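/- Let $d\in\mathbb N$, $T>0$, let $A,Q$ be symmetric real $d\times d$ matrices with $A$ strictly negative definite and $Q$ strictly positive definite, and let $W$ be a $d$-dimensional Brownian motion on a probability space $(\Omega,\mathcal F,\mathbb P)$. Let $f\in C([0,T];\mathbb R^d)$, let $B_0:[0,T]\times\mathbb R^d\to\mathbb R^d$ be Borel measurable with $|B_0(t,x)|\le C(1+|x|)^m$ for some constants $C,m$ and all $(t,x)$, and put $B(t,x)=B_0(t,x)-f(t)$. For $s\in[0,T]$, $x\in\mathbb R^d$ let $(Z^x_{s,t})_{t\in[s,T]}$ be the shifted Ornstein–Uhlenbeck process, i.e. the continuous solution of $$\mathrm dZ^x_{s,t}=(AZ^x_{s,t}+f(t))\,\mathrm dt+\sqrt Q\,\mathrm dW_t,\qquad t\in[s,T],\quad Z^x_{s,s}=x .$$ Put $(S_{s,t}\psi)(x)=\mathbb E[\psi(Z^x_{s,t})]$ and $$Q_t=\int_0^t e^{sA}Qe^{sA^*}\,\mathrm ds,\qquad \Lambda(t)=Q_t^{-1/2}e^{tA}\ (t>0),\qquad F_{s,t}=\int_s^t e^{(t-r)A}f(r)\,\mathrm dr .$$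 Let $\phi:\mathbb R^d\to\mathbb R$ be bounded and Borel measurable, and define, for $0\le s<t\le T$ and $n\ge0$, $$u^0_{s,t}=S_{s,t}\phi,\qquad u^{n+1}_{s,t}(x)=S_{s,t}\phi(x)+\int_s^t\big(S_{s,r}\langle B(r,\cdot),Du^n_{r,t}\rangle\big)(x)\,\mathrm dr,$$ and $v^0_{s,t}=u^0_{s,t}$, $v^n_{s,t}=u^n_{s,t}-u^{n-1}_{s,t}$ for $n\ge1$. Then the iteration is well defined: for all $n\ge 0$ and $0\le s<t\le T$ the function $u^n_{s,t}$ is differentiable on $\mathbb R^d$, and the expectation and the time integral defining $u^{n+1}_{s,t}(x)$ converge absolutely for every $x$. Moreover, for all $0\le s<t\le T$ and $x\in\mathbb R^d$: (a) For every $n\ge1$, setting $s_{n+1}=t$, $$v^n_{s,t}(x)=\int_s^t\mathrm ds_n\int_s^{s_n}\mathrm ds_{n-1}\cdots\int_s^{s_2}\mathrm ds_1\ \mathbb E\Big[\phi(Z^x_{s,t})\prod_{i=1}^n\Big\langle\Lambda(s_{i+1}-s_i)B(s_i,Z^x_{s,s_i}),\,Q^{-1/2}_{s_{i+1}-s_i}\big(Z^x_{s,s_{i+1}}-e^{(s_{i+1}-s_i)A}Z^x_{s,s_i}-F_{s_i,s_{i+1}}\big)\Big\rangle\Big],$$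 where the random variable under the expectation is integrable for all $s<s_1<\dots<s_n<t$ and, as a function of $(s_1,\dots,s_n,\omega)$, is integrable on $\{s<s_1<\dots<s_n<t\}\times\Omega$. (b) For every $n\ge0$, $$v^n_{s,t}(x)=\mathbb E\big[\phi(Z^x_{s,t})\,I^n_{s,t}(x)\big],$$ where $I^0_{s,t}(x)\equiv1$ and $$I^{n+1}_{s,t}(x)=\int_s^t\Big\langle\Lambda(t-r)B(r,Z^x_{s,r}),\,Q_{t-r}^{-1/2}\big(Z^x_{s,t}-e^{(t-r)A}Z^x_{s,r}-F_{r,t}\big)\Big\rangle I^n_{s,r}(x)\,\mathrm dr ;$$ these time integrals converge absolutely almost surely and $\phi(Z^x_{s,t})I^n_{s,t}(x)$ is integrable. -/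

import Mathlib

open MeasureTheory ProbabilityTheory
open scoped NNReal MatrixOrder

noncomputable section

namespace ShiftedOU

/-- The state space `ℝ^d` with its Euclidean structure. -/
abbrev E (d : ℕ) : Type := EuclideanSpace ℝ (Fin d)

/-- The action `x ↦ M x` of a `d × d` matrix on `ℝ^d`. -/
abbrev act {d : ℕ} (M : Matrix (Fin d) (Fin d) ℝ) (x : E d) : E d :=
  Matrix.toEuclideanCLM (n := Fin d) (𝕜 := ℝ) M x

/-- A `d`-dimensional Brownian motion: its coordinates are independent real Brownian motions. -/
structure IsBrownianMotion {Ω : Type*} [MeasurableSpace Ω] {d : ℕ}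
    (W : ℝ≥0 → Ω → E d) (P : Measure Ω) : Prop where
  coord : ∀ i : Fin d, IsBrownianReal (fun t ω => W t ω i) P
  indep : iIndepFun (fun (i : Fin d) (ω : Ω) (t : ℝ≥0) => W t ω i) P

/-- The matrix exponential `e^{tA}`. -/
def semigroup {d : ℕ} (A : Matrix (Fin d) (Fin d) ℝ) (t : ℝ) : Matrix (Fin d) (Fin d) ℝ :=
  NormedSpace.exp (t • A)

/-- `Q_t = ∫_0^t e^{sA} Q e^{sA*} ds`, the integral being taken entrywise. -/
def covMat {d : ℕ} (A Q : Matrix (Fin d) (Fin d) ℝ) (t : ℝ) : Matrix (Fin d) (Fin d) ℝ :=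
  Matrix.of fun i j => ∫ s in (0 : ℝ)..t, (semigroup A s * Q * (semigroup A s).transpose) i j

/-- `Q_t^{-1/2}`, the inverse of the nonnegative square root of `Q_t`. -/
def covInvSqrt {d : ℕ} (A Q : Matrix (Fin d) (Fin d) ℝ) (t : ℝ) : Matrix (Fin d) (Fin d) ℝ :=
  (CFC.sqrt (covMat A Q t))⁻¹

/-- `Λ(t) = Q_t^{-1/2} e^{tA}`. -/
def Lam {d : ℕ} (A Q : Matrix (Fin d) (Fin d) ℝ) (t : ℝ) : Matrix (Fin d) (Fin d) ℝ :=
  covInvSqrt A Q t * semigroup A t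

/-- `F_{s,t} = ∫_s^t e^{(t-r)A} f(r) dr`. -/
def shiftInt {d : ℕ} (A : Matrix (Fin d) (Fin d) ℝ) (f : ℝ → E d) (s t : ℝ) : E d :=
  ∫ r in s..t, act (semigroup A (t - r)) (f r)

/-- `X = (X_t)_{t ∈ [s,T]}` solves `dX_t = (A X_t + f(t)) dt + √Q dW_t` on `[s,T]`, `X_s = x`.
As the noise is additive, the stochastic integral `∫_s^t √Q dW_r` is `√Q (W_t - W_s)`. -/
def IsSolution {Ω : Type*} [MeasurableSpace Ω] {d : ℕ} (A Q : Matrix (Fin d) (Fin d) ℝ)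
    (f : ℝ → E d) (W : ℝ≥0 → Ω → E d) (P : Measure Ω) (T s : ℝ) (x : E d)
    (X : ℝ → Ω → E d) : Prop :=
  ∀ᵐ ω ∂P, ContinuousOn (fun t => X t ω) (Set.Icc s T) ∧
    ∀ t ∈ Set.Icc s T,
      X t ω = x + (∫ r in s..t, (act A (X r ω) + f r))
        + act (CFC.sqrt Q) (W t.toNNReal ω - W s.toNNReal ω)

/-- `B(t,x) = B₀(t,x) - f(t)`. -/
def shiftedDrift {d : ℕ} (B₀ : ℝ → E d → E d) (f : ℝ → E d) (t : ℝ) (x : E d) : E d :=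
  B₀ t x - f t

/-- The evolution operator `(S_{s,t} φ)(x) = 𝔼[φ(Z^x_{s,t})]`; here `Z s x t` is `Z^x_{s,t}`. -/
def evol {Ω : Type*} [MeasurableSpace Ω] {d : ℕ} (P : Measure Ω)
    (Z : ℝ → E d → ℝ → Ω → E d) (s t : ℝ) (φ : E d → ℝ) (x : E d) : ℝ :=
  ∫ ω, φ (Z s x t ω) ∂P

/-- The iterates `u^n_{s,t}(x)`: `u^0_{s,t} = S_{s,t} φ` and
`u^{n+1}_{s,t} = S_{s,t} φ + ∫_s^t S_{s,r} ⟨B(r,·), D u^n_{r,t}⟩ dr`. -/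
def iterU {Ω : Type*} [MeasurableSpace Ω] {d : ℕ} (P : Measure Ω)
    (Z : ℝ → E d → ℝ → Ω → E d) (B : ℝ → E d → E d) (φ : E d → ℝ) :
    ℕ → ℝ → ℝ → E d → ℝ
  | 0 => fun s t x => evol P Z s t φ x
  | n + 1 => fun s t x => evol P Z s t φ x +
      ∫ r in s..t,
        evol P Z s r (fun y => inner ℝ (B r y) (gradient (iterU P Z B φ n r t) y)) x

/-- The increments `v^0 = u^0` and `v^n = u^n - u^{n-1}` for `n ≥ 1`. -/
def incrV {Ω : Type*} [MeasurableSpace Ω] {d : ℕ} (P : Measure Ω)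
    (Z : ℝ → E d → ℝ → Ω → E d) (B : ℝ → E d → E d) (φ : E d → ℝ) :
    ℕ → ℝ → ℝ → E d → ℝ
  | 0 => fun s t x => iterU P Z B φ 0 s t x
  | n + 1 => fun s t x => iterU P Z B φ (n + 1) s t x - iterU P Z B φ n s t x

/-- `⟨Λ(t-r) B(r, X_r), Q_{t-r}^{-1/2} (X_t - e^{(t-r)A} X_r - F_{r,t})⟩` along a process `X`. -/
def pairing {Ω : Type*} {d : ℕ} (A Q : Matrix (Fin d) (Fin d) ℝ) (f : ℝ → E d)
    (B : ℝ → E d → E d) (X : ℝ → Ω → E d) (r t : ℝ) (ω : Ω) : ℝ :=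
  inner ℝ (act (Lam A Q (t - r)) (B r (X r ω)))
    (act (covInvSqrt A Q (t - r)) (X t ω - act (semigroup A (t - r)) (X r ω) - shiftInt A f r t))

/-- `φ(X_t) ∏_{i=1}^n ⟨Λ(s_{i+1}-s_i) B(s_i, X_{s_i}), Q_{s_{i+1}-s_i}^{-1/2}
(X_{s_{i+1}} - e^{(s_{i+1}-s_i)A} X_{s_i} - F_{s_i,s_{i+1}})⟩` with `s_{n+1} = t`.
The times `s_1, …, s_n` are `σ 0, …, σ (n-1)`. -/
def integrand {Ω : Type*} {d : ℕ} (A Q : Matrix (Fin d) (Fin d) ℝ) (f : ℝ → E d)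
    (B : ℝ → E d → E d) (φ : E d → ℝ) (X : ℝ → Ω → E d) (t : ℝ) (n : ℕ)
    (σ : Fin n → ℝ) (ω : Ω) : ℝ :=
  φ (X t ω) * ∏ i : Fin n,
    pairing A Q f B X ((Fin.snoc σ t : Fin (n + 1) → ℝ) i.castSucc)
      ((Fin.snoc σ t : Fin (n + 1) → ℝ) i.succ) ω

/-- The iterated integral `∫_s^t ds_n ∫_s^{s_n} ds_{n-1} ⋯ ∫_s^{s_2} ds_1 g(s_1, …, s_n)`. -/
def iteratedIntegral (s : ℝ) : (n : ℕ) → ((Fin n → ℝ) → ℝ) → ℝ → ℝ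
  | 0 => fun g _ => g Fin.elim0
  | n + 1 => fun g t =>
      ∫ r in s..t, iteratedIntegral s n (fun σ => g (Fin.snoc σ r : Fin (n + 1) → ℝ)) r

/-- The open simplex `s < s_1 < ⋯ < s_n < t`. -/
def timeSimplex (n : ℕ) (s t : ℝ) : Set (Fin n → ℝ) :=
  {σ | StrictMono σ ∧ ∀ i, σ i ∈ Set.Ioo s t}

/-- The random weights `I^n_{s,t}`: `I^0 = 1` and
`I^{n+1}_{s,t} = ∫_s^t ⟨Λ(t-r) B(r, X_r), Q_{t-r}^{-1/2} (X_t - e^{(t-r)A} X_r - F_{r,t})⟩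
I^n_{s,r} dr`. -/
def iterI {Ω : Type*} {d : ℕ} (A Q : Matrix (Fin d) (Fin d) ℝ) (f : ℝ → E d)
    (B : ℝ → E d → E d) (X : ℝ → Ω → E d) (s : ℝ) : ℕ → ℝ → Ω → ℝ
  | 0 => fun _ _ => 1
  | n + 1 => fun t ω => ∫ r in s..t, pairing A Q f B X r t ω * iterI A Q f B X s n r ω

end ShiftedOU

end

/-! Given its value y at time r, the process at time t is e^{(t-r)A}y + F_{r,t} + Q_{t-r}^{1/2} ξ
with ξ standard Gaussian and independent of the past up to r. Since e^{(t-r)A} = Q_{t-r}^{1/2}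
Λ(t-r), the starting point only translates the noise by Λ(t-r)y, and the Cameron–Martin formula
moves this translation from the merely measurable test function g to a smooth density. Hence
S_{r,t}g is differentiable and ⟨B(r,y), D S_{r,t}g(y)⟩ is the expectation of g(Z) times the weight
⟨Λ(t-r)B(r,y), ξ⟩. Call this weighted operator R_{r,t}. Differentiation under the time integrals
then shows that u^n is the n-th partial sum of a series whose n-th term is the integral of S_{s,s_1}
R_{s_1,s_2} ⋯ R_{s_n,t} φ over s < s_1 < ⋯ < s_n < t (`hasGradientAt_pull`, `inner_pull`,
`iterU_eq`).

Everything converges because Λ(t) = O(t^{-1/2}) and, on bounded time intervals, the convolution of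
two such singularities is again bounded by a multiple of (t-s)^{-1/2}; the polynomial growth of B is
absorbed by Gaussian moments. `StepSystem` and `Admissible` record exactly this. All kernels are set
to zero unless 0 ≤ s < t ≤ T, so time integrals can run over the whole line.

The scheme adds new times at the beginning of the chain, whereas the Markov property removes them at
the end. `pull_succ_eq` reconciles the two by Fubini; `integral_terminal_chain_succ` integrates out
the last noise, and `iteratedIntegral_terminal_chain` deduces (a) by induction with a varying
terminal function. The weights are those of the statement because ξ = Q_{t-r}^{-1/2}(Z_t -
e^{(t-r)A}Z_r - F_{r,t}). Part (b) is Fubini on simplex times Ω: for a fixed path, I^n is the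
iterated time integral of the product of weights (`integral_weight`).

The noise is handled path by path: integration by parts turns the stochastic convolution into an
ordinary integral, which is a limit of sums of independent Gaussian increments; characteristic
functions identify its law (`charFun_stochConv`), and it depends only on the increments after r,
whence the independence. -/

namespace ShiftedOU

/-! ### Gaussian moments, Cameron–Martin formula and smoothing. -/

section Gaussian

open Complex in
-- Fernique's theorem makes exp(b‖z‖²) integrable for some b > 0. The polynomial is dominated by an
-- exponential, and (1+c)‖z‖ ≤ b‖z‖² + (1+c)²/(4b) by completing the square.
lemma integrable_poly_mul_exp_stdGaussian {d : ℕ} (k : ℕ) (c : ℝ) :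
    Integrable (fun z : E d => (1 + ‖z‖) ^ k * Real.exp (c * ‖z‖)) (stdGaussian (E d)) := by
  obtain ⟨b, hb, hint⟩ := IsGaussian.exists_integrable_exp_sq (stdGaussian (E d))
  have hfac : (0 : ℝ) < k.factorial := by positivity
  refine Integrable.mono' (hint.const_mul
    (k.factorial * Real.exp (1 + (1 + c) ^ 2 / (4 * b)))) (by fun_prop) (.of_forall fun z => ?_)
  have hz := norm_nonneg z
  rw [Real.norm_of_nonneg (by positivity)]
  have h1 : (1 + ‖z‖) ^ k ≤ k.factorial * Real.exp (1 + ‖z‖) := by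
    have := Real.pow_div_factorial_le_exp (1 + ‖z‖) (by positivity) k
    rwa [div_le_iff₀ hfac, mul_comm] at this
  calc (1 + ‖z‖) ^ k * Real.exp (c * ‖z‖)
      ≤ k.factorial * Real.exp (1 + ‖z‖) * Real.exp (c * ‖z‖) := by gcongr
    _ = k.factorial * Real.exp (1 + (1 + c) * ‖z‖) := by
        rw [mul_assoc, ← Real.exp_add]; ring_nf
    _ ≤ k.factorial * Real.exp (1 + (1 + c) ^ 2 / (4 * b) + b * ‖z‖ ^ 2) := by
        refine mul_le_mul_of_nonneg_left (Real.exp_le_exp.2 ?_) hfac.le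
        have : 0 ≤ (2 * b * ‖z‖ - (1 + c)) ^ 2 / (4 * b) := by positivity
        have h2 : (2 * b * ‖z‖ - (1 + c)) ^ 2 / (4 * b)
            = b * ‖z‖ ^ 2 - (1 + c) * ‖z‖ + (1 + c) ^ 2 / (4 * b) := by
          field_simp; ring
        linarith
    _ = _ := by rw [Real.exp_add]; ring

lemma integrable_poly_stdGaussian {d : ℕ} (k : ℕ) :
    Integrable (fun z : E d => (1 + ‖z‖) ^ k) (stdGaussian (E d)) := by
  simpa using integrable_poly_mul_exp_stdGaussian (d := d) k 0

/-- The Cameron–Martin density of the shift of the standard Gaussian measure by `a`. -/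
noncomputable def shiftDensity {d : ℕ} (a z : E d) : ℝ := Real.exp (inner ℝ a z - ‖a‖ ^ 2 / 2)

lemma shiftDensity_nonneg {d : ℕ} (a z : E d) : 0 ≤ shiftDensity a z := Real.exp_nonneg _

lemma measurable_shiftDensity {d : ℕ} (a : E d) : Measurable (shiftDensity a) := by
  unfold shiftDensity; fun_prop

lemma shiftDensity_le {d : ℕ} (a z : E d) : shiftDensity a z ≤ Real.exp (‖a‖ * ‖z‖) := by
  unfold shiftDensity
  gcongr
  have := real_inner_le_norm a z
  have : 0 ≤ ‖a‖ ^ 2 := by positivity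
  linarith

lemma integrable_shiftDensity {d : ℕ} (a : E d) :
    Integrable (shiftDensity a) (stdGaussian (E d)) := by
  refine Integrable.mono' (integrable_poly_mul_exp_stdGaussian 0 ‖a‖)
    (measurable_shiftDensity a).aestronglyMeasurable (.of_forall fun z => ?_)
  rw [Real.norm_of_nonneg (shiftDensity_nonneg _ _)]
  simpa using shiftDensity_le a z

open Complex in
-- The integral factors over coordinates, and each factor is the complex moment generating function
-- of N(0,1) at a_i + i t_i. After subtracting a_i²/2, the exponent (a_i + i t_i)²/2 leaves i a_i
-- t_i - t_i²/2, so this is the characteristic function of N(a, 1).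
lemma integral_shiftDensity_mul_cexp {d : ℕ} (a t : E d) :
    ∫ z, (shiftDensity a z : ℂ) * cexp (inner ℝ z t * I) ∂(stdGaussian (E d))
      = cexp (inner ℝ a t * I - ‖t‖ ^ 2 / 2) := by
  rw [← map_pi_eq_stdGaussian, integral_map (by fun_prop)]
  · have h (x : Fin d → ℝ) : (shiftDensity a (WithLp.toLp 2 x) : ℂ) *
        cexp (inner ℝ (WithLp.toLp 2 x : E d) t * I)
        = cexp (-(‖a‖ ^ 2 / 2 : ℝ)) * ∏ i, cexp ((a i + t i * I) * x i) := by
      unfold shiftDensity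
      rw [← Complex.exp_sum, ofReal_exp, ← Complex.exp_add, ← Complex.exp_add]
      congr 1
      simp only [PiLp.inner_apply, RCLike.inner_apply, conj_trivial, ofReal_sub, ofReal_sum,
        ofReal_mul, add_mul, Finset.sum_add_distrib, Finset.sum_mul]
      simp only [sub_eq_add_neg, add_assoc, add_comm, add_left_comm, mul_comm, mul_left_comm]
    simp_rw [h]
    rw [integral_const_mul, integral_fintype_prod_eq_prod
      (f := fun i (x : ℝ) => cexp ((a i + t i * I) * x))]
    have h1 (i : Fin d) : ∫ x : ℝ, cexp ((a i + t i * I) * x) ∂(gaussianReal 0 1)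
        = cexp ((a i + t i * I) ^ 2 / 2) := by
      have := complexMGF_id_gaussianReal (μ := 0) (v := 1) (a i + t i * I)
      simpa [complexMGF] using this
    simp_rw [h1]
    rw [← Complex.exp_sum, ← Complex.exp_add]
    congr 1
    have e1 : ((‖a‖ : ℝ) : ℂ) ^ 2 = ∑ i, (a i : ℂ) ^ 2 := by
      rw [← ofReal_pow, EuclideanSpace.real_norm_sq_eq]; simp
    have e2 : ((‖t‖ : ℝ) : ℂ) ^ 2 = ∑ i, (t i : ℂ) ^ 2 := by
      rw [← ofReal_pow, EuclideanSpace.real_norm_sq_eq]; simp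
    have e3 : ((inner ℝ a t : ℝ) : ℂ) = ∑ i, (a i : ℂ) * t i := by
      simp [PiLp.inner_apply, mul_comm]
    push_cast
    rw [e1, e2, e3, Finset.sum_div, Finset.sum_div, Finset.sum_mul, ← Finset.sum_neg_distrib,
      ← Finset.sum_add_distrib, ← Finset.sum_sub_distrib]
    refine Finset.sum_congr rfl fun i _ => ?_
    linear_combination ((t i : ℂ) ^ 2 / 2) * I_sq
  · have := (measurable_shiftDensity a)
    fun_prop

/-- The Cameron–Martin formula for the standard Gaussian measure on `ℝ^d`. -/
lemma stdGaussian_map_add {d : ℕ} (a : E d) :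
    (stdGaussian (E d)).map (fun z => a + z)
      = (stdGaussian (E d)).withDensity (fun z => ENNReal.ofReal (shiftDensity a z)) := by
  have : IsFiniteMeasure
      ((stdGaussian (E d)).withDensity (fun z => ENNReal.ofReal (shiftDensity a z))) :=
    isFiniteMeasure_withDensity_ofReal (integrable_shiftDensity a).2
  have : IsProbabilityMeasure ((stdGaussian (E d)).map (fun z => a + z)) :=
    Measure.isProbabilityMeasure_map (by fun_prop)
  refine Measure.ext_of_charFun (funext fun t => ?_)
  have hd := measurable_shiftDensity a
  rw [charFun_apply, charFun_apply, integral_map (by fun_prop) (by fun_prop),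
    integral_withDensity_eq_integral_toReal_smul (by fun_prop) (by simp)]
  have h1 (z : E d) : (ENNReal.ofReal (shiftDensity a z)).toReal = shiftDensity a z :=
    ENNReal.toReal_ofReal (Real.exp_nonneg _)
  simp_rw [h1, Complex.real_smul]
  rw [integral_shiftDensity_mul_cexp]
  simp_rw [inner_add_left, Complex.ofReal_add, add_mul, Complex.exp_add]
  rw [integral_const_mul, ← charFun_apply, charFun_stdGaussian, ← Complex.exp_add]
  congr 1
  ring

lemma integral_add_stdGaussian {d : ℕ} {F : Type*} [NormedAddCommGroup F] [NormedSpace ℝ F]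
    (a : E d) (g : E d → F) :
    ∫ z, g (a + z) ∂(stdGaussian (E d)) = ∫ z, shiftDensity a z • g z ∂(stdGaussian (E d)) := by
  have hd := measurable_shiftDensity a
  refine ((MeasurableEquiv.addLeft a).measurableEmbedding.integral_map
    (μ := stdGaussian (E d)) g).symm.trans ?_
  change ∫ z, g z ∂((stdGaussian (E d)).map (fun z => a + z)) = _
  rw [stdGaussian_map_add, integral_withDensity_eq_integral_toReal_smul (by fun_prop) (by simp)]
  simp_rw [ENNReal.toReal_ofReal (shiftDensity_nonneg _ _)]

/-- Smoothing by the standard Gaussian measure: the derivative of `a ↦ 𝔼[g(a + ξ)]`. -/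
lemma hasFDerivAt_integral_add_stdGaussian {d : ℕ} {g : E d → ℝ} (hg : Measurable g) {C : ℝ}
    {k : ℕ} (hgb : ∀ z, |g z| ≤ C * (1 + ‖z‖) ^ k) (a : E d) :
    HasFDerivAt (fun a => ∫ z, g (a + z) ∂(stdGaussian (E d)))
      (∫ z, g (a + z) • innerSL ℝ z ∂(stdGaussian (E d))) a := by
  have hC : 0 ≤ C := by simpa using (abs_nonneg _).trans (hgb 0)
  -- As `g` is only measurable, the dependence on `a` is moved into the density. The derivative of
  -- the density brings down z - a, which translates back to the factor z of the claim.
  have key : ∫ z, g (a + z) • innerSL ℝ z ∂(stdGaussian (E d))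
      = ∫ z, (shiftDensity a z * g z) • innerSL ℝ (z - a) ∂(stdGaussian (E d)) := by
    have := integral_add_stdGaussian a (fun z => g z • innerSL ℝ (z - a))
    simpa [smul_smul] using this
  have key2 : (fun a => ∫ z, g (a + z) ∂(stdGaussian (E d)))
      = fun a => ∫ z, shiftDensity a z * g z ∂(stdGaussian (E d)) := by
    ext a; simpa using integral_add_stdGaussian a g
  rw [key, key2]
  have hmeas (a : E d) : Measurable (fun z => shiftDensity a z * g z) :=
    (measurable_shiftDensity a).mul hg
  refine hasFDerivAt_integral_of_dominated_of_fderiv_le (Metric.ball_mem_nhds a one_pos)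
    (F' := fun a z => (shiftDensity a z * g z) • innerSL ℝ (z - a))
    -- For b in the unit ball around a, ‖b‖ ≤ ‖a‖ + 1 controls the density, and ‖z - b‖ ≤ (1 +
    -- ‖a‖)(1 + ‖z‖) accounts for the extra power of 1 + ‖z‖.
    (bound := fun z => C * (1 + ‖a‖) * ((1 + ‖z‖) ^ (k + 1) * Real.exp ((‖a‖ + 1) * ‖z‖)))
    (.of_forall fun a => (hmeas a).aestronglyMeasurable) ?_ ?_ (.of_forall fun z b hb => ?_)
    ((integrable_poly_mul_exp_stdGaussian _ _).const_mul _) (.of_forall fun z b hb => ?_)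
  · refine Integrable.mono' (((integrable_poly_mul_exp_stdGaussian k ‖a‖)).const_mul C)
      (hmeas a).aestronglyMeasurable (.of_forall fun z => ?_)
    rw [norm_mul, Real.norm_of_nonneg (shiftDensity_nonneg _ _), Real.norm_eq_abs]
    calc _ ≤ Real.exp (‖a‖ * ‖z‖) * (C * (1 + ‖z‖) ^ k) :=
          mul_le_mul (shiftDensity_le a z) (hgb z) (abs_nonneg _) (Real.exp_nonneg _)
      _ = _ := by ring
  · exact ((hmeas a).aestronglyMeasurable).smul
      ((innerSL ℝ).continuous.measurable.comp (measurable_id.sub_const a)).aestronglyMeasurable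
  · rw [norm_smul, norm_mul, Real.norm_of_nonneg (shiftDensity_nonneg _ _), Real.norm_eq_abs,
      innerSL_apply_norm]
    have hb1 : ‖b‖ ≤ ‖a‖ + 1 := by
      have h1 : ‖b - a‖ < 1 := mem_ball_iff_norm.1 hb
      have h2 : ‖b‖ ≤ ‖a‖ + ‖b - a‖ := norm_le_norm_add_norm_sub' b a
      linarith
    have hzb : ‖z - b‖ ≤ (1 + ‖a‖) * (1 + ‖z‖) := by
      have := norm_sub_le z b
      nlinarith [norm_nonneg a, norm_nonneg z]
    calc shiftDensity b z * |g z| * ‖z - b‖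
        ≤ Real.exp ((‖a‖ + 1) * ‖z‖) * (C * (1 + ‖z‖) ^ k) * ((1 + ‖a‖) * (1 + ‖z‖)) := by
          have h3 : shiftDensity b z ≤ Real.exp ((‖a‖ + 1) * ‖z‖) :=
            (shiftDensity_le b z).trans (by gcongr)
          have := hgb z
          have := shiftDensity_nonneg b z
          gcongr
      _ = _ := by ring
  · have h1 : HasFDerivAt (fun b : E d => inner ℝ b z - ‖b‖ ^ 2 / 2) (innerSL ℝ (z - b)) b := by
      have h2 : HasFDerivAt (fun b : E d => inner ℝ b z) (innerSL ℝ z) b := by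
        have := (innerSL ℝ z).hasFDerivAt (x := b)
        simpa [real_inner_comm] using this
      have h3 := (hasStrictFDerivAt_norm_sq b).hasFDerivAt.mul_const (1 / 2 : ℝ)
      convert! h2.sub h3 using 1
      · ext; simp [div_eq_mul_inv]
      · ext; simp
    have h4 := (h1.exp).mul_const (g z)
    convert! h4 using 1
    simp only [shiftDensity, smul_smul]
    rw [mul_comm]

end Gaussian

end ShiftedOU

namespace ShiftedOU

/-! ### Iterated weighted kernels with a convolution-stable singularity. -/

section AbstractKernel

open scoped ENNReal

/-- A family of random maps `step s t x ξ` with noise law `γ`, together with a function `sing`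
of two times which is reproduced, up to a constant, under convolution. -/
structure StepSystem (X : Type*) [NormedAddCommGroup X] [MeasurableSpace X] where
  γ : Measure X
  prob : IsProbabilityMeasure γ
  step : ℝ → ℝ → X → X → X
  sing : ℝ → ℝ → ℝ≥0∞
  measurable_step : Measurable fun p : ℝ × ℝ × X × X => step p.1 p.2.1 p.2.2.1 p.2.2.2
  measurable_sing : Measurable fun p : ℝ × ℝ => sing p.1 p.2
  sing_ne_top : ∀ s t, sing s t ≠ ∞
  lintegral_sing_mul : ∃ C : ℝ≥0, ∀ s t, ∫⁻ r, sing s r * sing r t ≤ C * sing s t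

namespace StepSystem

variable {X : Type*} [NormedAddCommGroup X] [MeasurableSpace X] (S : StepSystem X)

instance : IsProbabilityMeasure S.γ := S.prob

/-- A weight whose moments against polynomials of the step are bounded by `sing`. -/
structure Admissible {F : Type*} [NormedAddCommGroup F] (h : ℝ → ℝ → X → X → F) : Prop where
  meas : StronglyMeasurable fun p : ℝ × ℝ × X × X => h p.1 p.2.1 p.2.2.1 p.2.2.2
  bound : ∀ k : ℕ, ∃ (C : ℝ≥0) (j : ℕ), ∀ s t x,
    ∫⁻ ξ, ‖h s t x ξ‖ₑ * (1 + ‖S.step s t x ξ‖ₑ) ^ k ∂S.γ ≤ C * S.sing s t * (1 + ‖x‖ₑ) ^ j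

/-- The `n`-fold iterated weighted operators, integrated over the intermediate times. -/
noncomputable def iter (wt : ℝ → ℝ → X → X → ℝ) (ψ : ℝ → X → ℝ) : ℕ → ℝ → ℝ → X → ℝ
  | 0 => fun s t x => ∫ ξ, ψ t (S.step s t x ξ) * wt s t x ξ ∂S.γ
  | n + 1 => fun s t x => ∫ r, ∫ ξ, iter wt ψ n r t (S.step s r x ξ) * wt s r x ξ ∂S.γ

/-- The operators of `iter` with the first weight replaced by `h`. -/
noncomputable def pull {F : Type*} [NormedAddCommGroup F] [NormedSpace ℝ F]
    (wt : ℝ → ℝ → X → X → ℝ) (h : ℝ → ℝ → X → X → F) (ψ : ℝ → X → ℝ) : ℕ → ℝ → ℝ → X → F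
  | 0 => fun s t x => ∫ ξ, ψ t (S.step s t x ξ) • h s t x ξ ∂S.γ
  | n + 1 => fun s t x => ∫ r, ∫ ξ, S.iter wt ψ n r t (S.step s r x ξ) • h s r x ξ ∂S.γ

lemma pull_self (wt : ℝ → ℝ → X → X → ℝ) (ψ : ℝ → X → ℝ) (n : ℕ) :
    S.pull wt wt ψ n = S.iter wt ψ n := by
  cases n <;> rfl

variable {F : Type*} [NormedAddCommGroup F] [NormedSpace ℝ F]
  {wt : ℝ → ℝ → X → X → ℝ} {h : ℝ → ℝ → X → X → F} {ψ : ℝ → X → ℝ}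

variable {S}

lemma stronglyMeasurable_pull_zero (hh : S.Admissible h)
    (hψ : Measurable fun p : ℝ × X => ψ p.1 p.2) :
    StronglyMeasurable fun p : ℝ × ℝ × X => S.pull wt h ψ 0 p.1 p.2.1 p.2.2 := by
  refine StronglyMeasurable.integral_prod_right
    (f := fun (p : ℝ × ℝ × X) ξ => ψ p.2.1 (S.step p.1 p.2.1 p.2.2 ξ) • h p.1 p.2.1 p.2.2 ξ) ?_
  have h1 : Measurable fun q : (ℝ × ℝ × X) × X => (q.1.1, q.1.2.1, q.1.2.2, q.2) := by fun_prop
  have h2 : Measurable fun q : (ℝ × ℝ × X) × X =>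
      (q.1.2.1, S.step q.1.1 q.1.2.1 q.1.2.2 q.2) :=
    Measurable.prodMk (by fun_prop) (S.measurable_step.comp h1)
  exact (hψ.comp h2).stronglyMeasurable.smul (hh.meas.comp_measurable h1)

lemma stronglyMeasurable_integral_step_smul (hh : S.Admissible h) {Φ : ℝ → ℝ → X → ℝ}
    (hΦ : Measurable fun p : ℝ × ℝ × X => Φ p.1 p.2.1 p.2.2) :
    StronglyMeasurable fun p : (ℝ × ℝ × X) × ℝ =>
      ∫ ξ, Φ p.2 p.1.2.1 (S.step p.1.1 p.2 p.1.2.2 ξ) • h p.1.1 p.2 p.1.2.2 ξ ∂S.γ := by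
  refine StronglyMeasurable.integral_prod_right (f := fun (p : (ℝ × ℝ × X) × ℝ) ξ =>
    Φ p.2 p.1.2.1 (S.step p.1.1 p.2 p.1.2.2 ξ) • h p.1.1 p.2 p.1.2.2 ξ) ?_
  have h1 : Measurable fun q : ((ℝ × ℝ × X) × ℝ) × X =>
      (q.1.1.1, q.1.2, q.1.1.2.2, q.2) := by fun_prop
  have h2 : Measurable fun q : ((ℝ × ℝ × X) × ℝ) × X =>
      (q.1.2, q.1.1.2.1, S.step q.1.1.1 q.1.2 q.1.1.2.2 q.2) :=
    Measurable.prodMk (by fun_prop) (Measurable.prodMk (by fun_prop) (S.measurable_step.comp h1))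
  exact (hΦ.comp h2).stronglyMeasurable.smul (hh.meas.comp_measurable h1)

lemma measurable_iter (hwt : S.Admissible wt) (hψ : Measurable fun p : ℝ × X => ψ p.1 p.2)
    (n : ℕ) : Measurable fun p : ℝ × ℝ × X => S.iter wt ψ n p.1 p.2.1 p.2.2 := by
  induction n with
  | zero => exact (stronglyMeasurable_pull_zero (wt := wt) hwt hψ).measurable
  | succ n ih =>
    exact (StronglyMeasurable.integral_prod_right' (ν := volume)
      (stronglyMeasurable_integral_step_smul hwt ih)).measurable

lemma lintegral_smul_le {C : ℝ≥0∞} {k : ℕ} {g : X → ℝ}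
    (hg : ∀ z, ‖g z‖ₑ ≤ C * (1 + ‖z‖ₑ) ^ k) (hC : C ≠ ∞) {D : ℝ≥0∞} {s t : ℝ} {x : X}
    (hD : ∫⁻ ξ, ‖h s t x ξ‖ₑ * (1 + ‖S.step s t x ξ‖ₑ) ^ k ∂S.γ ≤ D) :
    ∫⁻ ξ, ‖g (S.step s t x ξ) • h s t x ξ‖ₑ ∂S.γ ≤ C * D := by
  calc ∫⁻ ξ, ‖g (S.step s t x ξ) • h s t x ξ‖ₑ ∂S.γ
      ≤ ∫⁻ ξ, C * (‖h s t x ξ‖ₑ * (1 + ‖S.step s t x ξ‖ₑ) ^ k) ∂S.γ := by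
        refine lintegral_mono fun ξ => ?_
        rw [enorm_smul]
        calc _ ≤ C * (1 + ‖S.step s t x ξ‖ₑ) ^ k * ‖h s t x ξ‖ₑ := by gcongr; exact hg _
          _ = _ := by ring
    _ = C * _ := lintegral_const_mul' _ _ hC
    _ ≤ C * D := by gcongr

lemma enorm_pull_succ_le {C : ℝ≥0∞} {k : ℕ} {n : ℕ} {t : ℝ}
    (hg : ∀ r z, ‖S.iter wt ψ n r t z‖ₑ ≤ C * S.sing r t * (1 + ‖z‖ₑ) ^ k) (hC : C ≠ ∞)
    {D D' : ℝ≥0∞} {s : ℝ} {x : X}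
    (hD : ∀ r, ∫⁻ ξ, ‖h s r x ξ‖ₑ * (1 + ‖S.step s r x ξ‖ₑ) ^ k ∂S.γ ≤ D * S.sing s r)
    (hD' : ∫⁻ r, S.sing s r * S.sing r t ≤ D') :
    ∫⁻ r, ∫⁻ ξ, ‖S.iter wt ψ n r t (S.step s r x ξ) • h s r x ξ‖ₑ ∂S.γ ≤ C * D * D' := by
  calc _ ≤ ∫⁻ r, C * D * (S.sing s r * S.sing r t) := by
        refine lintegral_mono fun r => ?_
        refine (lintegral_smul_le (hg r) (ENNReal.mul_ne_top hC (S.sing_ne_top r t))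
          (hD r)).trans (le_of_eq ?_)
        ring
    _ = C * D * ∫⁻ r, S.sing s r * S.sing r t :=
        lintegral_const_mul _ ((S.measurable_sing.comp (by fun_prop :
          Measurable fun r : ℝ => (s, r))).mul (S.measurable_sing.comp (by fun_prop :
          Measurable fun r : ℝ => (r, t))))
    _ ≤ _ := by gcongr

/-- Growth bound for the iterates. -/
lemma enorm_iter_le (hwt : S.Admissible wt) (n k : ℕ) : ∃ (C : ℝ≥0) (j : ℕ),
    ∀ (ψ : ℝ → X → ℝ) (t : ℝ) (w : ℝ≥0∞), w ≠ ∞ → (∀ z, ‖ψ t z‖ₑ ≤ w * (1 + ‖z‖ₑ) ^ k) →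
      ∀ s x, ‖S.iter wt ψ n s t x‖ₑ ≤ C * w * S.sing s t * (1 + ‖x‖ₑ) ^ j := by
  induction n with
  | zero =>
    obtain ⟨C, j, hC⟩ := hwt.bound k
    refine ⟨C, j, fun ψ t w hw hψ s x => (enorm_integral_le_lintegral_enorm _).trans ?_⟩
    refine (lintegral_smul_le hψ hw (hC s t x)).trans (le_of_eq ?_)
    ring
  | succ n ih =>
    obtain ⟨C, j, hC⟩ := ih
    obtain ⟨D, l, hD⟩ := hwt.bound j
    obtain ⟨D', hD'⟩ := S.lintegral_sing_mul
    refine ⟨C * D * D', l, fun ψ t w hw hψ s x => ?_⟩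
    refine (enorm_integral_le_lintegral_enorm _).trans
      ((lintegral_mono fun r => enorm_integral_le_lintegral_enorm _).trans ?_)
    refine (enorm_pull_succ_le (wt := wt) (h := wt) (D := D * (1 + ‖x‖ₑ) ^ l)
      (hC ψ t w hw hψ) (by finiteness)
      (fun r => (hD s r x).trans (le_of_eq (by ring))) (hD' s t)).trans (le_of_eq ?_)
    push_cast
    ring

/-- Joint bound for the weighted iterates in front of which a weight `h` is put. -/
lemma lintegral_pull_succ_le (hwt : S.Admissible wt) (hh : S.Admissible h) (n k : ℕ) :
    ∃ (C : ℝ≥0) (j : ℕ),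
    ∀ (ψ : ℝ → X → ℝ) (t : ℝ) (w : ℝ≥0∞), w ≠ ∞ → (∀ z, ‖ψ t z‖ₑ ≤ w * (1 + ‖z‖ₑ) ^ k) →
      ∀ s r x, ∫⁻ ξ, ‖S.iter wt ψ n r t (S.step s r x ξ) • h s r x ξ‖ₑ ∂S.γ
        ≤ C * w * (S.sing s r * S.sing r t) * (1 + ‖x‖ₑ) ^ j := by
  obtain ⟨C, j, hC⟩ := enorm_iter_le hwt n k
  obtain ⟨D, l, hD⟩ := hh.bound j
  refine ⟨C * D, l, fun ψ t w hw hψ s r x => ?_⟩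
  have := S.sing_ne_top r t
  refine (lintegral_smul_le (fun z => hC ψ t w hw hψ r z) (by finiteness) (hD s r x)).trans
    (le_of_eq ?_)
  push_cast
  ring

lemma measurable_sing_left (S : StepSystem X) (t : ℝ) : Measurable fun r => S.sing r t :=
  S.measurable_sing.comp (by fun_prop : Measurable fun r : ℝ => (r, t))

lemma measurable_sing_right (S : StepSystem X) (s : ℝ) : Measurable fun r => S.sing s r :=
  S.measurable_sing.comp (by fun_prop : Measurable fun r : ℝ => (s, r))

lemma integrable_pull_zero (hh : S.Admissible h) (hψ : Measurable fun p : ℝ × X => ψ p.1 p.2)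
    {k : ℕ} {t : ℝ} {w : ℝ≥0∞} (hw : w ≠ ∞) (hψw : ∀ z, ‖ψ t z‖ₑ ≤ w * (1 + ‖z‖ₑ) ^ k)
    (s : ℝ) (x : X) : Integrable (fun ξ => ψ t (S.step s t x ξ) • h s t x ξ) S.γ := by
  obtain ⟨C, j, hC⟩ := hh.bound k
  have h1 : Measurable fun ξ : X => (s, t, x, ξ) := by fun_prop
  have h2 : Measurable fun ξ : X => (t, S.step s t x ξ) :=
    measurable_const.prodMk (S.measurable_step.comp h1)
  refine ⟨((hψ.comp h2).stronglyMeasurable.smul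
    (hh.meas.comp_measurable h1)).aestronglyMeasurable, ?_⟩
  have := S.sing_ne_top s t
  exact (lintegral_smul_le hψw hw (hC s t x)).trans_lt (by finiteness)

lemma integrable_pull_succ (hwt : S.Admissible wt) (hh : S.Admissible h)
    (hψ : Measurable fun p : ℝ × X => ψ p.1 p.2) (n : ℕ)
    {k : ℕ} {t : ℝ} {w : ℝ≥0∞} (hw : w ≠ ∞) (hψw : ∀ z, ‖ψ t z‖ₑ ≤ w * (1 + ‖z‖ₑ) ^ k)
    (s : ℝ) (x : X) :
    (∀ r, Integrable (fun ξ => S.iter wt ψ n r t (S.step s r x ξ) • h s r x ξ) S.γ) ∧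
    Integrable (fun r => ∫ ξ, S.iter wt ψ n r t (S.step s r x ξ) • h s r x ξ ∂S.γ) := by
  obtain ⟨C, j, hC⟩ := lintegral_pull_succ_le hwt hh n k
  obtain ⟨D, hD⟩ := S.lintegral_sing_mul
  have hfin := S.sing_ne_top
  constructor
  · intro r
    have h1 : Measurable fun ξ : X => (s, r, x, ξ) := by fun_prop
    have h2 : Measurable fun ξ : X => (r, t, S.step s r x ξ) :=
      measurable_const.prodMk (measurable_const.prodMk (S.measurable_step.comp h1))
    refine ⟨(((measurable_iter hwt hψ n).comp h2).stronglyMeasurable.smul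
      (hh.meas.comp_measurable h1)).aestronglyMeasurable, ?_⟩
    have := hfin s r
    have := hfin r t
    exact (hC ψ t w hw hψw s r x).trans_lt (by finiteness)
  · refine ⟨((stronglyMeasurable_integral_step_smul hh (measurable_iter hwt hψ n)).comp_measurable
      (by fun_prop : Measurable fun r : ℝ => ((s, t, x), r))).aestronglyMeasurable, ?_⟩
    calc ∫⁻ r, ‖∫ ξ, S.iter wt ψ n r t (S.step s r x ξ) • h s r x ξ ∂S.γ‖ₑ
        ≤ ∫⁻ r, (C * w * (1 + ‖x‖ₑ) ^ j) * (S.sing s r * S.sing r t) := by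
          refine lintegral_mono fun r => (enorm_integral_le_lintegral_enorm _).trans
            ((hC ψ t w hw hψw s r x).trans (le_of_eq (by ring)))
      _ = (C * w * (1 + ‖x‖ₑ) ^ j) * ∫⁻ r, S.sing s r * S.sing r t :=
          lintegral_const_mul _ ((S.measurable_sing_right s).mul (S.measurable_sing_left t))
      _ ≤ (C * w * (1 + ‖x‖ₑ) ^ j) * (D * S.sing s t) := by gcongr; exact hD s t
      _ < ∞ := by have := hfin s t; finiteness

/-- Interchange of the first and of the last time integration. -/
theorem pull_succ_eq (hwt : S.Admissible wt) (hψ : Measurable fun p : ℝ × X => ψ p.1 p.2)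
    {k : ℕ} {t : ℝ} {w : ℝ≥0∞} (hw : w ≠ ∞) (hψw : ∀ z, ‖ψ t z‖ₑ ≤ w * (1 + ‖z‖ₑ) ^ k)
    (n : ℕ) : ∀ {F : Type} [NormedAddCommGroup F] [NormedSpace ℝ F] [CompleteSpace F]
       {h : ℝ → ℝ → X → X → F},
      S.Admissible h → ∀ s x, S.pull wt h ψ (n + 1) s t x
        = ∫ q, S.pull wt h (fun q z => S.iter wt ψ 0 q t z) n s q x := by
  induction n with
  | zero => exact fun _ _ _ => rfl
  | succ n ih =>
    intro F _ _ _ h hh s x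
    set ψ' : ℝ → X → ℝ := fun q z => S.iter wt ψ 0 q t z with hψ'
    obtain ⟨C₀, j₀, hC₀⟩ := enorm_iter_le hwt 0 k
    obtain ⟨C, j, hC⟩ := lintegral_pull_succ_le hwt hh n j₀
    obtain ⟨D, hD⟩ := S.lintegral_sing_mul
    have hfin := S.sing_ne_top
    have hψ'm : Measurable fun p : ℝ × X => ψ' p.1 p.2 :=
      (measurable_iter hwt hψ 0).comp (by fun_prop : Measurable fun p : ℝ × X => (p.1, t, p.2))
    -- The new terminal function is singular as q approaches t. The growth bounds are uniform in the
    -- terminal function and linear in its size `w`, so the factor `S.sing q t` simply travels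
    -- along.
    have hψ'b (q : ℝ) (z : X) : ‖ψ' q z‖ₑ ≤ (C₀ * w * S.sing q t) * (1 + ‖z‖ₑ) ^ j₀ :=
      hC₀ ψ t w hw hψw q z
    have hwq (q : ℝ) : C₀ * w * S.sing q t ≠ ∞ := by have := hfin q t; finiteness
    have hI (r q : ℝ) : ∫⁻ ξ, ‖S.iter wt ψ' n r q (S.step s r x ξ) • h s r x ξ‖ₑ ∂S.γ
        ≤ (C * C₀ * w * (1 + ‖x‖ₑ) ^ j * S.sing s r) * (S.sing r q * S.sing q t) :=
      (hC ψ' q _ (hwq q) (hψ'b q) s r x).trans (le_of_eq (by ring))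
    have hI2 (r : ℝ) : ∫⁻ q, (C * C₀ * w * (1 + ‖x‖ₑ) ^ j * S.sing s r) *
        (S.sing r q * S.sing q t)
        ≤ (C * C₀ * w * (1 + ‖x‖ₑ) ^ j * D) * (S.sing s r * S.sing r t) := by
      rw [lintegral_const_mul _ (show Measurable fun q => S.sing r q * S.sing q t from
        (S.measurable_sing_right r).mul (S.measurable_sing_left t))]
      calc _ ≤ (C * C₀ * w * (1 + ‖x‖ₑ) ^ j * S.sing s r) * (D * S.sing r t) := by
            gcongr; exact hD r t
        _ = _ := by ring
    have hm := measurable_iter hwt hψ'm n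
    -- The induction hypothesis is needed for the weight `wt` in place of `h`, which is why `F` and
    -- `h` are quantified inside the induction.
    have step1 (r : ℝ) (y : X) : S.iter wt ψ (n + 1) r t y = ∫ q, S.iter wt ψ' n r q y := by
      simpa only [pull_self] using ih hwt r y
    -- The last time q is moved outward twice: here past the first noise, and in the final `calc`
    -- past the first time r. Absolute convergence comes from convolving `sing` once and then a
    -- second time.
    have hswap1 (r : ℝ) :
        ∫ ξ, S.iter wt ψ (n + 1) r t (S.step s r x ξ) • h s r x ξ ∂S.γ
          = ∫ q, ∫ ξ, S.iter wt ψ' n r q (S.step s r x ξ) • h s r x ξ ∂S.γ := by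
      simp_rw [step1, ← integral_smul_const]
      refine integral_integral_swap (f := fun ξ q =>
        S.iter wt ψ' n r q (S.step s r x ξ) • h s r x ξ) ?_
      have h1 : Measurable fun p : X × ℝ => (s, r, x, p.1) := by fun_prop
      have h2 : Measurable fun p : X × ℝ => (r, p.2, S.step s r x p.1) :=
        measurable_const.prodMk (measurable_snd.prodMk (S.measurable_step.comp h1))
      have h3 : StronglyMeasurable (Function.uncurry fun ξ q =>
        S.iter wt ψ' n r q (S.step s r x ξ) • h s r x ξ) :=
        (hm.comp h2).stronglyMeasurable.smul (hh.meas.comp_measurable h1)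
      refine ⟨h3.aestronglyMeasurable, ?_⟩
      rw [hasFiniteIntegral_iff_enorm, lintegral_prod_symm' _ h3.enorm]
      refine ((lintegral_mono fun q => hI r q).trans (hI2 r)).trans_lt ?_
      have := hfin s r
      have := hfin r t
      finiteness
    calc S.pull wt h ψ (n + 1 + 1) s t x
        = ∫ r, ∫ q, ∫ ξ, S.iter wt ψ' n r q (S.step s r x ξ) • h s r x ξ ∂S.γ :=
          integral_congr_ae (.of_forall hswap1)
      _ = ∫ q, S.pull wt h ψ' (n + 1) s q x := by
          refine integral_integral_swap (f := fun r q => ∫ ξ,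
            S.iter wt ψ' n r q (S.step s r x ξ) • h s r x ξ ∂S.γ) ?_
          have h3 : StronglyMeasurable (Function.uncurry fun r q => ∫ ξ,
              S.iter wt ψ' n r q (S.step s r x ξ) • h s r x ξ ∂S.γ) :=
            (stronglyMeasurable_integral_step_smul hh hm).comp_measurable
              (by fun_prop : Measurable fun p : ℝ × ℝ => ((s, p.2, x), p.1))
          refine ⟨h3.aestronglyMeasurable, ?_⟩
          rw [hasFiniteIntegral_iff_enorm, lintegral_prod _ h3.enorm.aemeasurable]
          calc _ ≤ ∫⁻ r, (C * C₀ * w * (1 + ‖x‖ₑ) ^ j * D) * (S.sing s r * S.sing r t) := by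
                refine lintegral_mono fun r => le_trans (lintegral_mono fun q => ?_) (hI2 r)
                exact (enorm_integral_le_lintegral_enorm _).trans (hI r q)
            _ = (C * C₀ * w * (1 + ‖x‖ₑ) ^ j * D) * ∫⁻ r, S.sing s r * S.sing r t :=
                lintegral_const_mul _ ((S.measurable_sing_right s).mul (S.measurable_sing_left t))
            _ ≤ (C * C₀ * w * (1 + ‖x‖ₑ) ^ j * D) * (D * S.sing s t) := by
                gcongr; exact hD s t
            _ < ∞ := by have := hfin s t; finiteness

end StepSystem

end AbstractKernel

end ShiftedOU

namespace ShiftedOU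

/-! ### Differentiating iterated kernels in the starting point. -/

section KernelGradient

open scoped ENNReal

lemma abs_le_of_enorm_le {X : Type*} [NormedAddCommGroup X] {g : X → ℝ} {c : ℝ≥0∞} (hc : c ≠ ∞)
    {j : ℕ} (hg : ∀ z, ‖g z‖ₑ ≤ c * (1 + ‖z‖ₑ) ^ j) (z : X) :
    |g z| ≤ c.toReal * (1 + ‖z‖) ^ j := by
  have h := ENNReal.toReal_mono (by finiteness) (hg z)
  rw [ENNReal.toReal_mul, ENNReal.toReal_pow, ENNReal.toReal_add (by simp) (by simp)] at h
  simpa using h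

namespace StepSystem

variable {X : Type} [NormedAddCommGroup X] [MeasurableSpace X] {S : StepSystem X}
  [InnerProductSpace ℝ X] [CompleteSpace X]
  {wt : ℝ → ℝ → X → X → ℝ} {χ : ℝ → ℝ → X → X → ℝ} {wv : ℝ → ℝ → X → X → X} {ψ : ℝ → X → ℝ}

variable (S) in
/-- The one-step operators with weight `χ` are smoothing: their gradient is the operator with the
vector weight `wv`. -/
def HasGradientWeight (χ : ℝ → ℝ → X → X → ℝ) (wv : ℝ → ℝ → X → X → X) : Prop :=
  ∀ s t (g : X → ℝ), Measurable g → ∀ (C : ℝ) (k : ℕ), (∀ z, |g z| ≤ C * (1 + ‖z‖) ^ k) → ∀ x,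
    HasGradientAt (fun x => ∫ ξ, g (S.step s t x ξ) • χ s t x ξ ∂S.γ)
      (∫ ξ, g (S.step s t x ξ) • wv s t x ξ ∂S.γ) x

/-- Only the first step depends on the starting point; what follows it is a measurable function of
polynomial growth, which that step smooths. The gradient passes under the time integral because it
is dominated, locally uniformly in x, by a multiple of `sing s r * sing r t`. -/
theorem hasGradientAt_pull (hgrad : S.HasGradientWeight χ wv) (hwt : S.Admissible wt)
    (hχ : S.Admissible χ) (hwv : S.Admissible wv) (hψ : Measurable fun p : ℝ × X => ψ p.1 p.2)
    {k : ℕ} {t : ℝ} {w : ℝ≥0∞} (hw : w ≠ ∞) (hψw : ∀ z, ‖ψ t z‖ₑ ≤ w * (1 + ‖z‖ₑ) ^ k)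
    (n : ℕ) (s : ℝ) (x : X) :
    HasGradientAt (S.pull wt χ ψ n s t) (S.pull wt wv ψ n s t x) x := by
  cases n with
  | zero =>
    exact hgrad s t (ψ t) (hψ.comp (by fun_prop : Measurable fun z : X => (t, z))) _ _
      (abs_le_of_enorm_le hw hψw) x
  | succ n =>
    obtain ⟨C, j, hC⟩ := lintegral_pull_succ_le hwt hwv n k
    obtain ⟨D, hD⟩ := S.lintegral_sing_mul
    obtain ⟨C', j', hC'⟩ := enorm_iter_le hwt n k
    have hfin := S.sing_ne_top
    have hI := integrable_pull_succ hwt hwv hψ n hw hψw s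
    have hIχ := integrable_pull_succ hwt hχ hψ n hw hψw s
    set G : X → ℝ → X := fun y r => ∫ ξ, S.iter wt ψ n r t (S.step s r y ξ) • wv s r y ξ ∂S.γ
    have key : ∫ r, (InnerProductSpace.toDual ℝ X (G x r) : X →L[ℝ] ℝ)
        = InnerProductSpace.toDual ℝ X (∫ r, G x r) := by
      have hint : Integrable (fun r => (InnerProductSpace.toDual ℝ X (G x r) : X →L[ℝ] ℝ)) :=
        ⟨(InnerProductSpace.toDual ℝ X).continuous.comp_aestronglyMeasurable (hI x).2.1, by
          have h2 := (hI x).2.2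
          rw [hasFiniteIntegral_iff_norm] at h2 ⊢
          simpa using h2⟩
      ext y
      rw [ContinuousLinearMap.integral_apply hint, InnerProductSpace.toDual_apply_apply,
        real_inner_comm, ← integral_inner (hI x).2]
      simp_rw [InnerProductSpace.toDual_apply_apply, real_inner_comm]
      rfl
    rw [hasGradientAt_iff_hasFDerivAt]
    change HasFDerivAt (fun y => ∫ r, ∫ ξ, S.iter wt ψ n r t (S.step s r y ξ) • χ s r y ξ ∂S.γ)
      (InnerProductSpace.toDual ℝ X (∫ r, G x r)) x
    rw [← key]
    refine hasFDerivAt_integral_of_dominated_of_fderiv_le (Metric.ball_mem_nhds x one_pos)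
      (F' := fun y r => (InnerProductSpace.toDual ℝ X (G y r) : X →L[ℝ] ℝ))
      -- On the unit ball around x one has 1 + ‖y‖ ≤ 2 + ‖x‖.
      (bound := fun r => (C * w * (2 + ‖x‖ₑ) ^ j * (S.sing s r * S.sing r t)).toReal)
      (.of_forall fun y => (hIχ y).2.1) (hIχ x).2
      ((InnerProductSpace.toDual ℝ X).continuous.comp_aestronglyMeasurable (hI x).2.1)
      (.of_forall fun r y hy => ?_) ?_ (.of_forall fun r y hy => ?_)
    · have hy1 : ‖y‖ₑ ≤ 1 + ‖x‖ₑ := by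
        have h1 : ‖y‖ ≤ ‖x‖ + ‖y - x‖ := norm_le_norm_add_norm_sub' y x
        have h2 : ‖y - x‖ < 1 := mem_ball_iff_norm.1 hy
        rw [enorm_eq_nnnorm, enorm_eq_nnnorm]
        have : ‖y‖₊ ≤ 1 + ‖x‖₊ := by
          rw [← NNReal.coe_le_coe]; push_cast; linarith
        exact_mod_cast this
      have h1 := hfin s r
      have h2 := hfin r t
      rw [LinearIsometryEquiv.norm_map, ← toReal_enorm]
      refine ENNReal.toReal_mono (by finiteness) ((enorm_integral_le_lintegral_enorm _).trans
        ((hC ψ t w hw hψw s r y).trans ?_))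
      calc _ ≤ C * w * (S.sing s r * S.sing r t) * (1 + (1 + ‖x‖ₑ)) ^ j := by gcongr
        _ = _ := by rw [← add_assoc, one_add_one_eq_two]; ring
    · have hm : Measurable fun r => S.sing s r * S.sing r t :=
        (S.measurable_sing_right s).mul (S.measurable_sing_left t)
      refine integrable_toReal_of_lintegral_ne_top (hm.const_mul _).aemeasurable ?_
      rw [lintegral_const_mul _ hm]
      refine ne_of_lt ?_
      calc _ ≤ (C * w * (2 + ‖x‖ₑ) ^ j) * (D * S.sing s t) := by gcongr; exact hD s t
        _ < ∞ := by have := hfin s t; finiteness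
    · have h2 := hfin r t
      rw [← hasGradientAt_iff_hasFDerivAt]
      exact hgrad s r (S.iter wt ψ n r t) ((measurable_iter hwt hψ n).comp
        (by fun_prop : Measurable fun z : X => (r, t, z))) _ _
        (abs_le_of_enorm_le (by finiteness) (hC' ψ t w hw hψw r)) y

/-- The pairing with `b s x` commutes with the Bochner integrals. Thus ⟨B, D·⟩ applied to an iterate
is again an iterate, now with the scalar weight in its first step, and the scheme reproduces itself.
-/
lemma inner_pull (hwt : S.Admissible wt) (hwv : S.Admissible wv) {b : ℝ → X → X}
    (hb : ∀ s t x ξ, wt s t x ξ = inner ℝ (b s x) (wv s t x ξ))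
    (hψ : Measurable fun p : ℝ × X => ψ p.1 p.2)
    {k : ℕ} {t : ℝ} {w : ℝ≥0∞} (hw : w ≠ ∞) (hψw : ∀ z, ‖ψ t z‖ₑ ≤ w * (1 + ‖z‖ₑ) ^ k)
    (n : ℕ) (s : ℝ) (x : X) :
    inner ℝ (b s x) (S.pull wt wv ψ n s t x) = S.iter wt ψ n s t x := by
  cases n with
  | zero =>
    change inner ℝ (b s x) (∫ ξ, ψ t (S.step s t x ξ) • wv s t x ξ ∂S.γ) = ∫ ξ, _ ∂S.γ
    rw [← integral_inner (integrable_pull_zero hwv hψ hw hψw s x)]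
    simp_rw [inner_smul_right, hb]
  | succ n =>
    have hI := integrable_pull_succ hwt hwv hψ n hw hψw s x
    change inner ℝ (b s x) (∫ r, ∫ ξ, _ ∂S.γ) = ∫ r, ∫ ξ, _ ∂S.γ
    rw [← integral_inner hI.2]
    refine integral_congr_ae (.of_forall fun r => ?_)
    simp only
    rw [← integral_inner (hI.1 r)]
    simp_rw [inner_smul_right, hb]

end StepSystem

end KernelGradient

end ShiftedOU

namespace ShiftedOU

/-! ### The covariance matrix Q_t, its square root and the t^{-1/2} bound. -/

section MatrixFacts

open Matrix
open scoped Matrix.Norms.L2Operator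

variable {d : ℕ}

lemma act_mul (M N : Matrix (Fin d) (Fin d) ℝ) (x : E d) : act (M * N) x = act M (act N x) := by
  simp [act]

lemma act_one (x : E d) : act (1 : Matrix (Fin d) (Fin d) ℝ) x = x := by simp [act]

lemma act_apply (M : Matrix (Fin d) (Fin d) ℝ) (x : E d) (i : Fin d) :
    act M x i = ∑ j, M i j * x j := by
  simp [act, Matrix.mulVec, dotProduct]

lemma inner_act (M : Matrix (Fin d) (Fin d) ℝ) (x y : E d) :
    inner ℝ x (act M y) = inner ℝ (act Mᵀ x) y := by
  simp only [PiLp.inner_apply, act_apply, RCLike.inner_apply, conj_trivial, Matrix.transpose_apply,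
    Finset.sum_mul, Finset.mul_sum]
  rw [Finset.sum_comm]
  exact Finset.sum_congr rfl fun i _ => Finset.sum_congr rfl fun j _ => by ring

lemma norm_act_le (M : Matrix (Fin d) (Fin d) ℝ) (x : E d) : ‖act M x‖ ≤ ‖M‖ * ‖x‖ :=
  (toEuclideanCLM (n := Fin d) (𝕜 := ℝ) M).le_opNorm x

lemma continuous_act_left (x : E d) : Continuous fun M : Matrix (Fin d) (Fin d) ℝ => act M x := by
  refine (PiLp.continuous_toLp 2 _).comp (continuous_pi fun i => ?_)
  change Continuous fun M : Matrix (Fin d) (Fin d) ℝ => act M x i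
  simp only [act_apply]
  exact continuous_finsetSum _ fun j _ => (continuous_id.matrix_elem i j).mul continuous_const

lemma measurable_act {α : Type*} [MeasurableSpace α] {M : α → Matrix (Fin d) (Fin d) ℝ}
    {x : α → E d} (hM : ∀ i j, Measurable fun a => M a i j) (hx : Measurable x) :
    Measurable fun a => act (M a) (x a) := by
  refine (WithLp.measurable_toLp 2 _).comp (measurable_pi_lambda _ fun i => ?_)
  change Measurable fun a => act (M a) (x a) i
  simp only [act_apply]
  have h (j : Fin d) : Measurable fun a => x a j :=
    (EuclideanSpace.proj (𝕜 := ℝ) j).continuous.measurable.comp hx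
  exact Finset.measurable_sum _ fun j _ => (hM i j).mul (h j)

variable (A Q : Matrix (Fin d) (Fin d) ℝ)

lemma hasDerivAt_semigroup (t : ℝ) : HasDerivAt (semigroup A) (semigroup A t * A) t := by
  exact hasDerivAt_exp_smul_const (𝕂 := ℝ) A t

lemma continuous_semigroup : Continuous (semigroup A) :=
  continuous_iff_continuousAt.2 fun t => (hasDerivAt_semigroup A t).continuousAt

lemma semigroup_add (s t : ℝ) : semigroup A (s + t) = semigroup A s * semigroup A t := by
  unfold semigroup
  rw [add_smul]
  exact Matrix.exp_add_of_commute _ _ (((Commute.refl A).smul_left s).smul_right t)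

lemma semigroup_zero : semigroup A 0 = 1 := by simp [semigroup]

lemma continuous_covMat_integrand :
    Continuous fun s => semigroup A s * Q * (semigroup A s)ᵀ := by
  have := continuous_semigroup A
  fun_prop

lemma continuous_covMat : Continuous (covMat A Q) := by
  refine continuous_matrix fun i j => ?_
  refine intervalIntegral.continuous_primitive (fun a b => Continuous.intervalIntegrable ?_ _ _) 0
  exact (continuous_covMat_integrand A Q).matrix_elem i j

/-- This formula serves twice: for the coercivity of Q_t and for identifying the variance of the
stochastic convolution. -/
lemma inner_covMat (x : E d) (t : ℝ) : inner ℝ x (act (covMat A Q t) x)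
    = ∫ s in (0 : ℝ)..t, inner ℝ (act (semigroup A s)ᵀ x) (act Q (act (semigroup A s)ᵀ x)) := by
  have h (s : ℝ) : inner ℝ (act (semigroup A s)ᵀ x) (act Q (act (semigroup A s)ᵀ x))
      = ∑ i, ∑ j, x i * ((semigroup A s * Q * (semigroup A s)ᵀ) i j * x j) := by
    rw [← inner_act, ← act_mul, ← act_mul]
    simp only [PiLp.inner_apply, act_apply, RCLike.inner_apply, conj_trivial, Finset.sum_mul]
    exact Finset.sum_congr rfl fun i _ => Finset.sum_congr rfl fun j _ => by ring
  simp_rw [h]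
  have hc (i j : Fin d) : Continuous fun s =>
      x i * ((semigroup A s * Q * (semigroup A s)ᵀ) i j * x j) :=
    continuous_const.mul (((continuous_covMat_integrand A Q).matrix_elem i j).mul continuous_const)
  rw [intervalIntegral.integral_finsetSum fun i _ =>
    (continuous_finsetSum _ fun j _ => hc i j).intervalIntegrable _ _]
  simp only [PiLp.inner_apply, act_apply, RCLike.inner_apply, conj_trivial, Finset.sum_mul]
  refine Finset.sum_congr rfl fun i _ => ?_
  rw [intervalIntegral.integral_finsetSum fun j _ => (hc i j).intervalIntegrable _ _]
  refine Finset.sum_congr rfl fun j _ => ?_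
  rw [intervalIntegral.integral_const_mul, intervalIntegral.integral_mul_const, covMat, of_apply]
  ring

variable {Q}

lemma sqrt_transpose (M : Matrix (Fin d) (Fin d) ℝ) : (CFC.sqrt M)ᵀ = CFC.sqrt M := by
  have := (CFC.sqrt_nonneg M).posSemidef.isHermitian
  simpa [IsHermitian, conjTranspose_eq_transpose_of_trivial] using this

lemma norm_sq_act_sqrt {M : Matrix (Fin d) (Fin d) ℝ} (hM : M.PosSemidef) (x : E d) :
    ‖act (CFC.sqrt M) x‖ ^ 2 = inner ℝ x (act M x) := by
  rw [← real_inner_self_eq_norm_sq, ← sqrt_transpose M, ← inner_act, ← act_mul, sqrt_transpose,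
    CFC.sqrt_mul_sqrt_self M hM.nonneg]

lemma isUnit_det_sqrt {M : Matrix (Fin d) (Fin d) ℝ} (hM : M.PosDef) :
    IsUnit (CFC.sqrt M).det := by
  have h1 := congrArg det (CFC.sqrt_mul_sqrt_self M hM.posSemidef.nonneg)
  rw [det_mul] at h1
  exact isUnit_iff_ne_zero.2 fun h0 => hM.det_pos.ne' (by rw [← h1, h0, zero_mul])

lemma act_inv_act {M : Matrix (Fin d) (Fin d) ℝ} (h : IsUnit M.det) (x : E d) :
    act M⁻¹ (act M x) = x := by
  rw [← act_mul, nonsing_inv_mul _ h, act_one]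

lemma act_act_inv {M : Matrix (Fin d) (Fin d) ℝ} (h : IsUnit M.det) (x : E d) :
    act M (act M⁻¹ x) = x := by
  rw [← act_mul, mul_nonsing_inv _ h, act_one]

lemma exists_norm_sq_le_inner {M : Matrix (Fin d) (Fin d) ℝ} (hM : M.PosDef) :
    ∃ K : ℝ, 0 ≤ K ∧ ∀ x : E d, ‖x‖ ^ 2 ≤ K * inner ℝ x (act M x) := by
  refine ⟨‖(CFC.sqrt M)⁻¹‖ ^ 2, by positivity, fun x => ?_⟩
  rw [← norm_sq_act_sqrt hM.posSemidef, ← mul_pow]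
  gcongr
  calc ‖x‖ = ‖act (CFC.sqrt M)⁻¹ (act (CFC.sqrt M) x)‖ := by
        rw [act_inv_act (isUnit_det_sqrt hM)]
    _ ≤ _ := norm_act_le _ _

lemma exists_norm_le_of_continuous {F : Type*} [NormedAddCommGroup F] {M : ℝ → F}
    (hM : Continuous M) (T : ℝ) : ∃ K : ℝ, 0 ≤ K ∧ ∀ t ∈ Set.Icc 0 T, ‖M t‖ ≤ K := by
  obtain ⟨K, hK⟩ := isCompact_Icc.exists_bound_of_continuousOn (s := Set.Icc 0 T) hM.continuousOn
  exact ⟨max K 0, le_max_right _ _, fun t ht => (hK t ht).trans (le_max_left _ _)⟩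

/-- Quantitative coercivity of Q_t: Q is coercive, and x is recovered from e^{sA*}x by e^{-sA*},
whose norm is bounded on [0,T]; integrating over [0,t] yields the factor t. Positive definiteness of
Q_t and the singularity of Q_t^{-1/2} both come from here. -/
lemma exists_mul_norm_sq_le (hQ : Q.PosDef) (T : ℝ) :
    ∃ K : ℝ, 0 ≤ K ∧ ∀ t ∈ Set.Icc 0 T, ∀ x : E d,
      t * ‖x‖ ^ 2 ≤ K * inner ℝ x (act (covMat A Q t) x) := by
  obtain ⟨K₁, hK₁, h₁⟩ := exists_norm_sq_le_inner hQ
  obtain ⟨K₂, hK₂, h₂⟩ := exists_norm_le_of_continuous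
    (M := fun s => (semigroup A (-s))ᵀ) (by have := continuous_semigroup A; fun_prop) T
  refine ⟨K₂ ^ 2 * K₁, by positivity, fun t ht x => ?_⟩
  have hc : Continuous fun s => inner ℝ (act (semigroup A s)ᵀ x)
      (act Q (act (semigroup A s)ᵀ x)) := by
    have h1 : Continuous fun s => act (semigroup A s)ᵀ x :=
      (continuous_act_left x).comp (continuous_semigroup A).matrix_transpose
    exact h1.inner ((toEuclideanCLM (n := Fin d) (𝕜 := ℝ) Q).continuous.comp h1)
  rw [inner_covMat, ← intervalIntegral.integral_const_mul]
  have h3 : t * ‖x‖ ^ 2 = ∫ s in (0 : ℝ)..t, ‖x‖ ^ 2 := by simp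
  rw [h3]
  refine intervalIntegral.integral_mono_on ht.1 (by simp)
    ((hc.const_mul _).intervalIntegrable _ _) fun s hs => ?_
  have h4 : x = act (semigroup A (-s))ᵀ (act (semigroup A s)ᵀ x) := by
    rw [← act_mul, ← transpose_mul, ← semigroup_add, add_neg_cancel, semigroup_zero,
      transpose_one, act_one]
  have h5 : ‖x‖ ≤ K₂ * ‖act (semigroup A s)ᵀ x‖ := by
    conv_lhs => rw [h4]
    exact (norm_act_le _ _).trans (by gcongr; exact h₂ s ⟨hs.1, hs.2.trans ht.2⟩)
  calc ‖x‖ ^ 2 ≤ (K₂ * ‖act (semigroup A s)ᵀ x‖) ^ 2 := by gcongr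
    _ = K₂ ^ 2 * ‖act (semigroup A s)ᵀ x‖ ^ 2 := by ring
    _ ≤ K₂ ^ 2 * (K₁ * _) := by gcongr; exact h₁ _
    _ = _ := by ring

lemma covMat_transpose (hQ : Q.PosDef) (t : ℝ) : (covMat A Q t)ᵀ = covMat A Q t := by
  have hQt : Qᵀ = Q := by
    simpa [IsHermitian, conjTranspose_eq_transpose_of_trivial] using hQ.isHermitian
  have h (s : ℝ) : (semigroup A s * Q * (semigroup A s)ᵀ)ᵀ
      = semigroup A s * Q * (semigroup A s)ᵀ := by
    rw [transpose_mul, transpose_mul, transpose_transpose, hQt, mul_assoc]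
  ext i j
  simp only [covMat, transpose_apply, of_apply]
  congr 1
  ext s
  exact congrFun (congrFun (h s) i) j

lemma inner_act_eq_dotProduct (M : Matrix (Fin d) (Fin d) ℝ) (x : E d) :
    inner ℝ x (act M x) = x.ofLp ⬝ᵥ M *ᵥ x.ofLp := by
  rw [act, inner_toEuclideanCLM]

lemma covMat_posSemidef (hQ : Q.PosDef) {t : ℝ} (ht : 0 ≤ t) : (covMat A Q t).PosSemidef := by
  obtain ⟨K, hK, h⟩ := exists_mul_norm_sq_le A hQ t
  refine PosSemidef.of_dotProduct_mulVec_nonneg ?_ fun x => ?_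
  · simp [IsHermitian, conjTranspose_eq_transpose_of_trivial, covMat_transpose A hQ]
  · have : star x ⬝ᵥ covMat A Q t *ᵥ x
        = inner ℝ (WithLp.toLp 2 x : E d) (act (covMat A Q t) (WithLp.toLp 2 x)) := by
      rw [inner_act_eq_dotProduct]; simp
    rw [this, inner_covMat]
    refine intervalIntegral.integral_nonneg ht fun s _ => ?_
    rw [← norm_sq_act_sqrt hQ.posSemidef]
    positivity

lemma covMat_posDef (hQ : Q.PosDef) {t : ℝ} (ht : 0 < t) : (covMat A Q t).PosDef := by
  obtain ⟨K, hK, h⟩ := exists_mul_norm_sq_le A hQ t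
  refine PosDef.of_dotProduct_mulVec_pos (covMat_posSemidef A hQ ht.le).isHermitian fun x hx => ?_
  have h1 : star x ⬝ᵥ covMat A Q t *ᵥ x
      = inner ℝ (WithLp.toLp 2 x : E d) (act (covMat A Q t) (WithLp.toLp 2 x)) := by
    rw [inner_act_eq_dotProduct]; simp
  rw [h1]
  have h2 := h t ⟨ht.le, le_rfl⟩ (WithLp.toLp 2 x)
  have h3 : 0 < ‖(WithLp.toLp 2 x : E d)‖ := norm_pos_iff.2 (by simpa using hx)
  have h4 : 0 < t * ‖(WithLp.toLp 2 x : E d)‖ ^ 2 := by positivity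
  by_contra hneg
  push Not at hneg
  nlinarith

lemma isUnit_det_sqrt_covMat (hQ : Q.PosDef) {t : ℝ} (ht : 0 < t) :
    IsUnit (CFC.sqrt (covMat A Q t)).det :=
  isUnit_det_sqrt (covMat_posDef A hQ ht)

/-- Coercivity applied to the vector Q_t^{-1/2}x reads t‖Q_t^{-1/2}x‖² ≤ K‖x‖². -/
lemma exists_norm_covInvSqrt_le (hQ : Q.PosDef) (T : ℝ) :
    ∃ K : ℝ, 0 ≤ K ∧ ∀ t ∈ Set.Ioc 0 T, ∀ x : E d,
      ‖act (covInvSqrt A Q t) x‖ ≤ K * (√t)⁻¹ * ‖x‖ := by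
  obtain ⟨K, hK, h⟩ := exists_mul_norm_sq_le A hQ T
  refine ⟨√K, by positivity, fun t ht x => ?_⟩
  have h1 := h t ⟨ht.1.le, ht.2⟩ (act (covInvSqrt A Q t) x)
  rw [← norm_sq_act_sqrt (covMat_posSemidef A hQ ht.1.le), covInvSqrt,
    act_act_inv (isUnit_det_sqrt_covMat A hQ ht.1)] at h1
  have ht0 : 0 < √t := Real.sqrt_pos.2 ht.1
  rw [mul_assoc, inv_mul_eq_div, ← mul_div_assoc, le_div_iff₀ ht0]
  refine le_of_sq_le_sq ?_ (by positivity)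
  rw [mul_pow, mul_pow, Real.sq_sqrt ht.1.le, Real.sq_sqrt hK, mul_comm]
  exact h1

/-- The square root is continuous on nonnegative matrices only, so time is truncated at 0; nothing
changes for the time differences that occur. -/
lemma continuous_sqrt_covMat (hQ : Q.PosDef) :
    Continuous fun t => CFC.sqrt (covMat A Q (max t 0)) :=
  CFC.continuousOn_sqrt.comp_continuous
    ((continuous_covMat A Q).comp (by fun_prop : Continuous fun t : ℝ => max t 0))
    fun t => (covMat_posSemidef A hQ (le_max_right _ _)).nonneg

/-- The inverse is written as the reciprocal determinant times the adjugate, which is measurable in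
t even where the determinant vanishes. -/
lemma measurable_covInvSqrt (hQ : Q.PosDef) (i j : Fin d) :
    Measurable fun t => covInvSqrt A Q (max t 0) i j := by
  have hc := continuous_sqrt_covMat A hQ
  simp only [covInvSqrt, inv_def, Matrix.smul_apply, Ring.inverse_eq_inv', smul_eq_mul]
  exact (hc.matrix_det.measurable.inv).mul (hc.matrix_adjugate.matrix_elem i j).measurable

end MatrixFacts

end ShiftedOU

namespace ShiftedOU

/-! ### The Ornstein–Uhlenbeck transition as a step system. -/

section OUStep

open Matrix Set
open scoped ENNReal Classical Matrix.Norms.L2Operator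

variable {d : ℕ} (A Q : Matrix (Fin d) (Fin d) ℝ) (f : ℝ → E d) (B : ℝ → E d → E d) (T : ℝ)

/-- Pairs of times `0 ≤ s < t ≤ T`. -/
def Valid (T s t : ℝ) : Prop := 0 ≤ s ∧ s < t ∧ t ≤ T

/-- One step of the shifted Ornstein–Uhlenbeck process, driven by the normalised noise `ξ`. -/
noncomputable def ouStep (s t : ℝ) (x ξ : E d) : E d :=
  if Valid T s t then act (semigroup A (t - s)) x + shiftInt A f s t
    + act (CFC.sqrt (covMat A Q (t - s))) ξ else 0

/-- The vector weight `Λ(t-s)ᵀ ξ`. -/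
noncomputable def ouVec (s t : ℝ) (_x ξ : E d) : E d :=
  if Valid T s t then act (Lam A Q (t - s))ᵀ ξ else 0

/-- The scalar weight `⟨Λ(t-s) B(s,x), ξ⟩`. -/
noncomputable def ouWt (s t : ℝ) (x ξ : E d) : ℝ := inner ℝ (B s x) (ouVec A Q T s t x ξ)

/-- The indicator of the admissible pairs of times, as a weight. -/
noncomputable def ouInd (s t : ℝ) (_x _ξ : E d) : ℝ := if Valid T s t then 1 else 0

/-- The singularity `(t-s)^{-1/2}`. -/
noncomputable def ouSing (s t : ℝ) : ℝ≥0∞ :=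
  if Valid T s t then ENNReal.ofReal (√(t - s))⁻¹ else 0

variable {A Q f B T}

lemma Valid.mem_left {s t : ℝ} (h : Valid T s t) : s ∈ Icc 0 T := ⟨h.1, h.2.1.le.trans h.2.2⟩

lemma Valid.sub_mem {s t : ℝ} (h : Valid T s t) : t - s ∈ Ioc 0 T :=
  ⟨sub_pos.2 h.2.1, by linarith [h.1, h.2.2]⟩

lemma Valid.trans {s r t : ℝ} (h : Valid T s r) (h' : Valid T r t) : Valid T s t :=
  ⟨h.1, h.2.1.trans h'.2.1, h'.2.2⟩

lemma Valid.left_of_mem_Ioo {s r t : ℝ} (h : Valid T s t) (hr : r ∈ Ioo s t) : Valid T s r :=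
  ⟨h.1, hr.1, hr.2.le.trans h.2.2⟩

lemma Valid.right_of_mem_Ioo {s r t : ℝ} (h : Valid T s t) (hr : r ∈ Ioo s t) : Valid T r t :=
  ⟨h.1.trans hr.1.le, hr.2, h.2.2⟩

lemma measurableSet_valid : MeasurableSet {p : ℝ × ℝ | Valid T p.1 p.2} :=
  (measurableSet_le measurable_const measurable_fst).inter
    ((measurableSet_lt measurable_fst measurable_snd).inter
      (measurableSet_le measurable_snd measurable_const))

/-- Allows the true expression to be replaced by a globally measurable one that agrees with it on
valid pairs, such as the version with t - s truncated at 0. -/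
lemma measurable_ite_valid {α F : Type*} [MeasurableSpace α] [MeasurableSpace F] [Zero F]
    {s t : α → ℝ} (hs : Measurable s) (ht : Measurable t) {g g' : α → F} (hg : Measurable g)
    (hgg' : ∀ a, Valid T (s a) (t a) → g' a = g a) :
    Measurable fun a => if Valid T (s a) (t a) then g' a else 0 := by
  have h : (fun a => if Valid T (s a) (t a) then g' a else 0)
      = fun a => if Valid T (s a) (t a) then g a else 0 := by
    ext a
    split_ifs with ha
    · exact hgg' a ha
    · rfl
  rw [h]
  exact Measurable.ite (measurableSet_valid.preimage (hs.prodMk ht)) hg measurable_const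

/-- Off [0,T] nothing is known about `f`, so it is extended by zero, and the variable limits of
integration become an indicator on the product space. -/
lemma measurable_shiftInt (hf : ContinuousOn f (Icc 0 T)) :
    Measurable fun p : ℝ × ℝ => if Valid T p.1 p.2 then shiftInt A f p.1 p.2 else 0 := by
  have hf' : Measurable ((Icc 0 T).indicator f) := by
    have := hf.measurable_piecewise (g := fun _ => (0 : E d)) continuousOn_const measurableSet_Icc
    rwa [← Set.piecewise_eq_indicator]
  have hg : Measurable fun q : (ℝ × ℝ) × ℝ => {q : (ℝ × ℝ) × ℝ | q.2 ∈ Ioc q.1.1 q.1.2}.indicator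
      (fun q => act (semigroup A (q.1.2 - q.2)) ((Icc 0 T).indicator f q.2)) q := by
    refine Measurable.indicator ?_ ?_
    · refine measurable_act (fun i j => ?_) (hf'.comp measurable_snd)
      exact ((continuous_semigroup A).matrix_elem i j).measurable.comp (by fun_prop)
    · exact (measurableSet_lt (measurable_fst.comp measurable_fst) measurable_snd).inter
        (measurableSet_le measurable_snd (measurable_snd.comp measurable_fst))
  refine measurable_ite_valid measurable_fst measurable_snd
    (hg.stronglyMeasurable.integral_prod_right' (ν := volume)).measurable fun p hp => ?_
  rw [shiftInt, intervalIntegral.integral_of_le hp.2.1.le, ← integral_indicator measurableSet_Ioc]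
  refine integral_congr_ae (.of_forall fun q => ?_)
  simp only [Set.indicator, mem_ofPred_eq]
  split_ifs with h1 h2
  · rfl
  · exact absurd ⟨hp.1.trans h1.1.le, h1.2.trans hp.2.2⟩ h2
  · rfl

lemma measurable_ouStep (hQ : Q.PosDef) (hf : ContinuousOn f (Icc 0 T)) :
    Measurable fun p : ℝ × ℝ × E d × E d => ouStep A Q f T p.1 p.2.1 p.2.2.1 p.2.2.2 := by
  have h1 : Measurable fun p : ℝ × ℝ × E d × E d => act (semigroup A (p.2.1 - p.1)) p.2.2.1 :=
    measurable_act (fun i j => ((continuous_semigroup A).matrix_elem i j).measurable.comp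
      (by fun_prop)) (by fun_prop)
  have h2 := (measurable_shiftInt (A := A) hf).comp
    (by fun_prop : Measurable fun p : ℝ × ℝ × E d × E d => (p.1, p.2.1))
  have h3 : Measurable fun p : ℝ × ℝ × E d × E d =>
      act (CFC.sqrt (covMat A Q (max (p.2.1 - p.1) 0))) p.2.2.2 :=
    measurable_act (fun i j => ((continuous_sqrt_covMat A hQ).matrix_elem i j).measurable.comp
      (by fun_prop : Measurable fun p : ℝ × ℝ × E d × E d => p.2.1 - p.1)) (by fun_prop)
  refine measurable_ite_valid (by fun_prop) (by fun_prop) ((h1.add h2).add h3) fun p hp => ?_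
  simp [hp, max_eq_left hp.sub_mem.1.le]

lemma measurable_covInvSqrt_sub (hQ : Q.PosDef) {α : Type*} [MeasurableSpace α] {s t : α → ℝ}
    (hs : Measurable s) (ht : Measurable t) (i j : Fin d) :
    Measurable fun a => covInvSqrt A Q (max (t a - s a) 0) i j :=
  (measurable_covInvSqrt A hQ i j).comp (ht.sub hs)

lemma measurable_Lam_sub (hQ : Q.PosDef) {α : Type*} [MeasurableSpace α] {s t : α → ℝ}
    (hs : Measurable s) (ht : Measurable t) (i j : Fin d) :
    Measurable fun a => Lam A Q (max (t a - s a) 0) i j := by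
  simp only [Lam, Matrix.mul_apply]
  exact Finset.measurable_sum _ fun k _ => (measurable_covInvSqrt_sub hQ hs ht i k).mul
    (((continuous_semigroup A).matrix_elem k j).measurable.comp ((ht.sub hs).max measurable_const))

lemma measurable_ouVec (hQ : Q.PosDef) :
    Measurable fun p : ℝ × ℝ × E d × E d => ouVec A Q T p.1 p.2.1 p.2.2.1 p.2.2.2 := by
  have h3 : Measurable fun p : ℝ × ℝ × E d × E d =>
      act (Lam A Q (max (p.2.1 - p.1) 0))ᵀ p.2.2.2 :=
    measurable_act (fun i j => measurable_Lam_sub hQ (by fun_prop) (by fun_prop) j i)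
      (by fun_prop)
  refine measurable_ite_valid (by fun_prop) (by fun_prop) h3 fun p hp => ?_
  simp [max_eq_left hp.sub_mem.1.le]

/-- The vector weight vanishes on invalid pairs, so `B` may be cut off outside [0,T], where it need
not be measurable. -/
lemma ouWt_eq (s t : ℝ) (x ξ : E d) : ouWt A Q B T s t x ξ
    = inner ℝ ((Icc 0 T).indicator (fun s => B s x) s) (ouVec A Q T s t x ξ) := by
  by_cases h : Valid T s t
  · rw [ouWt, indicator_of_mem h.mem_left]
  · simp [ouWt, ouVec, h]

lemma measurable_ouWt (hQ : Q.PosDef)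
    (hB : Measurable fun p : ℝ × E d => (Icc 0 T).indicator (fun s => B s p.2) p.1) :
    Measurable fun p : ℝ × ℝ × E d × E d => ouWt A Q B T p.1 p.2.1 p.2.2.1 p.2.2.2 := by
  simp only [ouWt_eq]
  exact (hB.comp (by fun_prop : Measurable fun p : ℝ × ℝ × E d × E d => (p.1, p.2.2.1))).inner
    (measurable_ouVec hQ)

lemma measurable_ouSing : Measurable fun p : ℝ × ℝ => ouSing T p.1 p.2 :=
  measurable_ite_valid measurable_fst measurable_snd
    (g := fun p => ENNReal.ofReal (√(p.2 - p.1))⁻¹) (by fun_prop) fun _ _ => rfl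

lemma ouSing_ne_top (s t : ℝ) : ouSing T s t ≠ ∞ := by
  unfold ouSing; split_ifs <;> simp

/-- The function `u^{-1/2}` on `(0,T]`. -/
noncomputable def invSqrtInd (T u : ℝ) : ℝ≥0∞ :=
  (Ioc 0 T).indicator (fun u => ENNReal.ofReal (√u)⁻¹) u

lemma lintegral_invSqrtInd_lt_top (T : ℝ) : ∫⁻ u, invSqrtInd T u < ∞ := by
  unfold invSqrtInd
  rw [lintegral_indicator measurableSet_Ioc]
  rcases le_or_gt T 0 with hT | hT
  · simp [hT]
  have h := (intervalIntegral.intervalIntegrable_rpow' (a := 0) (b := T) (r := -(1 / 2))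
    (by norm_num)).1
  refine lt_of_le_of_lt (setLIntegral_mono' measurableSet_Ioc fun u hu => ?_) h.2
  rw [Real.sqrt_eq_rpow, ← Real.rpow_neg hu.1.le]
  exact Real.ofReal_le_enorm _

lemma ouSing_le_left (s r : ℝ) : ouSing T s r ≤ invSqrtInd T (r - s) := by
  unfold ouSing invSqrtInd
  split_ifs with h
  · rw [indicator_of_mem h.sub_mem]
  · exact zero_le

/-- This is √(a+b) ≤ √a + √b divided by √a √b √(a+b). -/
lemma inv_sqrt_mul_inv_sqrt_le {a b : ℝ} (ha : 0 < a) (hb : 0 < b) :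
    (√a)⁻¹ * (√b)⁻¹ ≤ (√(a + b))⁻¹ * ((√a)⁻¹ + (√b)⁻¹) := by
  have ha' := Real.sqrt_pos.2 ha
  have hb' := Real.sqrt_pos.2 hb
  have hab := Real.sqrt_pos.2 (add_pos ha hb)
  have h : √(a + b) ≤ √a + √b := by
    refine Real.sqrt_le_iff.2 ⟨by positivity, ?_⟩
    nlinarith [Real.sq_sqrt ha.le, Real.sq_sqrt hb.le, mul_pos ha' hb']
  have e1 : (√a)⁻¹ + (√b)⁻¹ = (√a + √b) * ((√a)⁻¹ * (√b)⁻¹) := by field_simp; ring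
  rw [e1, ← mul_assoc]
  refine le_mul_of_one_le_left (by positivity) ?_
  rw [inv_mul_eq_div, one_le_div hab]
  exact h

lemma ouSing_mul_le (s r t : ℝ) :
    ouSing T s r * ouSing T r t ≤ ouSing T s t * (ouSing T s r + ouSing T r t) := by
  by_cases h1 : Valid T s r
  · by_cases h2 : Valid T r t
    · have h3 := h1.trans h2
      simp only [ouSing, h1, h2, h3, if_true]
      rw [← ENNReal.ofReal_mul (by positivity), ← ENNReal.ofReal_add (by positivity)
        (by positivity), ← ENNReal.ofReal_mul (by positivity)]
      refine ENNReal.ofReal_le_ofReal ?_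
      have := inv_sqrt_mul_inv_sqrt_le (sub_pos.2 h1.2.1) (sub_pos.2 h2.2.1)
      rwa [show r - s + (t - r) = t - s by ring] at this
    · simp [ouSing, h2]
  · simp [ouSing, h1]

lemma exists_lintegral_ouSing_le (T : ℝ) : ∃ C : ℝ≥0,
    (∀ s, ∫⁻ r, ouSing T s r ≤ C) ∧ ∀ t, ∫⁻ r, ouSing T r t ≤ C := by
  refine ⟨(∫⁻ u, invSqrtInd T u).toNNReal, fun s => ?_, fun t => ?_⟩ <;>
    rw [ENNReal.coe_toNNReal (lintegral_invSqrtInd_lt_top T).ne]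
  · calc _ ≤ ∫⁻ r, invSqrtInd T (r - s) := lintegral_mono fun r => ouSing_le_left s r
      _ = _ := lintegral_sub_right_eq_self _ _
  · calc _ ≤ ∫⁻ r, invSqrtInd T (t - r) := lintegral_mono fun r => ouSing_le_left r t
      _ = _ := lintegral_sub_left_eq_self _ _

/-- By `ouSing_mul_le` the product is at most (t-s)^{-1/2} times a sum of two functions of r whose
integrals are bounded uniformly in s and t, which avoids evaluating a Beta integral. -/
lemma exists_lintegral_ouSing_mul_le (T : ℝ) : ∃ C : ℝ≥0, ∀ s t,
    ∫⁻ r, ouSing T s r * ouSing T r t ≤ C * ouSing T s t := by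
  obtain ⟨C, h1, h2⟩ := exists_lintegral_ouSing_le T
  refine ⟨C + C, fun s t => ?_⟩
  have hm1 : Measurable fun r => ouSing T s r :=
    measurable_ouSing.comp (by fun_prop : Measurable fun r : ℝ => (s, r))
  calc _ ≤ ∫⁻ r, ouSing T s t * (ouSing T s r + ouSing T r t) :=
        lintegral_mono fun r => ouSing_mul_le s r t
    _ = ouSing T s t * ((∫⁻ r, ouSing T s r) + ∫⁻ r, ouSing T r t) := by
        rw [lintegral_const_mul' _ _ (ouSing_ne_top s t), lintegral_add_left hm1]
    _ ≤ ouSing T s t * (C + C) := by gcongr; exacts [h1 s, h2 t]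
    _ = _ := by push_cast; ring

lemma exists_norm_shiftInt_le (hf : ContinuousOn f (Icc 0 T)) :
    ∃ K : ℝ, 0 ≤ K ∧ ∀ s t, Valid T s t → ‖shiftInt A f s t‖ ≤ K := by
  obtain ⟨K₁, hK₁, h₁⟩ := exists_norm_le_of_continuous (continuous_semigroup A) T
  obtain ⟨K₂, h₂⟩ := isCompact_Icc.exists_bound_of_continuousOn hf
  refine ⟨K₁ * max K₂ 0 * max T 0, by positivity, fun s t h => ?_⟩
  have hb : ∀ q ∈ uIoc s t, ‖act (semigroup A (t - q)) (f q)‖ ≤ K₁ * max K₂ 0 := by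
    intro q hq
    rw [uIoc_of_le h.2.1.le] at hq
    refine (norm_act_le _ _).trans (mul_le_mul (h₁ _ ⟨sub_nonneg.2 hq.2, ?_⟩)
      ((h₂ q ⟨h.1.trans hq.1.le, hq.2.trans h.2.2⟩).trans (le_max_left _ _)) (norm_nonneg _) hK₁)
    linarith [h.1, h.2.2, hq.1]
  refine (intervalIntegral.norm_integral_le_of_norm_le_const hb).trans ?_
  have := h.sub_mem
  rw [abs_of_pos this.1]
  gcongr
  exact this.2.trans (le_max_left _ _)

lemma exists_enorm_ouStep_le (hQ : Q.PosDef) (hf : ContinuousOn f (Icc 0 T)) :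
    ∃ K : ℝ≥0, ∀ s t x ξ,
      1 + ‖ouStep A Q f T s t x ξ‖ₑ ≤ K * ((1 + ‖x‖ₑ) * (1 + ‖ξ‖ₑ)) := by
  obtain ⟨K₁, hK₁, h₁⟩ := exists_norm_le_of_continuous (continuous_semigroup A) T
  obtain ⟨K₂, hK₂, h₂⟩ := exists_norm_shiftInt_le (A := A) hf
  obtain ⟨K₃, hK₃, h₃⟩ := exists_norm_le_of_continuous (continuous_sqrt_covMat A hQ) T
  refine ⟨⟨1 + K₁ + K₂ + K₃, by positivity⟩, fun s t x ξ => ?_⟩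
  have key : 1 + ‖ouStep A Q f T s t x ξ‖ ≤ (1 + K₁ + K₂ + K₃) * ((1 + ‖x‖) * (1 + ‖ξ‖)) := by
    have hx := norm_nonneg x
    have hξ := norm_nonneg ξ
    unfold ouStep
    split_ifs with h
    · have hm := h.sub_mem
      have e1 : ‖act (semigroup A (t - s)) x‖ ≤ K₁ * ‖x‖ :=
        (norm_act_le _ _).trans (by gcongr; exact h₁ _ ⟨hm.1.le, hm.2⟩)
      have e3 : ‖act (CFC.sqrt (covMat A Q (t - s))) ξ‖ ≤ K₃ * ‖ξ‖ := by
        have := h₃ _ ⟨hm.1.le, hm.2⟩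
        rw [max_eq_left hm.1.le] at this
        exact (norm_act_le _ _).trans (by gcongr)
      have e4 := norm_add₃_le (a := act (semigroup A (t - s)) x) (b := shiftInt A f s t)
        (c := act (CFC.sqrt (covMat A Q (t - s))) ξ)
      have e2 := h₂ s t h
      calc _ ≤ 1 + (K₁ * ‖x‖ + K₂ + K₃ * ‖ξ‖) := by linarith
        _ ≤ _ := by
          have p1 : 0 ≤ ‖x‖ * ‖ξ‖ := by positivity
          have p2 : 0 ≤ K₁ * (1 + ‖ξ‖ + ‖x‖ * ‖ξ‖) := by positivity
          have p3 : 0 ≤ K₂ * (‖x‖ + ‖ξ‖ + ‖x‖ * ‖ξ‖) := by positivity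
          have p4 : 0 ≤ K₃ * (1 + ‖x‖ + ‖x‖ * ‖ξ‖) := by positivity
          linarith
    · have p1 : 0 ≤ ‖x‖ * ‖ξ‖ := by positivity
      have p2 : 0 ≤ (K₁ + K₂ + K₃) * ((1 + ‖x‖) * (1 + ‖ξ‖)) := by positivity
      simp only [norm_zero]
      linarith
  have := ENNReal.ofReal_le_ofReal key
  rw [ENNReal.ofReal_mul (by positivity), ENNReal.ofReal_mul (by positivity),
    ENNReal.ofReal_add zero_le_one (norm_nonneg _),
    ENNReal.ofReal_add zero_le_one (norm_nonneg x),
    ENNReal.ofReal_add zero_le_one (norm_nonneg ξ), ofReal_norm, ofReal_norm, ofReal_norm,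
    ENNReal.ofReal_one] at this
  refine this.trans_eq ?_
  congr 1
  exact ENNReal.ofReal_eq_coe_nnreal _

variable (T) in
/-- The step system of the shifted Ornstein–Uhlenbeck process. -/
noncomputable def ouSystem (A : Matrix (Fin d) (Fin d) ℝ) (hQ : Q.PosDef)
    (hf : ContinuousOn f (Icc 0 T)) : StepSystem (E d) where
  γ := stdGaussian (E d)
  prob := inferInstance
  step := ouStep A Q f T
  sing := ouSing T
  measurable_step := measurable_ouStep hQ hf
  measurable_sing := measurable_ouSing
  sing_ne_top := ouSing_ne_top
  lintegral_sing_mul := exists_lintegral_ouSing_mul_le T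

lemma lintegral_poly_stdGaussian_lt_top (k : ℕ) :
    ∫⁻ ξ : E d, (1 + ‖ξ‖ₑ) ^ k ∂(stdGaussian (E d)) < ∞ := by
  have h := (integrable_poly_stdGaussian (d := d) k).2
  rw [hasFiniteIntegral_iff_enorm] at h
  refine lt_of_le_of_lt (lintegral_mono fun ξ => le_of_eq ?_) h
  rw [enorm_pow, Real.enorm_eq_ofReal (by positivity), ENNReal.ofReal_add (by positivity)
    (by positivity), ofReal_norm, ENNReal.ofReal_one]

/-- A k-th power of the step contributes k powers of 1 + ‖x‖ and of 1 + ‖ξ‖, the weight m and one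
more; the powers of the noise integrate to a finite Gaussian moment. -/
lemma admissible_of_le (hQ : Q.PosDef) (hf : ContinuousOn f (Icc 0 T)) {F : Type*}
    [NormedAddCommGroup F] {h : ℝ → ℝ → E d → E d → F}
    (hm : StronglyMeasurable fun p : ℝ × ℝ × E d × E d => h p.1 p.2.1 p.2.2.1 p.2.2.2)
    (c : ℝ≥0) (m : ℕ)
    (hb : ∀ s t x ξ, ‖h s t x ξ‖ₑ ≤ c * ouSing T s t * (1 + ‖x‖ₑ) ^ m * (1 + ‖ξ‖ₑ)) :
    (ouSystem T A hQ hf).Admissible h := by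
  refine ⟨hm, fun k => ?_⟩
  obtain ⟨K, hK⟩ := exists_enorm_ouStep_le (A := A) hQ hf
  have hfin := lintegral_poly_stdGaussian_lt_top (d := d) (k + 1)
  refine ⟨c * K ^ k * (∫⁻ ξ : E d, (1 + ‖ξ‖ₑ) ^ (k + 1) ∂(stdGaussian (E d))).toNNReal, m + k,
    fun s t x => ?_⟩
  push_cast
  rw [ENNReal.coe_toNNReal hfin.ne]
  calc ∫⁻ ξ, ‖h s t x ξ‖ₑ * (1 + ‖ouStep A Q f T s t x ξ‖ₑ) ^ k ∂(stdGaussian (E d))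
      ≤ ∫⁻ ξ, (c * K ^ k * ouSing T s t * (1 + ‖x‖ₑ) ^ (m + k)) * (1 + ‖ξ‖ₑ) ^ (k + 1)
          ∂(stdGaussian (E d)) := by
        refine lintegral_mono fun ξ => ?_
        calc _ ≤ c * ouSing T s t * (1 + ‖x‖ₑ) ^ m * (1 + ‖ξ‖ₑ)
              * (K * ((1 + ‖x‖ₑ) * (1 + ‖ξ‖ₑ))) ^ k := by
              gcongr
              exacts [hb s t x ξ, hK s t x ξ]
          _ = _ := by rw [mul_pow, mul_pow]; ring
    _ = (c * K ^ k * ouSing T s t * (1 + ‖x‖ₑ) ^ (m + k))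
          * ∫⁻ ξ, (1 + ‖ξ‖ₑ) ^ (k + 1) ∂(stdGaussian (E d)) :=
        lintegral_const_mul _ (by fun_prop)
    _ = _ := by simp only [ouSystem]; ring

lemma exists_enorm_ouVec_le (A : Matrix (Fin d) (Fin d) ℝ) (hQ : Q.PosDef) (T : ℝ) :
    ∃ K : ℝ≥0, ∀ s t x ξ, ‖ouVec A Q T s t x ξ‖ₑ ≤ K * ouSing T s t * ‖ξ‖ₑ := by
  obtain ⟨K₁, hK₁, h₁⟩ := exists_norm_le_of_continuous
    (M := fun t => (semigroup A t)ᵀ) (by have := continuous_semigroup A; fun_prop) T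
  obtain ⟨K₂, hK₂, h₂⟩ := exists_norm_covInvSqrt_le A hQ T
  refine ⟨⟨K₁ * K₂, by positivity⟩, fun s t x ξ => ?_⟩
  unfold ouVec ouSing
  split_ifs with h
  · have hm := h.sub_mem
    have hsym : (covInvSqrt A Q (t - s))ᵀ = covInvSqrt A Q (t - s) := by
      rw [covInvSqrt, transpose_nonsing_inv, sqrt_transpose]
    have key : ‖act (Lam A Q (t - s))ᵀ ξ‖ ≤ K₁ * K₂ * (√(t - s))⁻¹ * ‖ξ‖ := by
      rw [Lam, transpose_mul, act_mul, hsym]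
      calc _ ≤ K₁ * (K₂ * (√(t - s))⁻¹ * ‖ξ‖) :=
            (norm_act_le _ _).trans (mul_le_mul (h₁ _ ⟨hm.1.le, hm.2⟩) (h₂ _ hm _)
              (norm_nonneg _) hK₁)
        _ = _ := by ring
    have := ENNReal.ofReal_le_ofReal key
    rw [ENNReal.ofReal_mul (by positivity), ENNReal.ofReal_mul (by positivity), ofReal_norm,
      ofReal_norm] at this
    refine this.trans_eq ?_
    congr 2
    exact ENNReal.ofReal_eq_coe_nnreal _
  · simp

lemma admissible_ouVec (hQ : Q.PosDef) (hf : ContinuousOn f (Icc 0 T)) :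
    (ouSystem T A hQ hf).Admissible (ouVec A Q T) := by
  obtain ⟨K, hK⟩ := exists_enorm_ouVec_le A hQ T
  refine admissible_of_le hQ hf (measurable_ouVec hQ).stronglyMeasurable K 0 fun s t x ξ => ?_
  rw [pow_zero, mul_one]
  exact (hK s t x ξ).trans (by gcongr; exact le_add_self)

lemma admissible_ouWt (hQ : Q.PosDef) (hf : ContinuousOn f (Icc 0 T))
    (hB : Measurable fun p : ℝ × E d => (Icc 0 T).indicator (fun s => B s p.2) p.1)
    {C : ℝ≥0} {m : ℕ} (hBg : ∀ s ∈ Icc 0 T, ∀ x, ‖B s x‖ₑ ≤ C * (1 + ‖x‖ₑ) ^ m) :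
    (ouSystem T A hQ hf).Admissible (ouWt A Q B T) := by
  obtain ⟨K, hK⟩ := exists_enorm_ouVec_le A hQ T
  refine admissible_of_le hQ hf (measurable_ouWt hQ hB).stronglyMeasurable (C * K) m
    fun s t x ξ => ?_
  by_cases h : Valid T s t
  · calc ‖ouWt A Q B T s t x ξ‖ₑ ≤ ‖B s x‖ₑ * ‖ouVec A Q T s t x ξ‖ₑ := by
          rw [ouWt, ← ofReal_norm, ← ofReal_norm, ← ofReal_norm, ← ENNReal.ofReal_mul (norm_nonneg _)]
          exact ENNReal.ofReal_le_ofReal (norm_inner_le_norm _ _)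
      _ ≤ (C * (1 + ‖x‖ₑ) ^ m) * (K * ouSing T s t * (1 + ‖ξ‖ₑ)) := by
          gcongr
          · exact hBg s h.mem_left x
          · exact (hK s t x ξ).trans (by gcongr; exact le_add_self)
      _ = _ := by push_cast; ring
  · simp [ouWt, ouVec, h]

/-- The unweighted first step fits the singular framework because 1 ≤ √T (t-s)^{-1/2} whenever 0 < t
- s ≤ T. -/
lemma admissible_ouInd (hQ : Q.PosDef) (hf : ContinuousOn f (Icc 0 T)) :
    (ouSystem T A hQ hf).Admissible (ouInd T) := by
  have hm : Measurable fun p : ℝ × ℝ × E d × E d =>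
      ouInd T p.1 p.2.1 p.2.2.1 p.2.2.2 :=
    measurable_ite_valid (by fun_prop) (by fun_prop) (g := fun _ => (1 : ℝ))
      measurable_const fun _ _ => rfl
  refine admissible_of_le hQ hf hm.stronglyMeasurable ⟨√(max T 0), by positivity⟩ 0
    fun s t x ξ => ?_
  unfold ouInd ouSing
  split_ifs with h
  · have hs := h.sub_mem
    rw [pow_zero, mul_one]
    have e1 : (1 : ℝ) ≤ √(max T 0) * (√(t - s))⁻¹ := by
      rw [← div_eq_mul_inv, one_le_div (Real.sqrt_pos.2 hs.1)]
      exact Real.sqrt_le_sqrt (hs.2.trans (le_max_left _ _))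
    have e2 := ENNReal.ofReal_le_ofReal e1
    rw [ENNReal.ofReal_mul (by positivity), ENNReal.ofReal_one] at e2
    calc ‖(1 : ℝ)‖ₑ = 1 := by simp
      _ ≤ _ := e2
      _ ≤ _ := by
        refine le_trans (le_of_eq ?_) (le_mul_of_one_le_right zero_le le_self_add)
        congr 1
        exact ENNReal.ofReal_eq_coe_nnreal _
  · simp

/-- Since e^{(t-s)A} = Q_{t-s}^{1/2} Λ(t-s), the starting point enters only as the translation
Λ(t-s)x of the noise. The chain rule applied to the Gaussian smoothing formula at Λ(t-s)x produces
the weight Λ(t-s)ᵀξ. -/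
lemma hasGradientWeight_ouSystem (hQ : Q.PosDef) (hf : ContinuousOn f (Icc 0 T)) :
    (ouSystem T A hQ hf).HasGradientWeight (ouInd T) (ouVec A Q T) := by
  intro s t g hg C k hgb x
  change HasGradientAt (fun x => ∫ ξ, g (ouStep A Q f T s t x ξ) • ouInd T s t x ξ
    ∂(stdGaussian (E d))) (∫ ξ, g (ouStep A Q f T s t x ξ) • ouVec A Q T s t x ξ
    ∂(stdGaussian (E d))) x
  by_cases h : Valid T s t
  swap
  · simpa [ouInd, ouVec, h] using hasGradientAt_const x (0 : ℝ)
  have hC : 0 ≤ C := by simpa using (abs_nonneg _).trans (hgb 0)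
  have hs := h.sub_mem
  set R := CFC.sqrt (covMat A Q (t - s)) with hR
  set L := Lam A Q (t - s) with hL
  set F := shiftInt A f s t with hF
  have hstep (y ξ : E d) : ouStep A Q f T s t y ξ = F + act R (act L y + ξ) := by
    have e : act R (act L y) = act (semigroup A (t - s)) y := by
      rw [hL, Lam, act_mul, covInvSqrt, act_act_inv (isUnit_det_sqrt_covMat A hQ hs.1)]
    simp only [ouStep, h, if_true]
    rw [show act R (act L y + ξ) = act R (act L y) + act R ξ from map_add _ _ _, e]
    abel
  simp only [hstep, ouInd, ouVec, h, if_true, smul_eq_mul, mul_one]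
  have hg' : Measurable fun z => g (F + act R z) :=
    hg.comp (((toEuclideanCLM (n := Fin d) (𝕜 := ℝ) R).continuous.measurable).const_add F)
  have hgb' (z : E d) : |g (F + act R z)| ≤ C * (1 + ‖F‖ + ‖R‖) ^ k * (1 + ‖z‖) ^ k := by
    refine (hgb _).trans ?_
    rw [mul_assoc, ← mul_pow]
    gcongr
    have := (norm_add_le F (act R z)).trans (add_le_add_right (norm_act_le R z) _)
    nlinarith [norm_nonneg F, norm_nonneg R, norm_nonneg z, mul_nonneg (norm_nonneg F)
      (norm_nonneg z)]
  have hint : Integrable (fun z : E d => g (F + act R (act L x + z)) • z) (stdGaussian (E d)) := by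
    refine Integrable.mono' ((integrable_poly_stdGaussian (d := d) (k + 1)).const_mul
      (C * (1 + ‖F‖ + ‖R‖) ^ k * (1 + ‖act L x‖) ^ k))
      ((hg'.comp (measurable_const_add _)).smul measurable_id).aestronglyMeasurable
      (.of_forall fun z => ?_)
    rw [norm_smul, Real.norm_eq_abs]
    calc _ ≤ C * (1 + ‖F‖ + ‖R‖) ^ k * ((1 + ‖act L x‖) * (1 + ‖z‖)) ^ k * (1 + ‖z‖) := by
          gcongr
          · refine (hgb' _).trans ?_
            gcongr
            have := norm_add_le (act L x) z
            nlinarith [mul_nonneg (norm_nonneg (act L x)) (norm_nonneg z)]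
          · linarith
      _ = _ := by rw [mul_pow]; ring
  have hD := (hasFDerivAt_integral_add_stdGaussian hg' hgb' (act L x)).comp x
    (toEuclideanCLM (n := Fin d) (𝕜 := ℝ) L).hasFDerivAt
  rw [hasGradientAt_iff_hasFDerivAt]
  convert! hD using 1
  have hint2 : Integrable (fun z : E d => g (F + act R (act L x + z)) • innerSL ℝ z)
      (stdGaussian (E d)) := by
    have := (innerSL ℝ (E := E d)).integrable_comp hint
    simpa using this
  have hint3 : Integrable (fun z : E d => g (F + act R (act L x + z)) • act Lᵀ z)
      (stdGaussian (E d)) := by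
    have := (toEuclideanCLM (n := Fin d) (𝕜 := ℝ) Lᵀ).integrable_comp hint
    simpa using this
  ext y
  rw [InnerProductSpace.toDual_apply_apply, real_inner_comm, ← integral_inner hint3,
    ContinuousLinearMap.comp_apply, ContinuousLinearMap.integral_apply hint2]
  refine integral_congr_ae (.of_forall fun z => ?_)
  simp only [_root_.smul_apply, innerSL_apply_apply, inner_smul_right, smul_eq_mul]
  rw [inner_act, transpose_transpose, real_inner_comm]

end OUStep

end ShiftedOU

namespace ShiftedOU

/-! ### Iterated time integrals and integrals over the simplex. -/

section Simplex

open Set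
open scoped ENNReal

lemma snoc_mem_timeSimplex {n : ℕ} {s t r : ℝ} {σ : Fin n → ℝ} :
    (Fin.snoc σ r : Fin (n + 1) → ℝ) ∈ timeSimplex (n + 1) s t
      ↔ r ∈ Ioo s t ∧ σ ∈ timeSimplex n s r := by
  constructor
  · rintro ⟨h1, h2⟩
    have hr : r ∈ Ioo s t := by simpa using h2 (Fin.last n)
    refine ⟨hr, fun i j hij => ?_, fun i => ⟨?_, ?_⟩⟩
    · simpa using h1 (Fin.castSucc_lt_castSucc_iff.2 hij)
    · simpa using (h2 i.castSucc).1
    · simpa using h1 (Fin.castSucc_lt_last i)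
  · rintro ⟨hr, h1, h2⟩
    refine ⟨fun i j hij => ?_, fun i => ?_⟩
    · induction i using Fin.lastCases with
      | last => exact absurd hij (not_lt.2 (Fin.le_last j))
      | cast i =>
        induction j using Fin.lastCases with
        | last => simpa using (h2 i).2
        | cast j => simpa using h1 (Fin.castSucc_lt_castSucc_iff.1 hij)
    · induction i using Fin.lastCases with
      | last => simpa using hr
      | cast i => simpa using ⟨(h2 i).1, (h2 i).2.trans hr.2⟩

lemma measurableSet_timeSimplex (n : ℕ) (s t : ℝ) : MeasurableSet (timeSimplex n s t) := by
  have h : timeSimplex n s t = (⋂ i, ⋂ j, ⋂ (_ : i < j), {σ : Fin n → ℝ | σ i < σ j})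
      ∩ ⋂ i, {σ : Fin n → ℝ | σ i ∈ Ioo s t} := by
    ext σ
    simp [timeSimplex, StrictMono]
  rw [h]
  refine .inter (.iInter fun i => .iInter fun j => .iInter fun _ => ?_) (.iInter fun i => ?_)
  · exact measurableSet_lt (measurable_pi_apply i) (measurable_pi_apply j)
  · exact measurable_pi_apply i measurableSet_Ioo

lemma measurePreserving_snoc (n : ℕ) :
    MeasurePreserving (fun p : ℝ × (Fin n → ℝ) => (Fin.snoc p.2 p.1 : Fin (n + 1) → ℝ)) := by
  have h := (volume_preserving_piFinSuccAbove (fun _ : Fin (n + 1) => ℝ) (Fin.last n)).symm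
  convert! h using 1
  ext p i
  simp [MeasurableEquiv.piFinSuccAbove]

lemma measurableEmbedding_snoc (n : ℕ) : MeasurableEmbedding
    (fun p : ℝ × (Fin n → ℝ) => (Fin.snoc p.2 p.1 : Fin (n + 1) → ℝ)) := by
  have h := (MeasurableEquiv.piFinSuccAbove (fun _ : Fin (n + 1) => ℝ)
    (Fin.last n)).symm.measurableEmbedding
  convert! h using 1
  ext p i
  simp [MeasurableEquiv.piFinSuccAbove]

lemma indicator_timeSimplex_snoc {F : Type*} [Zero F] {n : ℕ} {s t : ℝ}
    (g : (Fin (n + 1) → ℝ) → F) (r : ℝ) (σ : Fin n → ℝ) :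
    (timeSimplex (n + 1) s t).indicator g (Fin.snoc σ r)
      = (Ioo s t).indicator (fun r => (timeSimplex n s r).indicator
          (fun σ => g (Fin.snoc σ r)) σ) r := by
  by_cases h1 : r ∈ Ioo s t
  · by_cases h2 : σ ∈ timeSimplex n s r
    · rw [indicator_of_mem (snoc_mem_timeSimplex.2 ⟨h1, h2⟩), indicator_of_mem h1,
        indicator_of_mem h2]
    · rw [indicator_of_notMem (fun h => h2 (snoc_mem_timeSimplex.1 h).2), indicator_of_mem h1,
        indicator_of_notMem h2]
  · rw [indicator_of_notMem (fun h => h1 (snoc_mem_timeSimplex.1 h).1), indicator_of_notMem h1]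

lemma setLIntegral_timeSimplex_succ {n : ℕ} {s t : ℝ} {F : (Fin (n + 1) → ℝ) → ℝ≥0∞}
    (hF : Measurable F) : ∫⁻ σ in timeSimplex (n + 1) s t, F σ
      = ∫⁻ r in Ioo s t, ∫⁻ σ in timeSimplex n s r, F (Fin.snoc σ r) := by
  have hm : Measurable ((timeSimplex (n + 1) s t).indicator F) :=
    hF.indicator (measurableSet_timeSimplex _ _ _)
  rw [← lintegral_indicator (measurableSet_timeSimplex _ _ _),
    ← (measurePreserving_snoc n).lintegral_comp hm, Measure.volume_eq_prod,
    lintegral_prod (fun p : ℝ × (Fin n → ℝ) => (timeSimplex (n + 1) s t).indicator F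
      (Fin.snoc p.2 p.1)) (hm.comp (measurePreserving_snoc n).measurable).aemeasurable,
    ← lintegral_indicator measurableSet_Ioo]
  refine lintegral_congr fun r => ?_
  simp_rw [indicator_timeSimplex_snoc]
  by_cases h : r ∈ Ioo s t
  · simp only [indicator_of_mem h]
    rw [lintegral_indicator (measurableSet_timeSimplex _ _ _)]
  · simp [indicator_of_notMem h]

lemma integrableOn_timeSimplex_succ {n : ℕ} {s t : ℝ} {g : (Fin (n + 1) → ℝ) → ℝ}
    (hg : IntegrableOn g (timeSimplex (n + 1) s t)) :
    (∀ᵐ r ∂(volume.restrict (Ioo s t)),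
      IntegrableOn (fun σ : Fin n → ℝ => g (Fin.snoc σ r)) (timeSimplex n s r)) ∧
    IntegrableOn (fun r => ∫ σ in timeSimplex n s r, g (Fin.snoc σ r)) (Ioo s t) ∧
    ∫ σ in timeSimplex (n + 1) s t, g σ
      = ∫ r in Ioo s t, ∫ σ in timeSimplex n s r, g (Fin.snoc σ r) := by
  have hg1 : Integrable ((timeSimplex (n + 1) s t).indicator g) :=
    (integrable_indicator_iff (measurableSet_timeSimplex _ _ _)).2 hg
  have hg2 := (measurePreserving_snoc n).integrable_comp_of_integrable hg1
  have e (r : ℝ) : (∫ σ : Fin n → ℝ, (timeSimplex (n + 1) s t).indicator g (Fin.snoc σ r))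
      = (Ioo s t).indicator (fun r => ∫ σ in timeSimplex n s r, g (Fin.snoc σ r)) r := by
    simp_rw [indicator_timeSimplex_snoc]
    by_cases h : r ∈ Ioo s t
    · simp only [indicator_of_mem h]
      rw [integral_indicator (measurableSet_timeSimplex _ _ _)]
    · simp [indicator_of_notMem h]
  rw [Measure.volume_eq_prod] at hg2
  refine ⟨?_, ?_, ?_⟩
  · rw [ae_restrict_iff' measurableSet_Ioo]
    filter_upwards [hg2.prod_right_ae] with r hr hrm
    simp only [Function.comp_def, indicator_timeSimplex_snoc, indicator_of_mem hrm] at hr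
    exact (integrable_indicator_iff (measurableSet_timeSimplex _ _ _)).1 hr
  · rw [← integrable_indicator_iff measurableSet_Ioo]
    refine hg2.integral_prod_left.congr (.of_forall fun r => ?_)
    simpa using e r
  · rw [← integral_indicator (measurableSet_timeSimplex _ _ _),
      ← (measurePreserving_snoc n).integral_comp (measurableEmbedding_snoc n),
      Measure.volume_eq_prod, integral_prod (fun p : ℝ × (Fin n → ℝ) => (timeSimplex (n + 1) s t).indicator g
        (Fin.snoc p.2 p.1)) hg2, ← integral_indicator measurableSet_Ioo]
    exact integral_congr_ae (.of_forall fun r => by simpa using e r)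

lemma iteratedIntegral_succ {n : ℕ} {s t : ℝ} (hst : s ≤ t) (g : (Fin (n + 1) → ℝ) → ℝ) :
    iteratedIntegral s (n + 1) g t
      = ∫ r in Ioo s t, iteratedIntegral s n (fun σ => g (Fin.snoc σ r)) r := by
  change ∫ r in s..t, iteratedIntegral s n (fun σ => g (Fin.snoc σ r)) r = _
  rw [intervalIntegral.integral_of_le hst, integral_Ioc_eq_integral_Ioo]

/-- Joint integrability gives integrable slices only for almost every last time, which is enough for
the induction. The identity makes Fubini between times and Ω available for iterated integrals. -/
lemma setIntegral_timeSimplex {n : ℕ} : ∀ {s t : ℝ} {g : (Fin n → ℝ) → ℝ}, s ≤ t →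
    IntegrableOn g (timeSimplex n s t) →
    ∫ σ in timeSimplex n s t, g σ = iteratedIntegral s n g t := by
  induction n with
  | zero =>
    intro s t g _ _
    have h : timeSimplex 0 s t = univ := by
      ext σ; simp [timeSimplex, StrictMono]
    have hg : g = fun _ => g Fin.elim0 := funext fun σ => by rw [Subsingleton.elim σ Fin.elim0]
    rw [iteratedIntegral, h, hg]
    -- The zero-dimensional simplex is a single point of mass one.
    simp [volume_pi, measureReal_def]
  | succ n ih =>
    intro s t g hst hg
    obtain ⟨h1, -, h3⟩ := integrableOn_timeSimplex_succ hg
    rw [h3, iteratedIntegral_succ hst]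
    refine integral_congr_ae ?_
    filter_upwards [h1, ae_restrict_mem measurableSet_Ioo] with r hr hrm
    exact ih hrm.1.le hr

lemma integrableOn_iteratedIntegral {n : ℕ} {s t : ℝ} {g : (Fin (n + 1) → ℝ) → ℝ}
    (hg : IntegrableOn g (timeSimplex (n + 1) s t)) :
    IntegrableOn (fun r => iteratedIntegral s n (fun σ => g (Fin.snoc σ r)) r) (Ioo s t) := by
  obtain ⟨h1, h2, -⟩ := integrableOn_timeSimplex_succ hg
  refine h2.congr ?_
  filter_upwards [h1, ae_restrict_mem measurableSet_Ioo] with r hr hrm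
  exact setIntegral_timeSimplex hrm.1.le hr

lemma iteratedIntegral_congr {n : ℕ} : ∀ {s t : ℝ} {g g' : (Fin n → ℝ) → ℝ}, s ≤ t →
    (∀ σ ∈ timeSimplex n s t, g σ = g' σ) →
    iteratedIntegral s n g t = iteratedIntegral s n g' t := by
  induction n with
  | zero => exact fun _ h => h _ (by simp [timeSimplex, StrictMono])
  | succ n ih =>
    intro s t g g' hst h
    rw [iteratedIntegral_succ hst, iteratedIntegral_succ hst]
    exact setIntegral_congr_fun measurableSet_Ioo fun r hr =>
      ih hr.1.le fun σ hσ => h _ (snoc_mem_timeSimplex.2 ⟨hr, hσ⟩)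

lemma iteratedIntegral_const_mul {n : ℕ} (c : ℝ) : ∀ {s t : ℝ} (g : (Fin n → ℝ) → ℝ),
    iteratedIntegral s n (fun σ => c * g σ) t = c * iteratedIntegral s n g t := by
  induction n with
  | zero => exact fun _ => rfl
  | succ n ih =>
    intro s t g
    simp only [iteratedIntegral, ih, intervalIntegral.integral_const_mul]

end Simplex

end ShiftedOU

namespace ShiftedOU

/-! ### Brownian paths: regular version, independence of past and future increments. -/

section BrownianMotion

open Set Filter Topology

variable {Ω : Type*} {d : ℕ} {W : ℝ≥0 → Ω → E d}

/-- The history of the path up to time `r`. -/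
abbrev past (W : ℝ≥0 → Ω → E d) (r : ℝ≥0) : MeasurableSpace Ω :=
  MeasurableSpace.comap (fun ω (i : Fin d) (q : ℝ≥0) => W (min q r) ω i) inferInstance

/-- The increments of the path after time `r`. -/
abbrev future (W : ℝ≥0 → Ω → E d) (r : ℝ≥0) : MeasurableSpace Ω :=
  MeasurableSpace.comap (fun ω (i : Fin d) (q : ℝ≥0) => W (r + q) ω i - W r ω i) inferInstance

lemma measurable_of_coord {α : Type*} [MeasurableSpace α] {X : α → E d}
    (h : ∀ i, Measurable fun ω => X ω i) : Measurable X :=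
  (WithLp.measurable_toLp 2 _).comp (measurable_pi_lambda _ h)

lemma measurable_past {q r : ℝ≥0} (h : q ≤ r) : Measurable[past W r] (W q) := by
  let _ := past W r
  refine measurable_of_coord fun i => ?_
  have h1 : Measurable fun ω (i : Fin d) (q : ℝ≥0) => W (min q r) ω i := comap_measurable _
  have h2 := ((measurable_pi_apply q).comp (measurable_pi_apply i)).comp h1
  simpa [Function.comp_def, min_eq_left h] using h2

lemma measurable_future {q r : ℝ≥0} (h : r ≤ q) :
    Measurable[future W r] fun ω => W q ω - W r ω := by
  let _ := future W r
  refine measurable_of_coord fun i => ?_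
  have h1 : Measurable fun ω (i : Fin d) (q : ℝ≥0) => W (r + q) ω i - W r ω i := comap_measurable _
  have h2 := ((measurable_pi_apply (q - r)).comp (measurable_pi_apply i)).comp h1
  simpa [Function.comp_def, add_tsub_cancel_of_le h] using h2

variable [mΩ : MeasurableSpace Ω] {P : Measure Ω}

lemma aemeasurable_of_coord {X : Ω → E d} (h : ∀ i, AEMeasurable (fun ω => X ω i) P) :
    AEMeasurable X P :=
  (WithLp.measurable_toLp 2 _).comp_aemeasurable (aemeasurable_pi_lambda _ h)

lemma IsBrownianMotion.aemeasurable (hW : IsBrownianMotion W P) (t : ℝ≥0) :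
    AEMeasurable (W t) P :=
  aemeasurable_of_coord fun i => (hW.coord i).aemeasurable t

lemma continuous_of_coord {Y : Type*} [TopologicalSpace Y] {X : Y → E d}
    (h : ∀ i, Continuous fun y => X y i) : Continuous X :=
  (PiLp.continuous_toLp 2 _).comp (continuous_pi h)

lemma IsBrownianMotion.ae_continuous (hW : IsBrownianMotion W P) :
    ∀ᵐ ω ∂P, Continuous fun t => W t ω := by
  filter_upwards [ae_all_iff.2 fun i => (hW.coord i).cont] with ω h
  exact continuous_of_coord h

lemma IsBrownianMotion.congr {W' : ℝ≥0 → Ω → E d} (hW : IsBrownianMotion W P)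
    (h : ∀ᵐ ω ∂P, ∀ t, W' t ω = W t ω) : IsBrownianMotion W' P where
  coord i := by
    refine ⟨(hW.coord i).toIsPreBrownianReal.congr fun t => ?_, ?_⟩
    · filter_upwards [h] with ω hω
      rw [hω t]
    · filter_upwards [h, (hW.coord i).cont] with ω hω hc
      simpa only [hω] using hc
  indep := by
    refine (iIndepFun_congr fun i => ?_).1 hW.indep
    filter_upwards [h] with ω hω
    exact funext fun t => by rw [hω t]

/-- The path is set to zero on a measurable null set outside which it is continuous and agrees, at a
dense sequence of times, with measurable representatives. Measurability at any other time follows by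
taking limits along that sequence. -/
lemma IsBrownianMotion.exists_modification (hW : IsBrownianMotion W P) :
    ∃ W' : ℝ≥0 → Ω → E d, (∀ t, Measurable (W' t)) ∧ (∀ ω, Continuous fun t => W' t ω) ∧
      IsBrownianMotion W' P ∧ ∀ᵐ ω ∂P, ∀ t, W' t ω = W t ω := by
  classical
  let D : ℕ → ℝ≥0 := TopologicalSpace.denseSeq ℝ≥0
  have hN : ∀ᵐ ω ∂P, (Continuous fun t => W t ω) ∧
      ∀ n, W (D n) ω = (hW.aemeasurable (D n)).mk _ ω :=
    hW.ae_continuous.and (ae_all_iff.2 fun n => (hW.aemeasurable (D n)).ae_eq_mk)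
  obtain ⟨N, hNsub, hNm, hN0⟩ := exists_measurable_superset_of_null (ae_iff.1 hN)
  have hgood {ω : Ω} (hω : ω ∉ N) : (Continuous fun t => W t ω) ∧
      ∀ n, W (D n) ω = (hW.aemeasurable (D n)).mk _ ω := by
    by_contra h
    exact hω (hNsub h)
  have hae : ∀ᵐ ω ∂P, ∀ t, (fun (t : ℝ≥0) ω => if ω ∈ N then 0 else W t ω) t ω = W t ω := by
    filter_upwards [measure_eq_zero_iff_ae_notMem.1 hN0] with ω hω t
    simp [hω]
  refine ⟨fun t ω => if ω ∈ N then 0 else W t ω, fun t => ?_, fun ω => ?_, hW.congr hae, hae⟩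
  · obtain ⟨u, hu, hut⟩ := mem_closure_iff_seq_limit.1
      ((TopologicalSpace.denseRange_denseSeq ℝ≥0).closure_range ▸ mem_univ t)
    choose k hk using hu
    refine measurable_of_tendsto_metrizable
      (f := fun n ω => if ω ∈ N then 0 else (hW.aemeasurable (D (k n))).mk _ ω)
      (fun n => Measurable.ite hNm measurable_const (AEMeasurable.measurable_mk _)) ?_
    refine tendsto_pi_nhds.2 fun ω => ?_
    by_cases hω : ω ∈ N
    · simp [hω]
    · simp only [hω, if_false]
      simp only [← (hgood hω).2]
      refine ((hgood hω).1.tendsto t).comp ?_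
      simpa only [D, hk] using hut
  · by_cases hω : ω ∈ N
    · simpa [hω] using continuous_const
    · simpa [hω] using (hgood hω).1

lemma measurable_coord {X : Ω → E d} (h : Measurable X) (i : Fin d) : Measurable fun ω => X ω i :=
  (EuclideanSpace.proj (𝕜 := ℝ) i).continuous.measurable.comp h

lemma past_le (hm : ∀ t, Measurable (W t)) (r : ℝ≥0) : past W r ≤ mΩ := by
  refine Measurable.comap_le ?_
  refine measurable_pi_lambda _ fun i => measurable_pi_lambda _ fun q => ?_
  exact measurable_coord (hm _) i

lemma future_le (hm : ∀ t, Measurable (W t)) (r : ℝ≥0) : future W r ≤ mΩ := by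
  refine Measurable.comap_le ?_
  refine measurable_pi_lambda _ fun i => measurable_pi_lambda _ fun q => ?_
  exact (measurable_coord (hm _) i).sub (measurable_coord (hm _) i)

/-- Within one coordinate, the stopped path and the later increments are independent, and the
coordinates are mutually independent. Hence all pairs (coordinate, past or future) form an
independent family, which is then regrouped into past and future. -/
lemma IsBrownianMotion.indep_past_future (hW : IsBrownianMotion W P) (hm : ∀ t, Measurable (W t))
    (r : ℝ≥0) : Indep (past W r) (future W r) P := by
  let g : Bool → (ℝ≥0 → ℝ) → ℝ≥0 → ℝ := fun b w q => if b then w (r + q) - w r else w (min q r)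
  have hg (b : Bool) : Measurable (g b) := by
    refine measurable_pi_lambda _ fun q => ?_
    cases b
    · exact measurable_pi_apply (min q r)
    · exact (measurable_pi_apply (r + q)).sub (measurable_pi_apply r)
  let X : Fin d → Bool → Ω → ℝ≥0 → ℝ := fun i b ω => g b fun t => W t ω i
  have hX (i : Fin d) (b : Bool) : Measurable (X i b) :=
    (hg b).comp (measurable_pi_lambda _ fun t => measurable_coord (hm t) i)
  have h1 : iIndepFun (fun i ω b => X i b ω) P :=
    hW.indep.comp (γ := fun _ => Bool → ℝ≥0 → ℝ) (fun _ w b => g b w) fun _ =>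
      measurable_pi_lambda _ hg
  have h2 (i : Fin d) : iIndepFun (X i) P := by
    have h3 := ((hW.coord i).indepFun_shift r).symm.comp
      (φ := fun (w : Iic r → ℝ) (q : ℝ≥0) => w ⟨min q r, min_le_right q r⟩) (ψ := id)
      (measurable_pi_lambda _ fun q => measurable_pi_apply _) measurable_id
    have h4 : IndepFun (X i false) (X i true) P := by
      simpa [X, g, Function.comp_def] using h3
    have hP := (hW.indep).isProbabilityMeasure
    -- Mutual independence of a family indexed by `Bool` is checked on the four subsets of the index
    -- set; only the full set uses the independence of the pair.
    refine iIndepFun_iff_measure_inter_preimage_eq_mul.2 fun S sets hs => ?_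
    have h5 := indepFun_iff_measure_inter_preimage_eq_mul.1 h4 (sets false) (sets true)
    fin_cases S
    · simp
    · change P (⋂ b ∈ ({true} : Finset Bool), _) = ∏ b ∈ ({true} : Finset Bool), _
      simp
    · change P (⋂ b ∈ ({false} : Finset Bool), _) = ∏ b ∈ ({false} : Finset Bool), _
      simp
    · simp at hs ⊢
      rw [mul_comm, ← h5 hs.1 hs.2]
      congr 1
      ext ω
      simp
  have h5 := iIndepFun_uncurry' hX h1 h2
  have h6 := h5.indepFun_finset (Finset.univ ×ˢ {false}) (Finset.univ ×ˢ {true})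
    (by simp [Finset.disjoint_left]) fun p => hX p.1 p.2
  have h7 := h6.comp (φ := fun w (i : Fin d) => w ⟨(i, false), by simp⟩)
    (ψ := fun w (i : Fin d) => w ⟨(i, true), by simp⟩)
    (measurable_pi_lambda _ fun i => measurable_pi_apply _)
    (measurable_pi_lambda _ fun i => measurable_pi_apply _)
  exact h7

lemma IsBrownianMotion.charFun_increment (hW : IsBrownianMotion W P)
    {r t : ℝ≥0} (hrt : r ≤ t) (η : E d) :
    charFun (P.map fun ω => W t ω - W r ω) η
      = Complex.exp (((-((t - r : ℝ) * ‖η‖ ^ 2 / 2) : ℝ) : ℂ)) := by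
  have := hW.indep.isProbabilityMeasure
  have hlaw (i : Fin d) : HasLaw (fun ω => W t ω i - W r ω i) (gaussianReal 0 (t - r)) P := by
    have h1 := (hW.coord i).hasLaw_sub t r
    have h2 : nndist t.1 r.1 = t - r := by
      ext
      rw [coe_nndist, NNReal.coe_sub hrt, Real.dist_eq]
      exact abs_of_nonneg (sub_nonneg.2 hrt)
    rw [h2] at h1
    exact h1
  have hind : iIndepFun (fun i ω => W t ω i - W r ω i) P :=
    hW.indep.comp (fun _ w => w t - w r) fun _ => (measurable_pi_apply _).sub (measurable_pi_apply _)
  have hmap : P.map (fun ω => W t ω - W r ω)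
      = (Measure.pi fun _ : Fin d => gaussianReal 0 (t - r)).map (WithLp.toLp 2) := by
    have h3 := hind.map_fun_eq_pi_map fun i => (hlaw i).aemeasurable
    simp only [(hlaw _).map_eq] at h3
    rw [← h3, AEMeasurable.map_map_of_aemeasurable (WithLp.measurable_toLp 2 _).aemeasurable
      (aemeasurable_pi_lambda _ fun i => (hlaw i).aemeasurable)]
    rfl
  rw [hmap, charFun_pi, EuclideanSpace.real_norm_sq_eq]
  simp only [charFun_gaussianReal]
  rw [← Complex.exp_sum]
  congr 1
  push_cast
  rw [NNReal.coe_sub hrt]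
  simp [Finset.mul_sum, Finset.sum_div]

end BrownianMotion

end ShiftedOU

namespace ShiftedOU

/-! ### Sums over uniform partitions. -/

section RiemannSums

open Set Filter Topology

/-- The points of the uniform partition of `[r, t]` into `n + 1` intervals. -/
noncomputable def gridPoint (r t : ℝ) (n j : ℕ) : ℝ := r + j * ((t - r) / (n + 1))

lemma gridPoint_zero (r t : ℝ) (n : ℕ) : gridPoint r t n 0 = r := by simp [gridPoint]

lemma gridPoint_last (r t : ℝ) (n : ℕ) : gridPoint r t n (n + 1) = t := by
  have : (n : ℝ) + 1 ≠ 0 := by positivity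
  simp only [gridPoint]
  push_cast
  field_simp
  ring

lemma gridPoint_succ_sub (r t : ℝ) (n j : ℕ) :
    gridPoint r t n (j + 1) - gridPoint r t n j = (t - r) / (n + 1) := by
  simp only [gridPoint]
  push_cast
  ring

variable {r t : ℝ}

lemma monotone_gridPoint (h : r ≤ t) (n : ℕ) : Monotone (gridPoint r t n) := by
  refine monotone_nat_of_le_succ fun j => ?_
  rw [← sub_nonneg, gridPoint_succ_sub]
  have := sub_nonneg.2 h
  positivity

/-- A function whose increments are approximated by `S a b` up to `o(b - a)` is the limit of the
sums of `S` over uniform partitions. -/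
lemma tendsto_sum_gridPoint {F : Type*} [NormedAddCommGroup F] {H : ℝ → F} {S : ℝ → ℝ → F}
    (hrt : r ≤ t) (h : ∀ ε > 0, ∃ δ > 0, ∀ a b, r ≤ a → a ≤ b → b ≤ t → b - a < δ →
      ‖H b - H a - S a b‖ ≤ ε * (b - a)) :
    Tendsto (fun n => ∑ j ∈ Finset.range (n + 1), S (gridPoint r t n j) (gridPoint r t n (j + 1)))
      atTop (𝓝 (H t - H r)) := by
  rw [Metric.tendsto_atTop]
  intro ε hε
  have hd : 0 < t - r + 1 := by linarith
  -- The local errors add up to ε(t - r)/(2(t - r + 1)), which is below ε; the summand 1 covers the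
  -- case r = t.
  obtain ⟨δ, hδ, hS⟩ := h (ε / (2 * (t - r + 1))) (by positivity)
  obtain ⟨N, hN⟩ := exists_nat_gt ((t - r) / δ)
  refine ⟨N, fun n hn => ?_⟩
  have hmesh : (t - r) / (n + 1) < δ := by
    rw [div_lt_iff₀ (by positivity)]
    rw [div_lt_iff₀ hδ] at hN
    have : (N : ℝ) ≤ n := by exact_mod_cast hn
    nlinarith
  have htel : H t - H r = ∑ j ∈ Finset.range (n + 1),
      (H (gridPoint r t n (j + 1)) - H (gridPoint r t n j)) := by
    rw [Finset.sum_range_sub (fun j => H (gridPoint r t n j)), gridPoint_last, gridPoint_zero]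
  have htel2 : t - r = ∑ j ∈ Finset.range (n + 1),
      (gridPoint r t n (j + 1) - gridPoint r t n j) := by
    rw [Finset.sum_range_sub (fun j => gridPoint r t n j), gridPoint_last, gridPoint_zero]
  rw [dist_comm, dist_eq_norm, htel, ← Finset.sum_sub_distrib]
  have hm := monotone_gridPoint hrt n
  calc _ ≤ ∑ j ∈ Finset.range (n + 1), ε / (2 * (t - r + 1)) *
        (gridPoint r t n (j + 1) - gridPoint r t n j) := by
        refine norm_sum_le_of_le _ fun j hj => hS _ _ ?_ (hm j.le_succ) ?_ ?_
        · simpa [gridPoint_zero] using hm (Nat.zero_le j)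
        · simpa only [gridPoint_last] using hm (Finset.mem_range.1 hj)
        · rwa [gridPoint_succ_sub]
    _ = ε / (2 * (t - r + 1)) * (t - r) := by rw [← Finset.mul_sum, ← htel2]
    _ < ε := by
        rw [div_mul_eq_mul_div, div_lt_iff₀ (by positivity)]
        nlinarith [sub_nonneg.2 hrt]

lemma tendsto_riemann_sum {g : ℝ → ℝ} (hg : Continuous g) (hrt : r ≤ t) :
    Tendsto (fun n => ∑ j ∈ Finset.range (n + 1),
      (gridPoint r t n (j + 1) - gridPoint r t n j) * g (gridPoint r t n j))
      atTop (𝓝 (∫ q in r..t, g q)) := by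
  have hi (a b : ℝ) : IntervalIntegrable g volume a b := hg.intervalIntegrable a b
  have h := tendsto_sum_gridPoint (H := fun q => ∫ u in r..q, g u)
    (S := fun a b => (b - a) * g a) hrt fun ε hε => ?_
  · simpa using h
  obtain ⟨δ, hδ, hu⟩ := Metric.uniformContinuousOn_iff_le.1
    (isCompact_Icc.uniformContinuousOn_of_continuous (s := Icc r t) hg.continuousOn) ε hε
  refine ⟨δ, hδ, fun a b ha hab hb hd => ?_⟩
  rw [intervalIntegral.integral_interval_sub_left (hi _ _) (hi _ _)]
  have h1 : (b - a) * g a = ∫ u in a..b, g a := by simp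
  rw [h1, ← intervalIntegral.integral_sub (hi _ _) (by simp), ← abs_of_nonneg (sub_nonneg.2 hab)]
  refine intervalIntegral.norm_integral_le_of_norm_le_const fun u hum => ?_
  rw [uIoc_of_le hab] at hum
  rw [← dist_eq_norm]
  refine hu u ⟨by linarith [hum.1], by linarith [hum.2]⟩ a ⟨ha, by linarith⟩ ?_
  rw [Real.dist_eq, abs_of_nonneg (by linarith [hum.1])]
  linarith [hum.2]

end RiemannSums

/-! ### Pathwise stochastic convolution and variation of constants. -/

section StochConv

open Set Filter Topology Matrix
open scoped Matrix.Norms.L2Operator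

variable {d : ℕ} (A Q : Matrix (Fin d) (Fin d) ℝ)

/-- The convolution `∫_r^t e^{(t-q)A} √Q dw_q`, integrated by parts. -/
noncomputable def stochConv (r t : ℝ) (w : ℝ → E d) : E d :=
  act (CFC.sqrt Q) (w t - w r)
    + ∫ q in r..t, act (semigroup A (t - q) * A * CFC.sqrt Q) (w q - w r)

lemma continuous_act {α : Type*} [TopologicalSpace α] {M : α → Matrix (Fin d) (Fin d) ℝ}
    {x : α → E d} (hM : Continuous M) (hx : Continuous x) : Continuous fun a => act (M a) (x a) := by
  refine continuous_of_coord fun i => ?_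
  simp only [act_apply]
  have h (j : Fin d) : Continuous fun a => x a j :=
    (EuclideanSpace.proj (𝕜 := ℝ) j).continuous.comp hx
  exact continuous_finsetSum _ fun j _ => (hM.matrix_elem i j).mul (h j)

lemma continuousOn_act {α : Type*} [TopologicalSpace α] {M : α → Matrix (Fin d) (Fin d) ℝ}
    {x : α → E d} {s : Set α} (hM : ContinuousOn M s) (hx : ContinuousOn x s) :
    ContinuousOn (fun a => act (M a) (x a)) s := by
  rw [continuousOn_iff_continuous_domRestrict] at *
  exact continuous_act hM hx

lemma hasDerivAt_act {M : ℝ → Matrix (Fin d) (Fin d) ℝ} {x : ℝ → E d}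
    {M' : Matrix (Fin d) (Fin d) ℝ} {x' : E d} {q : ℝ} (hM : HasDerivAt M M' q)
    (hx : HasDerivAt x x' q) :
    HasDerivAt (fun a => act (M a) (x a)) (act M' (x q) + act (M q) x') q := by
  let L : Matrix (Fin d) (Fin d) ℝ →L[ℝ] E d →L[ℝ] E d :=
    ((toEuclideanCLM (n := Fin d) (𝕜 := ℝ)).toAlgEquiv.toLinearMap).toContinuousLinearMap
  exact (L.hasFDerivAt.comp_hasDerivAt q hM).clm_apply hx

lemma hasDerivAt_semigroup_sub (t q : ℝ) :
    HasDerivAt (fun q => semigroup A (t - q)) (-(semigroup A (t - q) * A)) q := by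
  have h := (hasDerivAt_semigroup A (t - q)).scomp q ((hasDerivAt_id q).const_sub t)
  simpa [Function.comp_def] using h

lemma continuous_semigroup_sub (t : ℝ) : Continuous fun q => semigroup A (t - q) :=
  (continuous_semigroup A).comp (by fun_prop)

lemma intervalIntegrable_act {M : ℝ → Matrix (Fin d) (Fin d) ℝ} {x : ℝ → E d} {a b : ℝ}
    (hM : Continuous M) (hx : ContinuousOn x (uIcc a b)) :
    IntervalIntegrable (fun q => act (M q) (x q)) volume a b :=
  (continuousOn_act hM.continuousOn hx).intervalIntegrable

/-- Variation of constants for the linear equation with additive forcing. -/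
lemma eq_add_stochConv {T s : ℝ} {f z w : ℝ → E d} {x : E d} (hf : ContinuousOn f (Icc s T))
    (hz : ContinuousOn z (Icc s T)) (hw : Continuous w)
    (h : ∀ t ∈ Icc s T, z t = x + (∫ q in s..t, (act A (z q) + f q))
      + act (CFC.sqrt Q) (w t - w s))
    {r t : ℝ} (hsr : s ≤ r) (hrt : r ≤ t) (htT : t ≤ T) :
    z t = act (semigroup A (t - r)) (z r) + shiftInt A f r t + stochConv A Q r t w := by
  have hD : ContinuousOn (fun q => act A (z q) + f q) (Icc s T) :=
    (continuousOn_act continuousOn_const hz).add hf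
  have hDi {a b : ℝ} (ha : a ∈ Icc s T) (hb : b ∈ Icc s T) :
      IntervalIntegrable (fun q => act A (z q) + f q) volume a b :=
    (hD.mono (uIcc_subset_Icc ha hb)).intervalIntegrable
  -- Removing the rough part leaves a function with derivative A z + f although `w` need not be
  -- differentiable. In the derivative of e^{(t-q)A} y(q) the remaining A-term is e^{(t-q)A}A(z - y)
  -- = e^{(t-q)A}A√Q(w_q - w_r), the integrand of `stochConv`.
  let y : ℝ → E d := fun q => z q - act (CFC.sqrt Q) (w q - w r)
  have hrm : r ∈ Icc s T := ⟨hsr, hrt.trans htT⟩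
  have hsm : s ∈ Icc s T := ⟨le_rfl, hsr.trans (hrt.trans htT)⟩
  have htm : t ∈ Icc s T := ⟨hsr.trans hrt, htT⟩
  have hsub : Icc r t ⊆ Icc s T := Icc_subset_Icc hsr htT
  have hy {q : ℝ} (hq : q ∈ Icc r t) : y q = z r + ∫ u in r..q, (act A (z u) + f u) := by
    have h1 := h q (hsub hq)
    have h2 := h r hrm
    have h3 := intervalIntegral.integral_interval_sub_left (hDi hsm (hsub hq)) (hDi hsm hrm)
    simp only [y]
    rw [← h3, h1, h2]
    simp only [map_sub]
    abel
  have hyd {q : ℝ} (hq : q ∈ Ioo r t) : HasDerivAt y (act A (z q) + f q) q := by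
    have hnhds : Icc s T ∈ 𝓝 q := mem_of_superset (Icc_mem_nhds hq.1 hq.2) hsub
    have h1 : HasDerivAt (fun q => z r + ∫ u in r..q, (act A (z u) + f u)) (act A (z q) + f q) q :=
      (intervalIntegral.integral_hasDerivAt_right
        (hDi hrm (hsub (Ioo_subset_Icc_self hq)))
        ((hD.mono (Ioo_subset_Icc_self.trans hsub)).stronglyMeasurableAtFilter isOpen_Ioo q hq)
        (hD.continuousAt hnhds)).const_add _
    refine h1.congr_of_eventuallyEq ?_
    filter_upwards [Icc_mem_nhds hq.1 hq.2] with u hu using hy hu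
  have hyc : ContinuousOn y (Icc r t) :=
    (hz.mono hsub).sub (continuousOn_act continuousOn_const (hw.sub continuous_const).continuousOn)
  have hwc : Continuous fun q => act (semigroup A (t - q) * A * CFC.sqrt Q) (w q - w r) :=
    continuous_act (((continuous_semigroup_sub A t).mul continuous_const).mul continuous_const)
      (hw.sub continuous_const)
  have hfi : IntervalIntegrable (fun q => act (semigroup A (t - q)) (f q)) volume r t :=
    intervalIntegrable_act (continuous_semigroup_sub A t)
      (hf.mono (by rw [uIcc_of_le hrt]; exact hsub))
  have hFTC := intervalIntegral.integral_eq_sub_of_hasDerivAt_of_le (a := r) (b := t) hrt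
    (f := fun q => act (semigroup A (t - q)) (y q))
    (f' := fun q => act (semigroup A (t - q) * A * CFC.sqrt Q) (w q - w r)
      + act (semigroup A (t - q)) (f q))
    (continuousOn_act (continuous_semigroup_sub A t).continuousOn hyc)
    (fun q hq => by
      refine (hasDerivAt_act (hasDerivAt_semigroup_sub A t q) (hyd hq)).congr_deriv ?_
      simp only [y, act, map_neg, map_mul, map_add, map_sub, _root_.neg_apply,
        mul_apply_eq_comp]
      abel)
    ((hwc.intervalIntegrable _ _).add hfi)
  rw [intervalIntegral.integral_add (hwc.intervalIntegrable _ _) hfi] at hFTC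
  simp only [sub_self, semigroup_zero, act_one, y, map_zero, sub_zero] at hFTC
  rw [sub_sub, eq_sub_iff_add_eq] at hFTC
  rw [stochConv, shiftInt, ← hFTC]
  abel

end StochConv

end ShiftedOU

namespace ShiftedOU

/-! ### Gaussian law and measurability of the noise. -/

section NoiseLaw

open Set Filter Topology Matrix
open scoped Matrix.Norms.L2Operator

variable {d : ℕ} (A Q : Matrix (Fin d) (Fin d) ℝ)

/-- With v = √Q(w - w_r), the function H(q) = e^{(t-q)A}v(q) + ∫_r^q e^{(t-u)A}A v(u) du has total
increment `stochConv`. On [a,b] its increment differs from the summand by ∫_a^b e^{(t-u)A}A(v(u) -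
v(b)) du, which is o(b - a) by uniform continuity of v. Only continuity of the path is needed. -/
lemma tendsto_sum_stochConv {w : ℝ → E d} (hw : Continuous w) {r t : ℝ} (hrt : r ≤ t) :
    Tendsto (fun n => ∑ j ∈ Finset.range (n + 1),
      act (semigroup A (t - gridPoint r t n j) * CFC.sqrt Q)
        (w (gridPoint r t n (j + 1)) - w (gridPoint r t n j)))
      atTop (𝓝 (stochConv A Q r t w)) := by
  let v : ℝ → E d := fun q => act (CFC.sqrt Q) (w q - w r)
  have hv : Continuous v := continuous_act continuous_const (hw.sub continuous_const)
  have hMc : Continuous fun q => semigroup A (t - q) * A :=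
    (continuous_semigroup_sub A t).mul continuous_const
  have hc {u : ℝ → E d} (hu : Continuous u) (a b : ℝ) :
      IntervalIntegrable (fun q => act (semigroup A (t - q) * A) (u q)) volume a b :=
    (continuous_act hMc hu).intervalIntegrable _ _
  have h := tendsto_sum_gridPoint
    (H := fun q => act (semigroup A (t - q)) (v q) + ∫ u in r..q, act (semigroup A (t - u) * A) (v u))
    (S := fun a b => act (semigroup A (t - a) * CFC.sqrt Q) (w b - w a)) hrt fun ε hε => ?_
  · refine (h.congr fun n => rfl).trans (le_of_eq ?_)
    congr 1
    simp [v, stochConv, semigroup_zero, act_mul]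
  obtain ⟨K, hK⟩ := isCompact_Icc.exists_bound_of_continuousOn (s := Icc r t) hMc.continuousOn
  have hK0 : 0 ≤ K := (norm_nonneg _).trans (hK r ⟨le_rfl, hrt⟩)
  obtain ⟨δ, hδ, hu⟩ := Metric.uniformContinuousOn_iff_le.1
    (isCompact_Icc.uniformContinuousOn_of_continuous (s := Icc r t) hv.continuousOn)
    (ε / (K + 1)) (by positivity)
  refine ⟨δ, hδ, fun a b ha hab hb hd => ?_⟩
  have h1 : (∫ u in a..b, act (semigroup A (t - u) * A) (v b))
      = act (semigroup A (t - a)) (v b) - act (semigroup A (t - b)) (v b) := by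
    have h2 := intervalIntegral.integral_eq_sub_of_hasDerivAt (a := a) (b := b)
      (f := fun q => -act (semigroup A (t - q)) (v b))
      (f' := fun u => act (semigroup A (t - u) * A) (v b)) (fun q _ => by
        have h3 := (hasDerivAt_act (hasDerivAt_semigroup_sub A t q) (hasDerivAt_const q (v b))).neg
        refine h3.congr_deriv ?_
        simp only [act, map_neg, map_zero, _root_.neg_apply, add_zero, neg_neg])
      (hc continuous_const _ _)
    rw [h2]
    abel
  have h4 : act (semigroup A (t - a) * CFC.sqrt Q) (w b - w a)
      = act (semigroup A (t - a)) (v b) - act (semigroup A (t - a)) (v a) := by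
    rw [act_mul, ← map_sub]
    congr 1
    simp only [v]
    rw [← map_sub]
    congr 1
    abel
  have h5 := intervalIntegral.integral_interval_sub_left (hc hv r b) (hc hv r a)
  have h6 : act (semigroup A (t - b)) (v b) + (∫ u in r..b, act (semigroup A (t - u) * A) (v u))
      - (act (semigroup A (t - a)) (v a) + ∫ u in r..a, act (semigroup A (t - u) * A) (v u))
      - act (semigroup A (t - a) * CFC.sqrt Q) (w b - w a)
      = ∫ u in a..b, act (semigroup A (t - u) * A) (v u - v b) := by
    have h7 (u : ℝ) : act (semigroup A (t - u) * A) (v u - v b)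
        = act (semigroup A (t - u) * A) (v u) - act (semigroup A (t - u) * A) (v b) := map_sub _ _ _
    simp only [h7]
    rw [intervalIntegral.integral_sub (hc hv _ _) (hc continuous_const _ _), h1, ← h5, h4]
    abel
  rw [h6, ← abs_of_nonneg (sub_nonneg.2 hab)]
  refine intervalIntegral.norm_integral_le_of_norm_le_const fun u hum => ?_
  rw [uIoc_of_le hab] at hum
  have hur : u ∈ Icc r t := ⟨by linarith [hum.1], by linarith [hum.2]⟩
  have h7 : dist (v u) (v b) ≤ ε / (K + 1) := by
    refine hu u hur b ⟨by linarith, hb⟩ ?_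
    rw [Real.dist_eq, abs_of_nonpos (by linarith [hum.2])]
    linarith [hum.1]
  rw [dist_eq_norm] at h7
  calc _ ≤ ‖semigroup A (t - u) * A‖ * ‖v u - v b‖ := norm_act_le _ _
    _ ≤ K * (ε / (K + 1)) := by gcongr; exact hK u hur
    _ ≤ ε := by
      rw [mul_div_assoc', div_le_iff₀ (by positivity)]
      nlinarith

/-- Factoring e^{tA} out of the integral leaves t only in the outer factors and in the upper limit.
-/
lemma continuous_stochConv {w : ℝ → E d} (hw : Continuous w) (r : ℝ) :
    Continuous fun t => stochConv A Q r t w := by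
  have h1 : Continuous fun q => act (semigroup A (-q) * A * CFC.sqrt Q) (w q - w r) :=
    continuous_act ((((continuous_semigroup A).comp continuous_neg).mul
      continuous_const).mul continuous_const) (hw.sub continuous_const)
  have h2 (t : ℝ) : stochConv A Q r t w = act (CFC.sqrt Q) (w t - w r)
      + act (semigroup A t) (∫ q in r..t, act (semigroup A (-q) * A * CFC.sqrt Q) (w q - w r)) := by
    have h3 := ContinuousLinearMap.intervalIntegral_comp_comm (μ := volume)
      (toEuclideanCLM (n := Fin d) (𝕜 := ℝ) (semigroup A t)) (h1.intervalIntegrable r t)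
    rw [stochConv]
    refine congrArg _ (Eq.trans (intervalIntegral.integral_congr fun q _ => ?_) h3)
    change _ = act (semigroup A t) (act _ _)
    rw [← act_mul, ← mul_assoc, ← mul_assoc, ← semigroup_add, sub_eq_add_neg]
  simp only [h2]
  exact (continuous_act continuous_const (hw.sub continuous_const)).add
    (continuous_act (continuous_semigroup A)
      (intervalIntegral.continuous_primitive (fun a b => h1.intervalIntegrable a b) r))

/-- Only the increments of the path from r on matter; the measurability with respect to past and
future rests on this. -/
lemma stochConv_congr {w w' : ℝ → E d} {r t : ℝ} (hrt : r ≤ t)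
    (h : ∀ q ∈ Icc r t, w q - w r = w' q - w' r) :
    stochConv A Q r t w = stochConv A Q r t w' := by
  rw [stochConv, stochConv, h t ⟨hrt, le_rfl⟩]
  congr 1
  refine intervalIntegral.integral_congr fun q hq => ?_
  rw [uIcc_of_le hrt] at hq
  simp only [h q hq]

lemma measurable_act_const {α : Type*} [MeasurableSpace α] (M : Matrix (Fin d) (Fin d) ℝ)
    {x : α → E d} (hx : Measurable x) : Measurable fun a => act M (x a) :=
  (toEuclideanCLM (n := Fin d) (𝕜 := ℝ) M).continuous.measurable.comp hx

lemma measurable_stochConv {α : Type*} [MeasurableSpace α] {w : ℝ → α → E d}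
    (hc : ∀ a, Continuous fun q => w q a) (hm : ∀ q, Measurable (w q)) (r t : ℝ) :
    Measurable fun a => stochConv A Q r t fun q => w q a := by
  have h1 : StronglyMeasurable (Function.uncurry fun q a =>
      act (semigroup A (t - q) * A * CFC.sqrt Q) (w q a - w r a)) := by
    refine stronglyMeasurable_uncurry_of_continuous_of_stronglyMeasurable (fun a => ?_) fun q => ?_
    · exact continuous_act (((continuous_semigroup_sub A t).mul continuous_const).mul
        continuous_const) ((hc a).sub continuous_const)
    · exact (measurable_act_const _ ((hm q).sub (hm r))).stronglyMeasurable
  have h2 (a b : ℝ) : Measurable fun x => ∫ q in Ioc a b,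
      act (semigroup A (t - q) * A * CFC.sqrt Q) (w q x - w r x) :=
    (h1.integral_prod_left (μ := volume.restrict (Ioc a b))).measurable
  exact (measurable_act_const _ ((hm t).sub (hm r))).add
    ((h2 r t).sub (h2 t r))

variable {Ω : Type*} [mΩ : MeasurableSpace Ω] {P : Measure Ω} {W : ℝ≥0 → Ω → E d}

lemma charFun_map_act (M : Matrix (Fin d) (Fin d) ℝ) {X : Ω → E d} (hX : AEMeasurable X P)
    (ξ : E d) : charFun (P.map fun ω => act M (X ω)) ξ = charFun (P.map X) (act Mᵀ ξ) := by
  have h1 : AEMeasurable (fun ω => act M (X ω)) P :=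
    (measurable_act_const M measurable_id).comp_aemeasurable hX
  rw [charFun_apply, charFun_apply, integral_map h1 (by fun_prop), integral_map hX (by fun_prop)]
  congr 1
  ext ω
  rw [real_inner_comm, inner_act, real_inner_comm]

/-- In the induction the first n summands are measurable for the past of `p n` and the next one for
its future, so the characteristic functions multiply. -/
lemma IsBrownianMotion.charFun_sum_increments (hW : IsBrownianMotion W P)
    (hm : ∀ t, Measurable (W t)) (M : ℕ → Matrix (Fin d) (Fin d) ℝ) {p : ℕ → ℝ≥0}
    (hp : Monotone p) (ξ : E d) (n : ℕ) :
    charFun (P.map fun ω => ∑ j ∈ Finset.range n, act (M j) (W (p (j + 1)) ω - W (p j) ω)) ξ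
      = Complex.exp (((-((∑ j ∈ Finset.range n,
          ((p (j + 1) : ℝ) - p j) * ‖act (M j)ᵀ ξ‖ ^ 2) / 2) : ℝ) : ℂ)) := by
  have := hW.indep.isProbabilityMeasure
  have hmeas (m : MeasurableSpace Ω) (j : ℕ)
      (h : Measurable[m] fun ω => W (p (j + 1)) ω - W (p j) ω) :
      Measurable[m] fun ω => act (M j) (W (p (j + 1)) ω - W (p j) ω) :=
    measurable_act_const _ h
  induction n with
  | zero => simp
  | succ n ih =>
    have h1 : Measurable[past W (p n)] fun ω =>
        ∑ j ∈ Finset.range n, act (M j) (W (p (j + 1)) ω - W (p j) ω) := by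
      refine Finset.measurable_sum _ fun j hj => hmeas _ j ?_
      have hj' := Finset.mem_range.1 hj
      exact (measurable_past (hp hj')).sub (measurable_past (hp hj'.le))
    have h2 := hmeas (future W (p n)) n (measurable_future (hp n.le_succ))
    have hind : IndepFun (fun ω => ∑ j ∈ Finset.range n, act (M j) (W (p (j + 1)) ω - W (p j) ω))
        (fun ω => act (M n) (W (p (n + 1)) ω - W (p n) ω)) P :=
      indep_of_indep_of_le_left (indep_of_indep_of_le_right
        (hW.indep_past_future hm (p n)) h2.comap_le) h1.comap_le
    simp only [Finset.sum_range_succ]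
    rw [hind.charFun_map_fun_add_eq_mul (h1.mono (past_le hm _) le_rfl).aemeasurable
      (h2.mono (future_le hm _) le_rfl).aemeasurable, Pi.mul_apply, ih,
      charFun_map_act (X := fun ω => W (p (n + 1)) ω - W (p n) ω) _
        ((hm _).sub (hm _)).aemeasurable, hW.charFun_increment (hp n.le_succ),
      ← Complex.exp_add]
    congr 1
    push_cast
    ring

variable {Q}

/-- The characteristic functions of the approximating sums converge by dominated convergence. Their
exponents are Riemann sums of the quadratic form in `inner_covMat`, so the limit is that of N(0,
Q_{t-r}). -/
lemma IsBrownianMotion.charFun_stochConv (hW : IsBrownianMotion W P)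
    (hm : ∀ t, Measurable (W t)) (hc : ∀ ω, Continuous fun t => W t ω) (hQ : Q.PosDef)
    {r t : ℝ} (hr : 0 ≤ r) (hrt : r ≤ t) (ξ : E d) :
    charFun (P.map fun ω => stochConv A Q r t fun q => W q.toNNReal ω) ξ
      = Complex.exp (((-(inner ℝ ξ (act (covMat A Q (t - r)) ξ) / 2) : ℝ) : ℂ)) := by
  have := hW.indep.isProbabilityMeasure
  have hcw (ω : Ω) : Continuous fun q : ℝ => W q.toNNReal ω := (hc ω).comp continuous_real_toNNReal
  have hgrid (n : ℕ) : Monotone fun j => (gridPoint r t n j).toNNReal :=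
    fun _ _ h => Real.toNNReal_mono (monotone_gridPoint hrt n h)
  have hgrid0 (n j : ℕ) : 0 ≤ gridPoint r t n j := by
    have := monotone_gridPoint hrt n (Nat.zero_le j)
    rw [gridPoint_zero] at this
    exact hr.trans this
  let S : ℕ → Ω → E d := fun n ω => ∑ j ∈ Finset.range (n + 1),
    act (semigroup A (t - gridPoint r t n j) * CFC.sqrt Q)
      (W (gridPoint r t n (j + 1)).toNNReal ω - W (gridPoint r t n j).toNNReal ω)
  have hS (n : ℕ) : Measurable (S n) := by
    refine Finset.measurable_sum _ fun j _ => measurable_act_const _ ?_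
    exact (hm _).sub (hm _)
  have hG : Measurable fun ω => stochConv A Q r t fun q => W q.toNNReal ω :=
    measurable_stochConv A Q hcw (fun q => hm _) r t
  let g : ℝ → ℝ := fun u => inner ℝ (act (semigroup A u)ᵀ ξ) (act Q (act (semigroup A u)ᵀ ξ))
  have hgc : Continuous g := by
    have h1 : Continuous fun s => act (semigroup A s)ᵀ ξ :=
      (continuous_act_left ξ).comp (continuous_semigroup A).matrix_transpose
    exact h1.inner (continuous_act continuous_const h1)
  have hgn (n j : ℕ) : ‖act (semigroup A (t - gridPoint r t n j) * CFC.sqrt Q)ᵀ ξ‖ ^ 2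
      = g (t - gridPoint r t n j) := by
    rw [transpose_mul, sqrt_transpose, act_mul, norm_sq_act_sqrt hQ.posSemidef]
  have h1 : Tendsto (fun n => charFun (P.map (S n)) ξ) atTop
      (𝓝 (charFun (P.map fun ω => stochConv A Q r t fun q => W q.toNNReal ω) ξ)) := by
    simp only [charFun_apply]
    rw [integral_map hG.aemeasurable (by fun_prop)]
    refine Tendsto.congr (fun n => (integral_map (hS n).aemeasurable (by fun_prop)).symm) ?_
    refine tendsto_integral_of_dominated_convergence (fun _ => 1) (fun n => ?_)
      (integrable_const _) (fun n => ae_of_all _ fun ω => ?_) (ae_of_all _ fun ω => ?_)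
    · have : Measurable fun ω => inner ℝ (S n ω) ξ := (hS n).inner measurable_const
      exact Measurable.aestronglyMeasurable (by fun_prop)
    · rw [Complex.norm_exp_ofReal_mul_I]
    · have h2 := tendsto_sum_stochConv A Q (hcw ω) hrt
      have h3 : Continuous fun x : E d => Complex.exp (((inner ℝ x ξ : ℝ) : ℂ) * Complex.I) := by
        fun_prop
      exact (h3.tendsto _).comp h2
  have h2 (n : ℕ) : charFun (P.map (S n)) ξ = Complex.exp (((-((∑ j ∈ Finset.range (n + 1),
      (gridPoint r t n (j + 1) - gridPoint r t n j) * g (t - gridPoint r t n j)) / 2) : ℝ) : ℂ)) := by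
    have h3 := hW.charFun_sum_increments hm
      (fun j => semigroup A (t - gridPoint r t n j) * CFC.sqrt Q) (hgrid n) ξ (n + 1)
    simpa only [hgn, Real.coe_toNNReal _ (hgrid0 n _)] using h3
  have h4 : Tendsto (fun n => charFun (P.map (S n)) ξ) atTop
      (𝓝 (Complex.exp (((-((∫ q in r..t, g (t - q)) / 2) : ℝ) : ℂ)))) := by
    simp only [h2]
    have h5 := tendsto_riemann_sum (g := fun q => g (t - q)) (by fun_prop) hrt
    have h6 : Continuous fun y : ℝ => Complex.exp ((-(y / 2) : ℝ) : ℂ) := by fun_prop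
    exact (h6.tendsto _).comp h5
  rw [tendsto_nhds_unique h1 h4, intervalIntegral.integral_comp_sub_left, sub_self, inner_covMat]

/-- The standardized noise acting on `[r, t]`. -/
noncomputable def noise {Ω : Type*} (A Q : Matrix (Fin d) (Fin d) ℝ) (W : ℝ≥0 → Ω → E d) (r t : ℝ) (ω : Ω) :
    E d :=
  act (covInvSqrt A Q (t - r)) (stochConv A Q r t fun q => W q.toNNReal ω)

lemma measurable_noise (hm : ∀ t, Measurable (W t)) (hc : ∀ ω, Continuous fun t => W t ω)
    (r t : ℝ) : Measurable (noise A Q W r t) :=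
  measurable_act_const _ (measurable_stochConv A Q
    (fun ω => (hc ω).comp continuous_real_toNNReal) (fun _ => hm _) r t)

/-- In the exponent Q_{t-r}^{1/2} Q_{t-r}^{-1/2} = 1 turns the quadratic form of Q_{t-r} into ‖ξ‖²;
this needs r < t for invertibility. -/
lemma IsBrownianMotion.map_noise (hW : IsBrownianMotion W P)
    (hm : ∀ t, Measurable (W t)) (hc : ∀ ω, Continuous fun t => W t ω) (hQ : Q.PosDef)
    {r t : ℝ} (hr : 0 ≤ r) (hrt : r < t) : P.map (noise A Q W r t) = stdGaussian (E d) := by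
  have := hW.indep.isProbabilityMeasure
  have hG : Measurable fun ω => stochConv A Q r t fun q => W q.toNNReal ω :=
    measurable_stochConv A Q (fun ω => (hc ω).comp continuous_real_toNNReal) (fun q => hm _) r t
  refine Measure.ext_of_charFun (funext fun ξ => ?_)
  have hpos : 0 < t - r := sub_pos.2 hrt
  have h1 := charFun_map_act (P := P) (covInvSqrt A Q (t - r)) hG.aemeasurable ξ
  have h2 : (covInvSqrt A Q (t - r))ᵀ = covInvSqrt A Q (t - r) := by
    rw [covInvSqrt, transpose_nonsing_inv, sqrt_transpose]
  refine h1.trans ?_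
  rw [h2, hW.charFun_stochConv A hm hc hQ hr hrt.le, charFun_stdGaussian,
    ← norm_sq_act_sqrt (covMat_posSemidef A hQ hpos.le), covInvSqrt,
    act_act_inv (isUnit_det_sqrt_covMat A hQ hpos)]
  push_cast
  congr 1
  ring

/-- On [r,t] the path may be replaced by its increment from r, frozen at zero before r, which is
expressed through future increments alone. -/
lemma measurable_noise_future {Ω : Type*} {W : ℝ≥0 → Ω → E d} (hc : ∀ ω, Continuous fun t => W t ω) {r t : ℝ} (hrt : r ≤ t) :
    Measurable[future W r.toNNReal] (noise A Q W r t) := by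
  let _ := future W r.toNNReal
  have h1 : noise A Q W r t = fun ω => act (covInvSqrt A Q (t - r)) (stochConv A Q r t fun q =>
      W (max q r).toNNReal ω - W r.toNNReal ω) := by
    ext1 ω
    rw [noise]
    congr 1
    refine stochConv_congr A Q hrt fun q hq => ?_
    simp [hq.1]
  rw [h1]
  refine measurable_act_const _ (measurable_stochConv A Q
    (w := fun q ω => W (max q r).toNNReal ω - W r.toNNReal ω) (fun ω => ?_) (fun q => ?_) r t)
  · exact ((hc ω).comp (by fun_prop)).sub continuous_const
  · exact measurable_future (Real.toNNReal_mono (le_max_right _ _))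

/-- Stopping the path at r does not alter it on [s,t]. -/
lemma measurable_stochConv_past {Ω : Type*} {W : ℝ≥0 → Ω → E d} (hc : ∀ ω, Continuous fun t => W t ω) {s t r : ℝ} (hst : s ≤ t)
    (htr : t ≤ r) : Measurable[past W r.toNNReal] fun ω =>
      stochConv A Q s t fun q => W q.toNNReal ω := by
  let _ := past W r.toNNReal
  have h1 : (fun ω => stochConv A Q s t fun q => W q.toNNReal ω)
      = fun ω => stochConv A Q s t fun q => W (min q r).toNNReal ω := by
    ext1 ω
    refine stochConv_congr A Q hst fun q hq => ?_
    simp [hq.2.trans htr, hst.trans htr]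
  rw [h1]
  refine measurable_stochConv A Q (w := fun q ω => W (min q r).toNNReal ω)
    (fun ω => (hc ω).comp (by fun_prop)) (fun q => ?_) s t
  exact measurable_past (Real.toNNReal_mono (min_le_right _ _))

end NoiseLaw

end ShiftedOU

namespace ShiftedOU

/-! ### Products of weights along ordered times. -/

section Chain

open Set
open scoped ENNReal

variable {Ω : Type*}

/-- The product of the weights `p` along the times `σ 0 < ⋯ < σ (n - 1) < t`. -/
noncomputable def chain (p : ℝ → ℝ → Ω → ℝ) (n : ℕ) (σ : Fin n → ℝ) (t : ℝ) (ω : Ω) : ℝ :=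
  ∏ i : Fin n, p ((Fin.snoc σ t : Fin (n + 1) → ℝ) i.castSucc)
    ((Fin.snoc σ t : Fin (n + 1) → ℝ) i.succ) ω

lemma chain_zero (p : ℝ → ℝ → Ω → ℝ) (σ : Fin 0 → ℝ) (t : ℝ) (ω : Ω) : chain p 0 σ t ω = 1 := by
  simp [chain]

lemma chain_succ (p : ℝ → ℝ → Ω → ℝ) (n : ℕ) (σ : Fin n → ℝ) (r t : ℝ) (ω : Ω) :
    chain p (n + 1) (Fin.snoc σ r) t ω = chain p n σ r ω * p r t ω := by
  simp only [chain, Fin.prod_univ_castSucc, Fin.succ_last, Fin.snoc_last, Fin.snoc_castSucc,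
    Fin.succ_castSucc]

lemma chain_eq_of_mem {n : ℕ} {s t : ℝ} {σ : Fin n → ℝ} (h : σ ∈ timeSimplex n s t) (i : Fin n) :
    s < (Fin.snoc σ t : Fin (n + 1) → ℝ) i.castSucc ∧
    (Fin.snoc σ t : Fin (n + 1) → ℝ) i.castSucc < (Fin.snoc σ t : Fin (n + 1) → ℝ) i.succ ∧
    (Fin.snoc σ t : Fin (n + 1) → ℝ) i.succ ≤ t := by
  cases n with
  | zero => exact i.elim0
  | succ n =>
    refine ⟨by simpa using (h.2 i).1, ?_⟩
    induction i using Fin.lastCases with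
    | last => simpa using (h.2 (Fin.last n)).2
    | cast i =>
      rw [Fin.succ_castSucc, Fin.snoc_castSucc, Fin.snoc_castSucc]
      exact ⟨h.1 (Fin.castSucc_lt_succ), (h.2 _).2.le⟩

end Chain

/-! ### Processes driven by independent steps, and moments of chains. -/

namespace StepSystem

open Set
open scoped ENNReal

variable {X : Type} [NormedAddCommGroup X] [MeasurableSpace X] {S : StepSystem X}
  {wt χ : ℝ → ℝ → X → X → ℝ} {ψ : ℝ → X → ℝ}
  {Ω : Type*} [mΩ : MeasurableSpace Ω] {P : Measure Ω} {s T : ℝ} {x : X}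
  {Y : ℝ → Ω → X} {p : ℝ → ℝ → Ω → ℝ}

lemma enorm_pull_le {F : Type*} [NormedAddCommGroup F] [NormedSpace ℝ F]
    {h : ℝ → ℝ → X → X → F} (hwt : S.Admissible wt) (hh : S.Admissible h) (n k : ℕ) :
    ∃ (C : ℝ≥0) (j : ℕ),
    ∀ (ψ : ℝ → X → ℝ) (t : ℝ) (w : ℝ≥0∞), w ≠ ∞ → (∀ z, ‖ψ t z‖ₑ ≤ w * (1 + ‖z‖ₑ) ^ k) →
      ∀ s x, ‖S.pull wt h ψ n s t x‖ₑ ≤ C * w * S.sing s t * (1 + ‖x‖ₑ) ^ j := by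
  cases n with
  | zero =>
    obtain ⟨C, j, hC⟩ := hh.bound k
    refine ⟨C, j, fun ψ t w hw hψ s x => (enorm_integral_le_lintegral_enorm _).trans ?_⟩
    refine (lintegral_smul_le hψ hw (hC s t x)).trans (le_of_eq ?_)
    ring
  | succ n =>
    obtain ⟨C, j, hC⟩ := lintegral_pull_succ_le hwt hh n k
    obtain ⟨D, hD⟩ := S.lintegral_sing_mul
    refine ⟨C * D, j, fun ψ t w hw hψ s x => (enorm_integral_le_lintegral_enorm _).trans ?_⟩
    have hm : Measurable fun r => S.sing s r * S.sing r t :=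
      (S.measurable_sing_right s).mul (S.measurable_sing_left t)
    calc _ ≤ ∫⁻ r, C * w * (1 + ‖x‖ₑ) ^ j * (S.sing s r * S.sing r t) := by
          refine lintegral_mono fun r => (enorm_integral_le_lintegral_enorm _).trans
            ((hC ψ t w hw hψ s r x).trans (le_of_eq (by ring)))
      _ ≤ C * w * (1 + ‖x‖ₑ) ^ j * (D * S.sing s t) := by
          rw [lintegral_const_mul _ hm]
          gcongr
          exact hD s t
      _ = _ := by push_cast; ring

/-- A process `Y` on `(s, T]` with weights `p` which is obtained from the step system through
independent noise. -/
structure Realization (S : StepSystem X) (wt : ℝ → ℝ → X → X → ℝ) (P : Measure Ω) (s T : ℝ)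
    (x : X) (Y : ℝ → Ω → X) (p : ℝ → ℝ → Ω → ℝ) : Prop where
  start : ∀ t, s < t → t ≤ T → ∃ N : Ω → X, Measurable N ∧ P.map N = S.γ ∧
    ∀ᵐ ω ∂P, Y t ω = S.step s t x (N ω)
  markov : ∀ r t, s < r → r < t → t ≤ T → ∃ m ≤ mΩ,
    (∀ q, s < q → q ≤ r → Measurable[m] (Y q)) ∧
    (∀ q q', s < q → q < q' → q' ≤ r → Measurable[m] (p q q')) ∧
    ∃ N : Ω → X, Measurable[mΩ] N ∧ Indep m (MeasurableSpace.comap N inferInstance) P ∧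
      P.map N = S.γ ∧ (∀ᵐ ω ∂P, Y t ω = S.step r t (Y r ω) (N ω)) ∧
      ∀ᵐ ω ∂P, p r t ω = wt r t (Y r ω) (N ω)
  meas : ∀ t, s < t → t ≤ T → Measurable (Y t)
  meas_weight : Measurable fun q : ℝ × ℝ × Ω =>
    if s < q.1 ∧ q.1 < q.2.1 ∧ q.2.1 ≤ T then p q.1 q.2.1 q.2.2 else 0

namespace Realization

lemma measurable_chain {Ω : Type*} {m : MeasurableSpace Ω} {p : ℝ → ℝ → Ω → ℝ} {n : ℕ} {t : ℝ} {σ : Fin n → ℝ}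
    (hσ : σ ∈ timeSimplex n s t)
    (h : ∀ q q', s < q → q < q' → q' ≤ t → Measurable[m] (p q q')) :
    Measurable[m] (chain p n σ t) := by
  have : chain p n σ t = fun ω => ∏ i : Fin n, p ((Fin.snoc σ t : Fin (n + 1) → ℝ) i.castSucc)
    ((Fin.snoc σ t : Fin (n + 1) → ℝ) i.succ) ω := rfl
  rw [this]
  refine Finset.measurable_prod _ fun i _ => ?_
  obtain ⟨h1, h2, h3⟩ := chain_eq_of_mem hσ i
  exact h _ _ h1 h2 h3

lemma measurable_weight (hR : S.Realization wt P s T x Y p) {q q' : ℝ} (h1 : s < q) (h2 : q < q')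
    (h3 : q' ≤ T) : Measurable (p q q') := by
  have h := hR.meas_weight.comp (by fun_prop : Measurable fun ω : Ω => (q, q', ω))
  simpa [Function.comp_def, h1, h2, h3] using h

lemma measurable_chain_of_le (hR : S.Realization wt P s T x Y p) {n : ℕ} {t : ℝ} {σ : Fin n → ℝ}
    (hσ : σ ∈ timeSimplex n s t) (ht : t ≤ T) : Measurable (chain p n σ t) :=
  measurable_chain hσ fun _ _ h1 h2 h3 => hR.measurable_weight h1 h2 (h3.trans ht)

lemma map_prodMk_eq {Ω : Type*} {m : MeasurableSpace Ω} {mΩ : MeasurableSpace Ω} {P : Measure Ω}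
    [IsProbabilityMeasure P]
    {β : Type*} [MeasurableSpace β] (hm : m ≤ mΩ) {V : Ω → β} {N : Ω → X} (hV : Measurable[m] V) (hN : Measurable N)
    (hind : Indep m (MeasurableSpace.comap N inferInstance) P) :
    P.map (fun ω => (V ω, N ω)) = (P.map V).prod (P.map N) := by
  have h : IndepFun V N P := indep_of_indep_of_le_left hind hV.comap_le
  exact (indepFun_iff_map_prod_eq_prod_map_map (hV.mono hm le_rfl).aemeasurable
    hN.aemeasurable).1 h

/-- The Markov property in integrated form: (J, V) is known at the earlier time and N is independent
of it, so their joint law is a product and N can be integrated out first. -/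
lemma lintegral_markov {Ω : Type*} {m : MeasurableSpace Ω} {mΩ : MeasurableSpace Ω} {P : Measure Ω}
    [IsProbabilityMeasure P]
    (hm : m ≤ mΩ) {J : Ω → ℝ} {V N : Ω → X} (hJ : Measurable[m] J) (hV : Measurable[m] V)
    (hN : Measurable N) (hind : Indep m (MeasurableSpace.comap N inferInstance) P)
    (hlaw : P.map N = S.γ) {g : X × X → ℝ≥0∞} (hg : Measurable g) :
    ∫⁻ ω, ‖J ω‖ₑ * g (V ω, N ω) ∂P = ∫⁻ ω, ‖J ω‖ₑ * ∫⁻ ξ, g (V ω, ξ) ∂S.γ ∂P := by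
  have hmap := map_prodMk_eq hm (hJ.prodMk hV) hN hind
  have hJV : Measurable fun ω => (J ω, V ω) := (hJ.mono hm le_rfl).prodMk (hV.mono hm le_rfl)
  have hG : Measurable fun q : (ℝ × X) × X => ‖q.1.1‖ₑ * g (q.1.2, q.2) := by
    have := hg.comp (by fun_prop : Measurable fun q : (ℝ × X) × X => (q.1.2, q.2))
    exact (by fun_prop : Measurable fun q : (ℝ × X) × X => ‖q.1.1‖ₑ).mul this
  have h1 := lintegral_map (μ := P) hG (hJV.prodMk hN)
  rw [hmap, hlaw, lintegral_prod _ hG.aemeasurable, lintegral_map hG.lintegral_prod_right' hJV] at h1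
  simp only at h1
  rw [← h1]
  refine lintegral_congr fun ω => ?_
  have hg' : Measurable fun ξ => g (V ω, ξ) := hg.comp measurable_prodMk_left
  rw [lintegral_const_mul _ hg']

lemma integral_markov {Ω : Type*} {m : MeasurableSpace Ω} {mΩ : MeasurableSpace Ω} {P : Measure Ω}
    [IsProbabilityMeasure P]
    (hm : m ≤ mΩ) {J : Ω → ℝ} {V N : Ω → X} (hJ : Measurable[m] J) (hV : Measurable[m] V)
    (hN : Measurable N) (hind : Indep m (MeasurableSpace.comap N inferInstance) P)
    (hlaw : P.map N = S.γ) {g : X × X → ℝ} (hg : Measurable g)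
    (hint : Integrable (fun ω => J ω * g (V ω, N ω)) P) :
    ∫ ω, J ω * g (V ω, N ω) ∂P = ∫ ω, J ω * ∫ ξ, g (V ω, ξ) ∂S.γ ∂P := by
  have hmap := map_prodMk_eq hm (hJ.prodMk hV) hN hind
  have hJV : Measurable fun ω => (J ω, V ω) := (hJ.mono hm le_rfl).prodMk (hV.mono hm le_rfl)
  have hG : Measurable fun q : (ℝ × X) × X => q.1.1 * g (q.1.2, q.2) := by
    have := hg.comp (by fun_prop : Measurable fun q : (ℝ × X) × X => (q.1.2, q.2))
    exact (by fun_prop : Measurable fun q : (ℝ × X) × X => q.1.1).mul this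
  have h0 : Integrable (fun q : (ℝ × X) × X => q.1.1 * g (q.1.2, q.2))
      ((P.map fun ω => (J ω, V ω)).prod S.γ) := by
    rw [← hlaw, ← hmap]
    exact (integrable_map_measure hG.aestronglyMeasurable (hJV.prodMk hN).aemeasurable).2 hint
  have h1 := integral_map (μ := P) (hJV.prodMk hN).aemeasurable hG.aestronglyMeasurable
  rw [hmap, hlaw, integral_prod _ h0, integral_map hJV.aemeasurable
    (hG.stronglyMeasurable.integral_prod_right'.aestronglyMeasurable)] at h1
  simp only at h1
  rw [← h1]
  simp_rw [integral_const_mul]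

/-- The product of the singularities of a chain of times. -/
noncomputable def singProd (S : StepSystem X) (s : ℝ) : (n : ℕ) → (Fin n → ℝ) → ℝ → ℝ≥0∞
  | 0 => fun _ t => S.sing s t
  | n + 1 => fun σ t => singProd S s n (fun i => σ i.castSucc) (σ (Fin.last n)) *
      S.sing (σ (Fin.last n)) t

lemma measurable_singProd (n : ℕ) :
    Measurable fun q : (Fin n → ℝ) × ℝ => singProd S s n q.1 q.2 := by
  induction n with
  | zero => exact (S.measurable_sing_right s).comp measurable_snd
  | succ n ih =>
    have h1 : Measurable fun q : (Fin (n + 1) → ℝ) × ℝ =>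
        ((fun i : Fin n => q.1 i.castSucc), q.1 (Fin.last n)) := by fun_prop
    have h2 : Measurable fun q : (Fin (n + 1) → ℝ) × ℝ => (q.1 (Fin.last n), q.2) := by fun_prop
    exact (ih.comp h1).mul (S.measurable_sing.comp h2)

/-- Each new last time costs one application of the convolution inequality for `sing`. -/
lemma lintegral_singProd_le (S : StepSystem X) (s : ℝ) (n : ℕ) :
    ∃ C : ℝ≥0, ∀ t, ∫⁻ σ in timeSimplex n s t, singProd S s n σ t ≤ C * S.sing s t := by
  induction n with
  | zero =>
    refine ⟨1, fun t => ?_⟩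
    simp only [singProd, lintegral_const, ENNReal.coe_one]
    rw [mul_comm]
    gcongr
    calc _ ≤ volume (univ : Set (Fin 0 → ℝ)) := Measure.restrict_apply_le _ _
      _ ≤ 1 := by simp [volume_pi]
  | succ n ih =>
    obtain ⟨C, hC⟩ := ih
    obtain ⟨D, hD⟩ := S.lintegral_sing_mul
    refine ⟨C * D, fun t => ?_⟩
    have hF : Measurable fun σ : Fin (n + 1) → ℝ => singProd S s (n + 1) σ t :=
      (measurable_singProd (n + 1)).comp (measurable_id.prodMk measurable_const)
    rw [setLIntegral_timeSimplex_succ hF]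
    have hm : Measurable fun r => S.sing s r * S.sing r t :=
      (S.measurable_sing_right s).mul (S.measurable_sing_left t)
    calc _ ≤ ∫⁻ r in Ioo s t, C * (S.sing s r * S.sing r t) := by
          refine lintegral_mono fun r => ?_
          simp only [singProd, Fin.snoc_castSucc, Fin.snoc_last]
          have hF' : Measurable fun σ : Fin n → ℝ => singProd S s n σ r :=
            (measurable_singProd n).comp (measurable_id.prodMk measurable_const)
          rw [lintegral_mul_const _ hF', ← mul_assoc]
          gcongr
          exact hC r
      _ ≤ ∫⁻ r, C * (S.sing s r * S.sing r t) := setLIntegral_le_lintegral _ _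
      _ ≤ C * (D * S.sing s t) := by
          rw [lintegral_const_mul _ hm]
          gcongr
          exact hD s t
      _ = _ := by push_cast; ring

variable [IsProbabilityMeasure P] [BorelSpace X] [SecondCountableTopology X]

/-- The last step is integrated out first, costing a factor `S.sing r t` and a possibly higher power
of 1 + ‖Y_r‖; hence the induction treats all powers k at once. For the empty chain, `χ` is
identically one and supplies the moments of the first step. -/
lemma lintegral_chain_le (hR : S.Realization wt P s T x Y p) (hwt : S.Admissible wt)
    (hχ : S.Admissible χ) (hχ1 : ∀ t, s < t → t ≤ T → ∀ ξ, χ s t x ξ = 1) (n : ℕ) :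
    ∀ k, ∃ (C : ℝ≥0) (j : ℕ), ∀ t, s < t → t ≤ T → ∀ σ ∈ timeSimplex n s t,
      ∫⁻ ω, ‖chain p n σ t ω‖ₑ * (1 + ‖Y t ω‖ₑ) ^ k ∂P
        ≤ C * singProd S s n σ t * (1 + ‖x‖ₑ) ^ j := by
  induction n with
  | zero =>
    intro k
    obtain ⟨C, j, hC⟩ := hχ.bound k
    refine ⟨C, j, fun t hst htT σ _ => ?_⟩
    obtain ⟨N, hN, hlaw, hY⟩ := hR.start t hst htT
    refine le_trans (le_of_eq ?_) (hC s t x)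
    have hm : Measurable fun ξ : X => ‖χ s t x ξ‖ₑ * (1 + ‖S.step s t x ξ‖ₑ) ^ k := by
      have h1 : Measurable fun ξ : X => (s, t, x, ξ) := by fun_prop
      have h2 := S.measurable_step.comp h1
      have h3 : StronglyMeasurable fun ξ => χ s t x ξ := hχ.meas.comp_measurable h1
      exact h3.enorm.mul ((h2.enorm.const_add _).pow_const _)
    rw [← hlaw, lintegral_map hm hN]
    refine lintegral_congr_ae ?_
    filter_upwards [hY] with ω hω
    simp [chain_zero, hω, hχ1 t hst htT]
  | succ n ih =>
    intro k
    obtain ⟨C, j, hC⟩ := hwt.bound k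
    obtain ⟨D, l, hD⟩ := ih j
    refine ⟨C * D, l, fun t hst htT σ hσ => ?_⟩
    obtain ⟨τ, r, rfl⟩ : ∃ (τ : Fin n → ℝ) (r : ℝ), σ = Fin.snoc τ r :=
      ⟨Fin.init σ, σ (Fin.last n), (Fin.snoc_init_self σ).symm⟩
    obtain ⟨hr, hτ⟩ := snoc_mem_timeSimplex.1 hσ
    have hmeas : Measurable fun ω => ‖chain p n τ r ω‖ₑ * (1 + ‖Y r ω‖ₑ) ^ j :=
      (hR.measurable_chain_of_le hτ (hr.2.le.trans htT)).enorm.mul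
        (((hR.meas r hr.1 (hr.2.le.trans htT)).enorm.const_add _).pow_const _)
    obtain ⟨m, hm, hYm, hpm, N, hN, hind, hlaw, hYt, hpt⟩ := hR.markov r t hr.1 hr.2 htT
    have h1 : Measurable fun q : X × X => (r, t, q.1, q.2) := by fun_prop
    have hg : Measurable fun q : X × X => ‖wt r t q.1 q.2‖ₑ * (1 + ‖S.step r t q.1 q.2‖ₑ) ^ k := by
      have h2 := S.measurable_step.comp h1
      have h3 : StronglyMeasurable fun q : X × X => wt r t q.1 q.2 := hwt.meas.comp_measurable h1
      exact h3.enorm.mul ((h2.enorm.const_add _).pow_const _)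
    have hJ := measurable_chain hτ hpm
    have key := lintegral_markov (S := S) hm hJ (hYm r hr.1 le_rfl) hN hind hlaw hg
    calc _ = ∫⁻ ω, ‖chain p n τ r ω‖ₑ *
          (‖wt r t (Y r ω) (N ω)‖ₑ * (1 + ‖S.step r t (Y r ω) (N ω)‖ₑ) ^ k) ∂P := by
          refine lintegral_congr_ae ?_
          filter_upwards [hYt, hpt] with ω h1 h2
          rw [chain_succ, h1, h2, enorm_mul, mul_assoc]
      _ ≤ ∫⁻ ω, C * S.sing r t * (‖chain p n τ r ω‖ₑ * (1 + ‖Y r ω‖ₑ) ^ j) ∂P := by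
          rw [key]
          refine lintegral_mono fun ω => ?_
          calc _ ≤ ‖chain p n τ r ω‖ₑ * (C * S.sing r t * (1 + ‖Y r ω‖ₑ) ^ j) := by
                gcongr; exact hC r t (Y r ω)
            _ = _ := by ring
      _ ≤ C * S.sing r t * (D * singProd S s n τ r * (1 + ‖x‖ₑ) ^ l) := by
          rw [lintegral_const_mul _ hmeas]
          gcongr
          exact hD r hr.1 (hr.2.le.trans htT) τ hτ
      _ = _ := by
          simp only [singProd, Fin.snoc_castSucc, Fin.snoc_last]
          push_cast
          ring

end Realization

end StepSystem

end ShiftedOU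

namespace ShiftedOU

/-! ### Expectations of chains as iterated kernels. -/

namespace StepSystem.Realization

open Set
open scoped ENNReal

variable {X : Type} [NormedAddCommGroup X] [MeasurableSpace X] {S : StepSystem X}
  {wt χ : ℝ → ℝ → X → X → ℝ} {ψ : ℝ → X → ℝ} {s T : ℝ} {x : X}

lemma singProd_ne_top (n : ℕ) (σ : Fin n → ℝ) (t : ℝ) : singProd S s n σ t ≠ ∞ := by
  induction n generalizing t with
  | zero => exact S.sing_ne_top s t
  | succ n ih => exact ENNReal.mul_ne_top (ih _ _) (S.sing_ne_top _ _)

lemma measurable_terminal (hψ : Measurable fun p : ℝ × X => ψ p.1 p.2) (t : ℝ) :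
    Measurable (ψ t) :=
  hψ.comp (by fun_prop : Measurable fun z : X => (t, z))

lemma measurable_iter_zero (hwt : S.Admissible wt) (hψ : Measurable fun p : ℝ × X => ψ p.1 p.2)
    (t : ℝ) : Measurable fun p : ℝ × X => S.iter wt ψ 0 p.1 t p.2 :=
  (measurable_iter hwt hψ 0).comp (by fun_prop : Measurable fun p : ℝ × X => (p.1, t, p.2))

variable [BorelSpace X] [SecondCountableTopology X]
  {Ω : Type*} [mΩ : MeasurableSpace Ω] {P : Measure Ω} [IsProbabilityMeasure P]
  {Y : ℝ → Ω → X} {p : ℝ → ℝ → Ω → ℝ}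

lemma lintegral_terminal_chain_le (hR : S.Realization wt P s T x Y p) (hwt : S.Admissible wt)
    (hχ : S.Admissible χ) (hχ1 : ∀ t, s < t → t ≤ T → ∀ ξ, χ s t x ξ = 1)
    (ψ : ℝ → X → ℝ) (n k : ℕ) :
    ∃ C : ℝ≥0∞, C ≠ ∞ ∧ ∀ t w, s < t → t ≤ T → (∀ z, ‖ψ t z‖ₑ ≤ w * (1 + ‖z‖ₑ) ^ k) →
      ∀ σ ∈ timeSimplex n s t,
      ∫⁻ ω, ‖ψ t (Y t ω) * chain p n σ t ω‖ₑ ∂P ≤ C * w * singProd S s n σ t := by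
  obtain ⟨C, j, hC⟩ := hR.lintegral_chain_le hwt hχ hχ1 n k
  refine ⟨C * (1 + ‖x‖ₑ) ^ j, by finiteness, fun t w hst htT hψw σ hσ => ?_⟩
  have hm : Measurable fun ω => ‖chain p n σ t ω‖ₑ * (1 + ‖Y t ω‖ₑ) ^ k :=
    (hR.measurable_chain_of_le hσ htT).enorm.mul
      (((hR.meas t hst htT).enorm.const_add _).pow_const _)
  calc _ ≤ ∫⁻ ω, w * (‖chain p n σ t ω‖ₑ * (1 + ‖Y t ω‖ₑ) ^ k) ∂P := by
        refine lintegral_mono fun ω => ?_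
        rw [enorm_mul]
        calc _ ≤ (w * (1 + ‖Y t ω‖ₑ) ^ k) * ‖chain p n σ t ω‖ₑ := by gcongr; exact hψw _
          _ = _ := by ring
    _ ≤ w * (C * singProd S s n σ t * (1 + ‖x‖ₑ) ^ j) := by
        rw [lintegral_const_mul _ hm]
        gcongr
        exact hC t hst htT σ hσ
    _ = _ := by ring

lemma integrable_terminal_chain (hR : S.Realization wt P s T x Y p) (hwt : S.Admissible wt)
    (hχ : S.Admissible χ) (hχ1 : ∀ t, s < t → t ≤ T → ∀ ξ, χ s t x ξ = 1)
    (hψ : Measurable fun p : ℝ × X => ψ p.1 p.2) {n k : ℕ} {t : ℝ} {w : ℝ≥0∞} (hst : s < t)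
    (htT : t ≤ T) (hw : w ≠ ∞) (hψw : ∀ z, ‖ψ t z‖ₑ ≤ w * (1 + ‖z‖ₑ) ^ k) {σ : Fin n → ℝ}
    (hσ : σ ∈ timeSimplex n s t) :
    Integrable (fun ω => ψ t (Y t ω) * chain p n σ t ω) P := by
  obtain ⟨C, hC, h⟩ := hR.lintegral_terminal_chain_le hwt hχ hχ1 ψ n k
  refine ⟨(((measurable_terminal hψ t).comp (hR.meas t hst htT)).mul
    (hR.measurable_chain_of_le hσ htT)).aestronglyMeasurable, ?_⟩
  have h1 := singProd_ne_top (S := S) (s := s) n σ t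
  exact (h t w hst htT hψw σ hσ).trans_lt (by finiteness)

/-- Conditioning on the past up to r, the last weight and the terminal function average to the
one-step weighted operator evaluated at Y_r: one time disappears and the terminal function changes.
-/
lemma integral_terminal_chain_succ (hR : S.Realization wt P s T x Y p) (hwt : S.Admissible wt)
    (hχ : S.Admissible χ) (hχ1 : ∀ t, s < t → t ≤ T → ∀ ξ, χ s t x ξ = 1)
    (hψ : Measurable fun p : ℝ × X => ψ p.1 p.2) {n k : ℕ} {r t : ℝ} {w : ℝ≥0∞} (hsr : s < r)
    (hrt : r < t) (htT : t ≤ T) (hw : w ≠ ∞) (hψw : ∀ z, ‖ψ t z‖ₑ ≤ w * (1 + ‖z‖ₑ) ^ k)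
    {σ : Fin n → ℝ} (hσ : σ ∈ timeSimplex n s r) :
    ∫ ω, ψ t (Y t ω) * chain p (n + 1) (Fin.snoc σ r) t ω ∂P
      = ∫ ω, S.iter wt ψ 0 r t (Y r ω) * chain p n σ r ω ∂P := by
  have hint := hR.integrable_terminal_chain hwt hχ hχ1 hψ (hsr.trans hrt) htT hw hψw
    (snoc_mem_timeSimplex.2 ⟨⟨hsr, hrt⟩, hσ⟩)
  obtain ⟨m, hm, hYm, hpm, N, hN, hind, hlaw, hYt, hpt⟩ := hR.markov r t hsr hrt htT
  have h1 : Measurable fun q : X × X => (r, t, q.1, q.2) := by fun_prop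
  have hg : Measurable fun q : X × X => ψ t (S.step r t q.1 q.2) * wt r t q.1 q.2 := by
    have h2 := (measurable_terminal hψ t).comp (S.measurable_step.comp h1)
    have h3 : StronglyMeasurable fun q : X × X => wt r t q.1 q.2 := hwt.meas.comp_measurable h1
    exact h2.mul h3.measurable
  have hae : (fun ω => ψ t (Y t ω) * chain p (n + 1) (Fin.snoc σ r) t ω) =ᵐ[P] fun ω =>
      chain p n σ r ω * (ψ t (S.step r t (Y r ω) (N ω)) * wt r t (Y r ω) (N ω)) := by
    filter_upwards [hYt, hpt] with ω h1 h2
    rw [chain_succ, h1, h2]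
    ring
  rw [integral_congr_ae hae, integral_markov (S := S) hm (measurable_chain hσ hpm)
    (hYm r hsr le_rfl) hN hind hlaw hg (hint.congr hae)]
  refine integral_congr_ae (.of_forall fun ω => ?_)
  simp only [iter]
  ring

/-- The outermost integral is over the last time r. Integrating out the last step gives the same
problem with n times and the terminal function `S.iter wt ψ 0 r t` at time r, so ψ must be allowed
to depend on time. `pull_succ_eq` puts the last time outside on the operator side as well. -/
theorem iteratedIntegral_terminal_chain (hR : S.Realization wt P s T x Y p)
    (hwt : S.Admissible wt) (hχ : S.Admissible χ)
    (hχ1 : ∀ t, s < t → t ≤ T → ∀ ξ, χ s t x ξ = 1) (hsing : ∀ s t, ¬ s < t → S.sing s t = 0)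
    (n : ℕ) : ∀ {ψ : ℝ → X → ℝ}, (Measurable fun p : ℝ × X => ψ p.1 p.2) →
    ∀ {k : ℕ} {t : ℝ} {w : ℝ≥0∞}, s < t → t ≤ T → w ≠ ∞ →
    (∀ z, ‖ψ t z‖ₑ ≤ w * (1 + ‖z‖ₑ) ^ k) →
    iteratedIntegral s n (fun σ => ∫ ω, ψ t (Y t ω) * chain p n σ t ω ∂P) t
      = S.pull wt χ ψ n s t x := by
  induction n with
  | zero =>
    intro ψ hψ k t w hst htT hw hψw
    obtain ⟨N, hN, hlaw, hY⟩ := hR.start t hst htT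
    have h1 : Measurable fun ξ : X => ψ t (S.step s t x ξ) :=
      (measurable_terminal hψ t).comp (S.measurable_step.comp
        (by fun_prop : Measurable fun ξ : X => (s, t, x, ξ)))
    simp only [iteratedIntegral, chain_zero, mul_one, pull, hχ1 t hst htT, smul_eq_mul]
    rw [← hlaw, integral_map hN.aemeasurable h1.aestronglyMeasurable]
    refine integral_congr_ae ?_
    filter_upwards [hY] with ω hω
    rw [hω]
  | succ n ih =>
    intro ψ hψ k t w hst htT hw hψw
    rw [iteratedIntegral_succ hst.le, pull_succ_eq hwt hψ hw hψw n hχ s x]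
    obtain ⟨C, j, hC⟩ := enorm_iter_le hwt 0 k
    obtain ⟨D, l, hD⟩ := enorm_pull_le hwt hχ n j
    have hbd (r : ℝ) := hC ψ t w hw hψw r
    have hfin (r : ℝ) : C * w * S.sing r t ≠ ∞ := by
      have := S.sing_ne_top r t
      finiteness
    rw [← integral_indicator measurableSet_Ioo]
    refine integral_congr_ae (.of_forall fun r => ?_)
    simp only
    by_cases hr : r ∈ Ioo s t
    · rw [indicator_of_mem hr, ← ih (measurable_iter_zero hwt hψ t) hr.1 (hr.2.le.trans htT) (hfin r)
        (hbd r)]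
      refine iteratedIntegral_congr hr.1.le fun σ hσ => ?_
      exact hR.integral_terminal_chain_succ hwt hχ hχ1 hψ hr.1 hr.2 htT hw hψw hσ
    · rw [indicator_of_notMem hr]
      -- Off (s,t) one of the two singularities vanishes, and the growth bound then forces the
      -- operator to be zero; this matches integration over ℝ with integration over (s,t).
      have h0 : S.sing r t * S.sing s r = 0 := by
        by_cases h : r < t
        · rw [hsing s r fun h' => hr ⟨h', h⟩, mul_zero]
        · rw [hsing r t h, zero_mul]
      have h1 := hD (fun q z => S.iter wt ψ 0 q t z) r _ (hfin r) (hbd r) s x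
      have h2 : D * (C * w * S.sing r t) * S.sing s r * (1 + ‖x‖ₑ) ^ l
          = D * (C * w) * (S.sing r t * S.sing s r) * (1 + ‖x‖ₑ) ^ l := by ring
      rw [h2, h0, mul_zero, zero_mul] at h1
      exact (enorm_eq_zero.1 (le_antisymm h1 zero_le)).symm

/-- Tonelli: for fixed times the expectation is bounded by a multiple of the product of
singularities, which is integrable over the simplex. -/
theorem integrable_terminal_chain_prod (hR : S.Realization wt P s T x Y p)
    (hwt : S.Admissible wt) (hχ : S.Admissible χ)
    (hχ1 : ∀ t, s < t → t ≤ T → ∀ ξ, χ s t x ξ = 1)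
    (hψ : Measurable fun p : ℝ × X => ψ p.1 p.2) (n : ℕ) {k : ℕ} {t : ℝ} {w : ℝ≥0∞} (hst : s < t)
    (htT : t ≤ T) (hw : w ≠ ∞) (hψw : ∀ z, ‖ψ t z‖ₑ ≤ w * (1 + ‖z‖ₑ) ^ k) :
    Integrable (fun q : (Fin n → ℝ) × Ω => ψ t (Y t q.2) * chain p n q.1 t q.2)
      ((volume.restrict (timeSimplex n s t)).prod P) := by
  -- Only the weight cut off at unordered times is jointly measurable; on the simplex the cut-off
  -- has no effect.
  let p' : ℝ → ℝ → Ω → ℝ := fun q q' ω => if s < q ∧ q < q' ∧ q' ≤ T then p q q' ω else 0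
  have hm : Measurable fun q : (Fin n → ℝ) × Ω => ψ t (Y t q.2) * chain p' n q.1 t q.2 := by
    refine ((measurable_terminal hψ t).comp ((hR.meas t hst htT).comp measurable_snd)).mul ?_
    simp only [chain]
    refine Finset.measurable_fun_prod _ fun i _ => ?_
    have hs (j : Fin (n + 1)) : Measurable fun q : (Fin n → ℝ) × Ω =>
        (Fin.snoc q.1 t : Fin (n + 1) → ℝ) j := by
      induction j using Fin.lastCases with
      | last => simp
      | cast j =>
        simp only [Fin.snoc_castSucc]
        exact (measurable_pi_apply j).comp measurable_fst
    exact hR.meas_weight.comp ((hs i.castSucc).prodMk ((hs i.succ).prodMk measurable_snd))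
  have heq : ∀ σ ∈ timeSimplex n s t, ∀ ω, chain p n σ t ω = chain p' n σ t ω := by
    intro σ hσ ω
    refine Finset.prod_congr rfl fun i _ => ?_
    obtain ⟨h1, h2, h3⟩ := chain_eq_of_mem hσ i
    simp only [p', h1, h2, h3.trans htT, and_self, if_true]
  have hae : (fun q : (Fin n → ℝ) × Ω => ψ t (Y t q.2) * chain p' n q.1 t q.2)
      =ᵐ[(volume.restrict (timeSimplex n s t)).prod P]
      fun q : (Fin n → ℝ) × Ω => ψ t (Y t q.2) * chain p n q.1 t q.2 := by
    have h1 : ∀ᵐ q ∂((volume.restrict (timeSimplex n s t)).prod P),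
        q.1 ∈ timeSimplex n s t :=
      Measure.quasiMeasurePreserving_fst.ae (ae_restrict_mem (measurableSet_timeSimplex n s t))
    filter_upwards [h1] with q hq
    rw [heq q.1 hq]
  refine Integrable.congr ⟨hm.aestronglyMeasurable, ?_⟩ hae
  obtain ⟨C, hC, h⟩ := hR.lintegral_terminal_chain_le hwt hχ hχ1 ψ n k
  obtain ⟨D, hD⟩ := lintegral_singProd_le S s n
  rw [hasFiniteIntegral_iff_enorm, lintegral_prod _ hm.enorm.aemeasurable]
  have hm' : Measurable fun σ : Fin n → ℝ => singProd S s n σ t :=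
    (measurable_singProd n).comp (measurable_id.prodMk measurable_const)
  calc _ ≤ ∫⁻ σ in timeSimplex n s t, C * w * singProd S s n σ t := by
        refine setLIntegral_mono (hm'.const_mul _) fun σ hσ => ?_
        simp only [← heq σ hσ]
        exact h t w hst htT hψw σ hσ
    _ ≤ C * w * (D * S.sing s t) := by
        rw [lintegral_const_mul _ hm']
        gcongr
        exact hD t
    _ < ∞ := by
        have := S.sing_ne_top s t
        finiteness

end StepSystem.Realization

end ShiftedOU

namespace ShiftedOU

/-! ### The Ornstein–Uhlenbeck process realizes the step system. -/

section OUProcess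

open Set Matrix
open scoped Classical Matrix.Norms.L2Operator

variable {d : ℕ} {A Q : Matrix (Fin d) (Fin d) ℝ} {f : ℝ → E d} {B : ℝ → E d → E d} {T : ℝ}
  {Ω : Type*} [mΩ : MeasurableSpace Ω] {P : Measure Ω} {W : ℝ≥0 → Ω → E d}

/-- The explicit solution of the linear equation started at `x` at time `s`. -/
noncomputable def ouProcess {Ω : Type*} (A Q : Matrix (Fin d) (Fin d) ℝ) (f : ℝ → E d)
    (W : ℝ≥0 → Ω → E d) (s : ℝ) (x : E d) (t : ℝ) (ω : Ω) : E d :=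
  act (semigroup A (t - s)) x + shiftInt A f s t + stochConv A Q s t fun q => W q.toNNReal ω

/-- Variation of constants from s identifies the solution with the explicit process, and from r it
gives the flow relation. Being pathwise, both hold outside one null set common to all times. -/
lemma IsSolution.ae_flow {Z : ℝ → Ω → E d} {s : ℝ} {x : E d} (hs : s ∈ Icc 0 T)
    (hf : ContinuousOn f (Icc 0 T)) (hZ : IsSolution A Q f W P T s x Z) {W' : ℝ≥0 → Ω → E d}
    (hW' : ∀ᵐ ω ∂P, ∀ t, W' t ω = W t ω) (hc : ∀ ω, Continuous fun t => W' t ω) :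
    ∀ᵐ ω ∂P, (∀ t ∈ Icc s T, Z t ω = ouProcess A Q f W' s x t ω) ∧
      ∀ r t, s ≤ r → r ≤ t → t ≤ T → ouProcess A Q f W' s x t ω =
        act (semigroup A (t - r)) (ouProcess A Q f W' s x r ω) + shiftInt A f r t +
          stochConv A Q r t fun q => W' q.toNNReal ω := by
  filter_upwards [hZ, hW'] with ω ⟨hzc, hz⟩ hω
  have hcw : Continuous fun q : ℝ => W' q.toNNReal ω := (hc ω).comp continuous_real_toNNReal
  have hf' : ContinuousOn f (Icc s T) := hf.mono (Icc_subset_Icc_left hs.1)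
  have hz' : ∀ t ∈ Icc s T, Z t ω = x + (∫ q in s..t, (act A (Z q ω) + f q))
      + act (CFC.sqrt Q) (W' t.toNNReal ω - W' s.toNNReal ω) := by
    intro t ht
    rw [hω, hω]
    exact hz t ht
  have hflow {r t : ℝ} := eq_add_stochConv A Q hf' hzc hcw hz' (r := r) (t := t)
  have hzs : Z s ω = x := by
    rw [hz s ⟨le_rfl, hs.2⟩]
    simp
  have h1 : ∀ t ∈ Icc s T, Z t ω = ouProcess A Q f W' s x t ω := by
    intro t ht
    rw [hflow le_rfl ht.1 ht.2, hzs, ouProcess]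
  refine ⟨h1, fun r t hsr hrt htT => ?_⟩
  rw [← h1 t ⟨hsr.trans hrt, htT⟩, ← h1 r ⟨hsr, hrt.trans htT⟩]
  exact hflow hsr hrt htT

lemma act_sqrt_noise {Ω : Type*} {W : ℝ≥0 → Ω → E d} (hQ : Q.PosDef) {r t : ℝ} (hrt : r < t) (ω : Ω) :
    act (CFC.sqrt (covMat A Q (t - r))) (noise A Q W r t ω)
      = stochConv A Q r t fun q => W q.toNNReal ω := by
  rw [noise, covInvSqrt, act_act_inv (isUnit_det_sqrt_covMat A hQ (sub_pos.2 hrt))]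

lemma measurable_ouProcess {Ω : Type*} {m : MeasurableSpace Ω} {W : ℝ≥0 → Ω → E d} {s t : ℝ}
    (h : Measurable fun ω => stochConv A Q s t fun q => W q.toNNReal ω) (x : E d) :
    Measurable (ouProcess A Q f W s x t) :=
  h.const_add _

lemma measurable_uncurry_ouProcess (hm : ∀ t, Measurable (W t))
    (hc : ∀ ω, Continuous fun t => W t ω) (hf : ContinuousOn f (Icc 0 T)) (s : ℝ) (x : E d) :
    Measurable fun p : ℝ × Ω => if Valid T s p.1 then ouProcess A Q f W s x p.1 p.2 else 0 := by
  have hcw (ω : Ω) : Continuous fun q : ℝ => W q.toNNReal ω := (hc ω).comp continuous_real_toNNReal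
  have h1 : Measurable fun p : ℝ × Ω => stochConv A Q s p.1 fun q => W q.toNNReal p.2 :=
    (stronglyMeasurable_uncurry_of_continuous_of_stronglyMeasurable
      (u := fun t ω => stochConv A Q s t fun q => W q.toNNReal ω)
      (fun ω => continuous_stochConv A Q (hcw ω) s)
      fun t => (measurable_stochConv A Q hcw (fun q => hm _) s t).stronglyMeasurable).measurable
  have h2 := (measurable_shiftInt (A := A) hf).comp
    (by fun_prop : Measurable fun p : ℝ × Ω => (s, p.1))
  have h3 : Measurable fun p : ℝ × Ω => act (semigroup A (p.1 - s)) x :=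
    measurable_act (fun i j => ((continuous_semigroup A).matrix_elem i j).measurable.comp
      (by fun_prop)) measurable_const
  refine measurable_ite_valid measurable_const measurable_fst ((h3.add h2).add h1) fun p hp => ?_
  simp [ouProcess, hp]

lemma measurable_pairing {Ω : Type*} {m : MeasurableSpace Ω} {Y : ℝ → Ω → E d} {r t : ℝ}
    (hB : Measurable (B r)) (hr : Measurable (Y r)) (ht : Measurable (Y t)) :
    Measurable (pairing A Q f B Y r t) :=
  (measurable_act_const _ (hB.comp hr)).inner
    (measurable_act_const _ ((ht.sub (measurable_act_const _ hr)).sub_const _))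

lemma measurable_drift
    (hB : Measurable fun p : ℝ × E d => (Icc 0 T).indicator (fun s => B s p.2) p.1)
    {r : ℝ} (hr : r ∈ Icc 0 T) : Measurable (B r) := by
  have := hB.comp (by fun_prop : Measurable fun z : E d => (r, z))
  simpa [Function.comp_def, hr.1, hr.2] using this

/-- The driving variable is `noise` and the σ-algebra is `past`. By the flow relation Z_t -
e^{(t-r)A}Z_r - F_{r,t} is the stochastic convolution, so applying Q_{t-r}^{-1/2} recovers the noise
and `pairing` becomes the abstract weight. -/
theorem realization_ouProcess [IsProbabilityMeasure P] (hW : IsBrownianMotion W P)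
    (hm : ∀ t, Measurable (W t))
    (hc : ∀ ω, Continuous fun t => W t ω) (hQ : Q.PosDef) (hf : ContinuousOn f (Icc 0 T))
    (hB : Measurable fun p : ℝ × E d => (Icc 0 T).indicator (fun s => B s p.2) p.1)
    {s : ℝ} (hs : 0 ≤ s) (x : E d)
    (hflow : ∀ᵐ ω ∂P, ∀ r t, s ≤ r → r ≤ t → t ≤ T → ouProcess A Q f W s x t ω =
        act (semigroup A (t - r)) (ouProcess A Q f W s x r ω) + shiftInt A f r t +
          stochConv A Q r t fun q => W q.toNNReal ω) :
    (ouSystem T A hQ hf).Realization (ouWt A Q B T) P s T x (ouProcess A Q f W s x)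
      (pairing A Q f B (ouProcess A Q f W s x)) where
  start t hst htT := by
    refine ⟨noise A Q W s t, measurable_noise A hm hc s t, hW.map_noise A hm hc hQ hs hst,
      .of_forall fun ω => ?_⟩
    have hv : Valid T s t := ⟨hs, hst, htT⟩
    change _ = ouStep A Q f T s t x _
    rw [ouStep, if_pos hv, act_sqrt_noise hQ hst, ouProcess]
  markov r t hsr hrt htT := by
    have hr0 : 0 ≤ r := hs.trans hsr.le
    have hv : Valid T r t := ⟨hr0, hrt, htT⟩
    have hY {q : ℝ} (h1 : s < q) (h2 : q ≤ r) :
        Measurable[past W r.toNNReal] (ouProcess A Q f W s x q) :=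
      measurable_ouProcess (measurable_stochConv_past A hc h1.le h2) x
    refine ⟨past W r.toNNReal, past_le hm _, fun q h1 h2 => hY h1 h2, fun q q' h1 h2 h3 => ?_,
      noise A Q W r t, measurable_noise A hm hc r t, ?_, hW.map_noise A hm hc hQ hr0 hrt, ?_, ?_⟩
    · exact measurable_pairing (measurable_drift hB
        ⟨hs.trans h1.le, h2.le.trans (h3.trans (hrt.le.trans htT))⟩) (hY h1 (h2.le.trans h3))
        (hY (h1.trans h2) h3)
    · exact indep_of_indep_of_le_right (hW.indep_past_future hm _)
        (measurable_noise_future A hc hrt.le).comap_le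
    · filter_upwards [hflow] with ω hω
      change _ = ouStep A Q f T r t _ _
      rw [ouStep, if_pos hv, act_sqrt_noise hQ hrt, hω r t hsr.le hrt.le htT]
    · filter_upwards [hflow] with ω hω
      have h1 : ouProcess A Q f W s x t ω - act (semigroup A (t - r)) (ouProcess A Q f W s x r ω)
          - shiftInt A f r t = stochConv A Q r t fun q => W q.toNNReal ω := by
        rw [hω r t hsr.le hrt.le htT]
        abel
      rw [pairing, h1, ouWt, ouVec, if_pos hv, inner_act _ (B r _), transpose_transpose, noise]
  meas t hst _ := measurable_ouProcess (measurable_stochConv A Q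
    (fun ω => (hc ω).comp continuous_real_toNNReal) (fun q => hm q.toNNReal) s t) x
  meas_weight := by
    have hY := measurable_uncurry_ouProcess (A := A) (Q := Q) hm hc hf s x
    set Y : ℝ × Ω → E d := fun p => if Valid T s p.1 then ouProcess A Q f W s x p.1 p.2 else 0
    have hY1 : Measurable fun q : ℝ × ℝ × Ω => Y (q.1, q.2.2) := hY.comp (by fun_prop)
    have hY2 : Measurable fun q : ℝ × ℝ × Ω => Y (q.2.1, q.2.2) := hY.comp (by fun_prop)
    have hF : Measurable fun q : ℝ × ℝ × Ω =>
        if Valid T q.1 q.2.1 then shiftInt A f q.1 q.2.1 else 0 :=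
      (measurable_shiftInt (A := A) hf).comp
        (by fun_prop : Measurable fun q : ℝ × ℝ × Ω => (q.1, q.2.1))
    have hBY : Measurable fun q : ℝ × ℝ × Ω =>
        (Icc 0 T).indicator (fun s => B s (Y (q.1, q.2.2))) q.1 :=
      hB.comp (measurable_fst.prodMk hY1)
    have hS : Measurable fun q : ℝ × ℝ × Ω => act (semigroup A (q.2.1 - q.1)) (Y (q.1, q.2.2)) :=
      measurable_act (fun i j => ((continuous_semigroup A).matrix_elem i j).measurable.comp
        (by fun_prop)) hY1
    have hG := (measurable_act (measurable_Lam_sub (A := A) hQ (α := ℝ × ℝ × Ω) measurable_fst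
      (measurable_fst.comp measurable_snd)) hBY).inner (𝕜 := ℝ)
      (measurable_act (measurable_covInvSqrt_sub (A := A) hQ (α := ℝ × ℝ × Ω) measurable_fst
      (measurable_fst.comp measurable_snd)) ((hY2.sub hS).sub hF))
    have hset : MeasurableSet {q : ℝ × ℝ × Ω | s < q.1 ∧ q.1 < q.2.1 ∧ q.2.1 ≤ T} :=
      (measurableSet_lt measurable_const measurable_fst).inter
        ((measurableSet_lt measurable_fst (measurable_fst.comp measurable_snd)).inter
          (measurableSet_le (measurable_fst.comp measurable_snd) measurable_const))
    have key (g : ℝ × ℝ × Ω → ℝ) (hg : Measurable g)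
        (h : ∀ q : ℝ × ℝ × Ω, s < q.1 ∧ q.1 < q.2.1 ∧ q.2.1 ≤ T →
          pairing A Q f B (ouProcess A Q f W s x) q.1 q.2.1 q.2.2 = g q) :
        Measurable fun q : ℝ × ℝ × Ω => if s < q.1 ∧ q.1 < q.2.1 ∧ q.2.1 ≤ T then
          pairing A Q f B (ouProcess A Q f W s x) q.1 q.2.1 q.2.2 else 0 := by
      have h1 : (fun q : ℝ × ℝ × Ω => if s < q.1 ∧ q.1 < q.2.1 ∧ q.2.1 ≤ T then
          pairing A Q f B (ouProcess A Q f W s x) q.1 q.2.1 q.2.2 else 0)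
          = fun q => if s < q.1 ∧ q.1 < q.2.1 ∧ q.2.1 ≤ T then g q else 0 := by
        ext q
        split_ifs with hq
        · exact h q hq
        · rfl
      rw [h1]
      exact Measurable.ite hset hg measurable_const
    refine key _ hG fun q hq => ?_
    have hv : Valid T q.1 q.2.1 := ⟨hs.trans hq.1.le, hq.2⟩
    have hv1 : Valid T s q.1 := ⟨hs, hq.1, hv.mem_left.2⟩
    have hv2 : Valid T s q.2.1 := hv1.trans hv
    simp only [Y, hv, hv1, hv2, if_true, pairing, Function.comp_apply, Pi.sub_apply,
      max_eq_left hv.sub_mem.1.le, indicator_of_mem hv.mem_left]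

end OUProcess

end ShiftedOU

namespace ShiftedOU

/-! ### The iteration scheme as a series of iterated kernels. -/

section Iteration

open Set
open scoped ENNReal

variable {d : ℕ} {T : ℝ} {S : StepSystem (E d)} {wt χ : ℝ → ℝ → E d → E d → ℝ}
  {wv : ℝ → ℝ → E d → E d → E d} {B : ℝ → E d → E d} {φ : E d → ℝ}
  {Ω : Type*} [mΩ : MeasurableSpace Ω] {P : Measure Ω}
  {Z : ℝ → E d → ℝ → Ω → E d}

/-- The data which identify the iteration scheme of a process `Z` with the kernels of a step
system. -/
structure IterationData (S : StepSystem (E d)) (wt χ : ℝ → ℝ → E d → E d → ℝ)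
    (wv : ℝ → ℝ → E d → E d → E d) (B : ℝ → E d → E d) (T : ℝ) (P : Measure Ω)
    (Z : ℝ → E d → ℝ → Ω → E d) (φ : E d → ℝ) : Prop where
  wt_adm : S.Admissible wt
  ind_adm : S.Admissible χ
  vec_adm : S.Admissible wv
  grad : S.HasGradientWeight χ wv
  wt_eq : ∀ s t x ξ, wt s t x ξ = inner ℝ (B s x) (wv s t x ξ)
  ind_eq : ∀ s t x ξ, Valid T s t → χ s t x ξ = 1
  sing_eq : ∀ s t, ¬ Valid T s t → S.sing s t = 0
  aemeas : ∀ s t x, Valid T s t → AEMeasurable (Z s x t) P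
  law : ∀ s t x, Valid T s t → P.map (Z s x t) = S.γ.map (S.step s t x)
  meas : Measurable φ
  bdd : ∃ w : ℝ≥0∞, w ≠ ∞ ∧ ∀ z, ‖φ z‖ₑ ≤ w * (1 + ‖z‖ₑ) ^ 0

namespace IterationData

lemma measurable_step (S : StepSystem (E d)) (s t : ℝ) (x : E d) : Measurable (S.step s t x) :=
  S.measurable_step.comp (by fun_prop : Measurable fun ξ : E d => (s, t, x, ξ))

variable (h : IterationData S wt χ wv B T P Z φ)
include h

/-- Only the one-time laws of `Z` enter the iteration scheme, so it can be computed with the step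
system. -/
lemma evol_eq {s t : ℝ} (hv : Valid T s t) {g : E d → ℝ} (hg : Measurable g) (x : E d) :
    evol P Z s t g x = ∫ ξ, g (S.step s t x ξ) ∂S.γ := by
  rw [evol, ← integral_map (h.aemeas s t x hv) hg.aestronglyMeasurable, h.law s t x hv,
    integral_map (measurable_step S s t x).aemeasurable hg.aestronglyMeasurable]

lemma integrable_iff {s t : ℝ} (hv : Valid T s t) {g : E d → ℝ} (hg : Measurable g) (x : E d) :
    Integrable (fun ω => g (Z s x t ω)) P ↔ Integrable (fun ξ => g (S.step s t x ξ)) S.γ := by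
  have h1 := integrable_map_measure (μ := P) (f := Z s x t) hg.aestronglyMeasurable
    (h.aemeas s t x hv)
  rw [h.law s t x hv] at h1
  have h2 := integrable_map_measure (μ := S.γ) (f := S.step s t x) hg.aestronglyMeasurable
    (measurable_step S s t x).aemeasurable
  exact h1.symm.trans h2

lemma measurable_const_terminal : Measurable fun p : ℝ × E d => (fun _ : ℝ => φ) p.1 p.2 :=
  h.meas.comp measurable_snd

lemma measurable_iter_right (k : ℕ) (r t : ℝ) : Measurable (S.iter wt (fun _ => φ) k r t) :=
  (StepSystem.measurable_iter h.wt_adm h.measurable_const_terminal k).comp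
    (by fun_prop : Measurable fun z : E d => (r, t, z))

lemma hasGradientAt_sum (n : ℕ) (s t : ℝ) (x : E d) :
    HasGradientAt (fun x => ∑ k ∈ Finset.range n, S.pull wt χ (fun _ => φ) k s t x)
      (∑ k ∈ Finset.range n, S.pull wt wv (fun _ => φ) k s t x) x := by
  obtain ⟨w, hw, hφ⟩ := h.bdd
  have hk (k : ℕ) := StepSystem.hasGradientAt_pull h.grad h.wt_adm h.ind_adm h.vec_adm
    h.measurable_const_terminal (k := 0) (ψ := fun _ => φ) (t := t) hw hφ k s x
  simp only [hasGradientAt_iff_hasFDerivAt] at hk ⊢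
  rw [map_sum]
  exact HasFDerivAt.fun_sum fun k _ => hk k

lemma inner_gradient_sum (n : ℕ) (s t : ℝ) (x : E d) :
    inner ℝ (B s x) (gradient (fun x => ∑ k ∈ Finset.range n,
      S.pull wt χ (fun _ => φ) k s t x) x)
      = ∑ k ∈ Finset.range n, S.iter wt (fun _ => φ) k s t x := by
  obtain ⟨w, hw, hφ⟩ := h.bdd
  rw [(h.hasGradientAt_sum n s t x).gradient, inner_sum]
  exact Finset.sum_congr rfl fun k _ => StepSystem.inner_pull h.wt_adm h.vec_adm h.wt_eq
    h.measurable_const_terminal (t := t) hw hφ k s x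

lemma integrable_iter_step (k : ℕ) {s r t : ℝ} (hv : Valid T s r) (x : E d) :
    Integrable (fun ξ => S.iter wt (fun _ => φ) k r t (S.step s r x ξ)) S.γ := by
  obtain ⟨w, hw, hφ⟩ := h.bdd
  have h1 := (StepSystem.integrable_pull_succ h.wt_adm h.ind_adm h.measurable_const_terminal k
    (k := 0) (ψ := fun _ => φ) (t := t) hw hφ s x).1 r
  simpa only [h.ind_eq s r _ _ hv, smul_eq_mul, mul_one] using h1

/-- The kernels integrate r over ℝ and the scheme over (s,t). Outside that interval one of the two
time pairs is invalid, its singularity is zero and so is the integrand; inside, the indicator weight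
is one. -/
lemma integral_iter_step (k : ℕ) {s t : ℝ} (hv : Valid T s t) (x : E d) :
    IntegrableOn (fun r => ∫ ξ, S.iter wt (fun _ => φ) k r t (S.step s r x ξ) ∂S.γ) (Ioo s t) ∧
    ∫ r in Ioo s t, ∫ ξ, S.iter wt (fun _ => φ) k r t (S.step s r x ξ) ∂S.γ
      = S.pull wt χ (fun _ => φ) (k + 1) s t x := by
  obtain ⟨w, hw, hφ⟩ := h.bdd
  have h1 := (StepSystem.integrable_pull_succ h.wt_adm h.ind_adm h.measurable_const_terminal k
    (k := 0) (ψ := fun _ => φ) (t := t) hw hφ s x).2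
  obtain ⟨C, j, hC⟩ := StepSystem.lintegral_pull_succ_le h.wt_adm h.ind_adm k 0
  have h2 (r : ℝ) (hr : r ∉ Ioo s t) :
      ∫ ξ, S.iter wt (fun _ => φ) k r t (S.step s r x ξ) • χ s r x ξ ∂S.γ = 0 := by
    have h3 : S.sing s r * S.sing r t = 0 := by
      by_cases h4 : Valid T s r
      · rw [h.sing_eq r t fun h5 => hr ⟨h4.2.1, h5.2.1⟩, mul_zero]
      · rw [h.sing_eq s r h4, zero_mul]
    have h6 := (enorm_integral_le_lintegral_enorm _).trans (hC (fun _ => φ) t w hw hφ s r x)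
    rw [h3, mul_zero, zero_mul] at h6
    exact enorm_eq_zero.1 (le_antisymm h6 zero_le)
  have h7 : EqOn (fun r => ∫ ξ, S.iter wt (fun _ => φ) k r t (S.step s r x ξ) • χ s r x ξ ∂S.γ)
      (fun r => ∫ ξ, S.iter wt (fun _ => φ) k r t (S.step s r x ξ) ∂S.γ) (Ioo s t) := by
    intro r hr
    simp only [h.ind_eq s r _ _ (hv.left_of_mem_Ioo hr), smul_eq_mul, mul_one]
  refine ⟨h1.integrableOn.congr_fun h7 measurableSet_Ioo, ?_⟩
  rw [← setIntegral_congr_fun measurableSet_Ioo h7]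
  exact setIntegral_eq_integral_of_forall_compl_eq_zero h2

/-- Applying ⟨B, D·⟩ to the k-th summand replaces its first weight by `wt`, and the subsequent
transition and time integration prepend an unweighted step. The k-th summand thus becomes the
(k+1)-st, and u^0 supplies the zeroth. -/
theorem iterU_eq (n : ℕ) {s t : ℝ} (hv : Valid T s t) (x : E d) :
    iterU P Z B φ n s t x = ∑ k ∈ Finset.range (n + 1), S.pull wt χ (fun _ => φ) k s t x := by
  have h0 {s t : ℝ} (hv : Valid T s t) (x : E d) :
      evol P Z s t φ x = S.pull wt χ (fun _ => φ) 0 s t x := by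
    rw [h.evol_eq hv h.meas]
    simp only [StepSystem.pull, h.ind_eq s t _ _ hv, smul_eq_mul, mul_one]
  induction n generalizing s t x with
  | zero => simpa [iterU] using h0 hv x
  | succ n ih =>
    rw [Finset.sum_range_succ', ← h0 hv x, add_comm _ (evol P Z s t φ x)]
    change evol P Z s t φ x + _ = _
    rw [add_right_inj, intervalIntegral.integral_of_le hv.2.1.le, integral_Ioc_eq_integral_Ioo]
    have h1 : EqOn (fun r => evol P Z s r
        (fun y => inner ℝ (B r y) (gradient (iterU P Z B φ n r t) y)) x)
        (fun r => ∑ k ∈ Finset.range (n + 1),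
          ∫ ξ, S.iter wt (fun _ => φ) k r t (S.step s r x ξ) ∂S.γ) (Ioo s t) := by
      intro r hr
      have hvr := hv.right_of_mem_Ioo hr
      have hvl := hv.left_of_mem_Ioo hr
      simp only
      rw [funext fun y => ih hvr y]
      simp only [h.inner_gradient_sum]
      rw [h.evol_eq hvl (Finset.measurable_fun_sum _ fun k _ => h.measurable_iter_right k r t),
        integral_finsetSum _ fun k _ => h.integrable_iter_step k hvl x]
    rw [setIntegral_congr_fun measurableSet_Ioo h1,
      integral_finsetSum _ fun k _ => (h.integral_iter_step k hv x).1]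
    exact Finset.sum_congr rfl fun k _ => (h.integral_iter_step k hv x).2

lemma differentiable_iterU (n : ℕ) {s t : ℝ} (hv : Valid T s t) :
    Differentiable ℝ (iterU P Z B φ n s t) := by
  rw [funext fun y => h.iterU_eq n hv y]
  exact fun x => (h.hasGradientAt_sum (n + 1) s t x).hasFDerivAt.differentiableAt

lemma inner_gradient_iterU (n : ℕ) {s t : ℝ} (hv : Valid T s t) :
    (fun y => inner ℝ (B s y) (gradient (iterU P Z B φ n s t) y))
      = fun y => ∑ k ∈ Finset.range (n + 1), S.iter wt (fun _ => φ) k s t y := by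
  rw [funext fun y => h.iterU_eq n hv y]
  exact funext fun y => h.inner_gradient_sum (n + 1) s t y

lemma integrable_inner_gradient (n : ℕ) {s r t : ℝ} (hv : Valid T s t) (hr : r ∈ Ioo s t)
    (x : E d) : Integrable (fun ω => inner ℝ (B r (Z s x r ω))
      (gradient (iterU P Z B φ n r t) (Z s x r ω))) P := by
  have h1 := h.inner_gradient_iterU n (hv.right_of_mem_Ioo hr)
  -- Measurability of ⟨B, Du⟩ is read off from its kernel representation rather than from the
  -- gradient.
  have h2 : Measurable fun y => ∑ k ∈ Finset.range (n + 1), S.iter wt (fun _ => φ) k r t y :=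
    Finset.measurable_fun_sum _ fun k _ => h.measurable_iter_right k r t
  rw [← h1] at h2
  rw [h.integrable_iff (hv.left_of_mem_Ioo hr) h2]
  simp only [fun y => congrFun h1 y]
  exact integrable_finsetSum _ fun k _ => h.integrable_iter_step k (hv.left_of_mem_Ioo hr) x

lemma intervalIntegrable_evol (n : ℕ) {s t : ℝ} (hv : Valid T s t) (x : E d) :
    IntervalIntegrable (fun r => evol P Z s r (fun y => inner ℝ (B r y)
      (gradient (iterU P Z B φ n r t) y)) x) volume s t := by
  rw [intervalIntegrable_iff_integrableOn_Ioo_of_le hv.2.1.le]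
  have h1 : IntegrableOn (fun r => ∑ k ∈ Finset.range (n + 1),
      ∫ ξ, S.iter wt (fun _ => φ) k r t (S.step s r x ξ) ∂S.γ) (Ioo s t) :=
    integrable_finsetSum _ fun k _ => (h.integral_iter_step k hv x).1
  refine h1.congr_fun (fun r hr => ?_) measurableSet_Ioo
  have hvl := hv.left_of_mem_Ioo hr
  simp only
  rw [h.inner_gradient_iterU n (hv.right_of_mem_Ioo hr),
    h.evol_eq hvl (Finset.measurable_fun_sum _ fun k _ => h.measurable_iter_right k r t),
    integral_finsetSum _ fun k _ => h.integrable_iter_step k hvl x]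

lemma incrV_eq (n : ℕ) {s t : ℝ} (hv : Valid T s t) (x : E d) :
    incrV P Z B φ n s t x = S.pull wt χ (fun _ => φ) n s t x := by
  cases n with
  | zero => simpa [incrV] using h.iterU_eq 0 hv x
  | succ n =>
    change iterU P Z B φ (n + 1) s t x - iterU P Z B φ n s t x = _
    rw [h.iterU_eq _ hv, h.iterU_eq _ hv, Finset.sum_range_succ, add_sub_cancel_left]

end IterationData

end Iteration

end ShiftedOU

namespace ShiftedOU

/-! ### Bounds for the shifted drift, and random weights as iterated integrals. -/

section Weights

open Set
open scoped ENNReal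

variable {d : ℕ} {T : ℝ} {A Q : Matrix (Fin d) (Fin d) ℝ} {f : ℝ → E d} {B₀ B : ℝ → E d → E d}
  {φ : E d → ℝ} {Ω : Type*} [mΩ : MeasurableSpace Ω] {P : Measure Ω}

lemma measurable_indicator_shiftedDrift
    (hB : Measurable fun p : Icc (0 : ℝ) T × E d => B₀ p.1 p.2) (hf : ContinuousOn f (Icc 0 T)) :
    Measurable fun p : ℝ × E d => (Icc 0 T).indicator (fun s => shiftedDrift B₀ f s p.2) p.1 := by
  have hS : MeasurableSet {p : ℝ × E d | p.1 ∈ Icc 0 T} := measurable_fst measurableSet_Icc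
  have hfm : Measurable fun t : Icc (0 : ℝ) T => f t :=
    (continuousOn_iff_continuous_domRestrict.1 hf).measurable
  refine measurable_of_restrict_of_restrict_compl hS ?_ ?_
  · have h1 : Measurable fun p : {p : ℝ × E d | p.1 ∈ Icc 0 T} =>
        ((⟨p.1.1, p.2⟩ : Icc (0 : ℝ) T), p.1.2) := by fun_prop
    have h2 := (hB.comp h1).sub (hfm.comp (measurable_fst.comp h1))
    convert h2 using 1
    ext1 p
    change (Icc 0 T).indicator (fun s => shiftedDrift B₀ f s p.1.2) p.1.1 = _
    exact indicator_of_mem (show p.1.1 ∈ Icc 0 T from p.2) _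
  · convert measurable_const (a := (0 : E d)) using 1
    ext1 p
    change (Icc 0 T).indicator (fun s => shiftedDrift B₀ f s p.1.2) p.1.1 = _
    exact indicator_of_notMem (show p.1.1 ∉ Icc 0 T from p.2) _

lemma exists_enorm_shiftedDrift_le
    (hB : ∃ (C : ℝ) (m : ℕ), ∀ t ∈ Icc (0 : ℝ) T, ∀ x, ‖B₀ t x‖ ≤ C * (1 + ‖x‖) ^ m)
    (hf : ContinuousOn f (Icc 0 T)) :
    ∃ (C : ℝ≥0) (m : ℕ), ∀ s ∈ Icc 0 T, ∀ x, ‖shiftedDrift B₀ f s x‖ₑ ≤ C * (1 + ‖x‖ₑ) ^ m := by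
  obtain ⟨C, m, h⟩ := hB
  obtain ⟨K, hK⟩ := isCompact_Icc.exists_bound_of_continuousOn hf
  refine ⟨‖C‖₊ + ‖K‖₊, m, fun s hs x => ?_⟩
  have h1 : (1 : ℝ) ≤ (1 + ‖x‖) ^ m := one_le_pow₀ (by linarith [norm_nonneg x])
  have h2 : ‖shiftedDrift B₀ f s x‖ ≤ (‖C‖ + ‖K‖) * (1 + ‖x‖) ^ m := by
    calc _ ≤ ‖B₀ s x‖ + ‖f s‖ := norm_sub_le _ _
      _ ≤ C * (1 + ‖x‖) ^ m + K := add_le_add (h s hs x) (hK s hs)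
      _ ≤ ‖C‖ * (1 + ‖x‖) ^ m + ‖K‖ * (1 + ‖x‖) ^ m := by
          refine add_le_add ?_ ?_
          · gcongr
            exact Real.le_norm_self C
          · exact (Real.le_norm_self K).trans (le_mul_of_one_le_right (norm_nonneg _) h1)
      _ = _ := by ring
  have h3 : ‖shiftedDrift B₀ f s x‖₊ ≤ (‖C‖₊ + ‖K‖₊) * (1 + ‖x‖₊) ^ m := by
    rw [← NNReal.coe_le_coe]
    simpa using h2
  rw [enorm_eq_nnnorm, enorm_eq_nnnorm]
  exact_mod_cast h3

lemma integrand_eq (X : ℝ → Ω → E d) (t : ℝ) (n : ℕ) (σ : Fin n → ℝ) (ω : Ω) :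
    integrand A Q f B φ X t n σ ω = φ (X t ω) * chain (pairing A Q f B X) n σ t ω := rfl

/-- For a fixed path, the last factor of the chain is constant in the earlier times and leaves the
inner integrals, which is exactly the recursion for I^n; no integrability enters. -/
lemma iteratedIntegral_chain (X : ℝ → Ω → E d) (s : ℝ) (ω : Ω) (n : ℕ) {t : ℝ} (hst : s ≤ t) :
    iteratedIntegral s n (fun σ => chain (pairing A Q f B X) n σ t ω) t
      = iterI A Q f B X s n t ω := by
  induction n generalizing t with
  | zero => simp [iteratedIntegral, chain_zero, iterI]
  | succ n ih =>
    change _ = ∫ r in s..t, pairing A Q f B X r t ω * iterI A Q f B X s n r ω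
    rw [iteratedIntegral_succ hst, intervalIntegral.integral_of_le hst,
      integral_Ioc_eq_integral_Ioo]
    refine setIntegral_congr_fun measurableSet_Ioo fun r hr => ?_
    simp only [chain_succ]
    simp_rw [mul_comm (chain _ _ _ _ _)]
    rw [iteratedIntegral_const_mul, ih hr.1.le]

lemma pairing_congr {X Y : ℝ → Ω → E d} {s : ℝ} {ω : Ω} (h : ∀ t ∈ Icc s T, X t ω = Y t ω)
    {r t : ℝ} (hr : r ∈ Icc s T) (ht : t ∈ Icc s T) :
    pairing A Q f B X r t ω = pairing A Q f B Y r t ω := by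
  rw [pairing, pairing, h r hr, h t ht]

lemma chain_congr {X Y : ℝ → Ω → E d} {s : ℝ} {ω : Ω} (h : ∀ t ∈ Icc s T, X t ω = Y t ω)
    {n : ℕ} {t : ℝ} (ht : t ≤ T) {σ : Fin n → ℝ} (hσ : σ ∈ timeSimplex n s t) :
    chain (pairing A Q f B X) n σ t ω = chain (pairing A Q f B Y) n σ t ω := by
  refine Finset.prod_congr rfl fun i _ => ?_
  obtain ⟨h1, h2, h3⟩ := chain_eq_of_mem hσ i
  exact pairing_congr h ⟨h1.le, h2.le.trans (h3.trans ht)⟩ ⟨(h1.trans h2).le, h3.trans ht⟩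

end Weights

/-! ### The two representation formulas. -/

section Representation

open Set
open scoped ENNReal

variable {d : ℕ} {T : ℝ} {A Q : Matrix (Fin d) (Fin d) ℝ} {f : ℝ → E d} {B : ℝ → E d → E d}
  {φ : E d → ℝ} {Ω : Type*} [mΩ : MeasurableSpace Ω] {P : Measure Ω} [IsProbabilityMeasure P]
  {S : StepSystem (E d)} {wt χ : ℝ → ℝ → E d → E d → ℝ} {wv : ℝ → ℝ → E d → E d → E d}
  {Z : ℝ → E d → ℝ → Ω → E d} {s : ℝ} {x : E d} {Y : ℝ → Ω → E d}

namespace IterationData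

variable (h : IterationData S wt χ wv B T P Z φ)
  (hR : S.Realization wt P s T x Y (pairing A Q f B Y))
  (hZY : ∀ᵐ ω ∂P, ∀ t ∈ Icc s T, Z s x t ω = Y t ω)
include h hR hZY

lemma integrable_integrand (hs : 0 ≤ s) {n : ℕ} {t : ℝ} (hst : s < t) (htT : t ≤ T)
    {σ : Fin n → ℝ} (hσ : σ ∈ timeSimplex n s t) :
    Integrable (integrand A Q f B φ (Z s x) t n σ) P := by
  obtain ⟨w, hw, hφ⟩ := h.bdd
  refine (hR.integrable_terminal_chain h.wt_adm h.ind_adm (ψ := fun _ => φ) (k := 0)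
    (fun t h1 h2 ξ => h.ind_eq s t x ξ ⟨hs, h1, h2⟩) h.measurable_const_terminal hst htT hw hφ
    hσ).congr ?_
  filter_upwards [hZY] with ω hω
  rw [integrand_eq, hω t ⟨hst.le, htT⟩, chain_congr hω htT hσ]

lemma integrable_integrand_prod (hs : 0 ≤ s) (n : ℕ) {t : ℝ} (hst : s < t) (htT : t ≤ T) :
    Integrable (fun p : (Fin n → ℝ) × Ω => integrand A Q f B φ (Z s x) t n p.1 p.2)
      ((volume.restrict (timeSimplex n s t)).prod P) := by
  obtain ⟨w, hw, hφ⟩ := h.bdd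
  refine (hR.integrable_terminal_chain_prod h.wt_adm h.ind_adm (ψ := fun _ => φ) (k := 0)
    (fun t h1 h2 ξ => h.ind_eq s t x ξ ⟨hs, h1, h2⟩) h.measurable_const_terminal n hst htT hw
    hφ).congr ?_
  have h1 : ∀ᵐ q ∂((volume.restrict (timeSimplex n s t)).prod P), q.1 ∈ timeSimplex n s t :=
    Measure.quasiMeasurePreserving_fst.ae (ae_restrict_mem (measurableSet_timeSimplex n s t))
  filter_upwards [h1, Measure.quasiMeasurePreserving_snd.ae hZY] with q hq hω
  rw [integrand_eq, hω t ⟨hst.le, htT⟩, chain_congr hω htT hq]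

theorem incrV_eq_iteratedIntegral (hs : 0 ≤ s) (n : ℕ) {t : ℝ} (hst : s < t) (htT : t ≤ T) :
    incrV P Z B φ n s t x =
      iteratedIntegral s n (fun σ => ∫ ω, integrand A Q f B φ (Z s x) t n σ ω ∂P) t := by
  obtain ⟨w, hw, hφ⟩ := h.bdd
  rw [h.incrV_eq n ⟨hs, hst, htT⟩, ← hR.iteratedIntegral_terminal_chain h.wt_adm h.ind_adm
    (ψ := fun _ => φ) (k := 0)
    (fun t h1 h2 ξ => h.ind_eq s t x ξ ⟨hs, h1, h2⟩)
    (fun s t hst => h.sing_eq s t fun hv => hst hv.2.1) n h.measurable_const_terminal hst htT hw hφ]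
  refine iteratedIntegral_congr hst.le fun σ hσ => integral_congr_ae ?_
  filter_upwards [hZY] with ω hω
  rw [integrand_eq, hω t ⟨hst.le, htT⟩, chain_congr hω htT hσ]

lemma ae_integrableOn_chain (hs : 0 ≤ s) (n : ℕ) {t : ℝ} (hst : s < t) (htT : t ≤ T) :
    ∀ᵐ ω ∂P, IntegrableOn (fun σ => chain (pairing A Q f B (Z s x)) n σ t ω)
      (timeSimplex n s t) := by
  -- The terminal function is taken to be 1, since φ may vanish and then gives no control of the
  -- weights themselves.
  have h1 := (hR.integrable_terminal_chain_prod h.wt_adm h.ind_adm (ψ := fun _ _ => 1)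
    (fun t h1 h2 ξ => h.ind_eq s t x ξ ⟨hs, h1, h2⟩) measurable_const n hst htT (w := 1) (k := 0)
    ENNReal.one_ne_top (by simp)).prod_left_ae
  filter_upwards [h1, hZY] with ω hω hZω
  refine IntegrableOn.congr_fun (f := fun σ => chain (pairing A Q f B Y) n σ t ω) ?_
    (fun σ hσ => (chain_congr hZω htT hσ).symm) (measurableSet_timeSimplex n s t)
  simpa [IntegrableOn] using hω

theorem ae_intervalIntegrable (hs : 0 ≤ s) (n : ℕ) {t : ℝ} (hst : s < t) (htT : t ≤ T) :
    ∀ᵐ ω ∂P, IntervalIntegrable (fun r => pairing A Q f B (Z s x) r t ω *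
      iterI A Q f B (Z s x) s n r ω) volume s t := by
  filter_upwards [h.ae_integrableOn_chain hR hZY hs (n + 1) hst htT] with ω hω
  rw [intervalIntegrable_iff_integrableOn_Ioo_of_le hst.le]
  refine (integrableOn_iteratedIntegral hω).congr_fun (fun r hr => ?_) measurableSet_Ioo
  simp only [chain_succ]
  simp_rw [mul_comm (chain _ _ _ _ _)]
  rw [iteratedIntegral_const_mul, iteratedIntegral_chain _ _ _ _ hr.1.le]

/-- Fubini on simplex times Ω applied to formula (a): integrating over the times first leaves φ(Z_t)
I^n, because the iterated time integral of the chain is I^n for almost every path. -/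
theorem integral_weight (hs : 0 ≤ s) (n : ℕ) {t : ℝ} (hst : s < t) (htT : t ≤ T) :
    Integrable (fun ω => φ (Z s x t ω) * iterI A Q f B (Z s x) s n t ω) P ∧
    incrV P Z B φ n s t x = ∫ ω, φ (Z s x t ω) * iterI A Q f B (Z s x) s n t ω ∂P := by
  have h1 := h.integrable_integrand_prod hR hZY hs n hst htT
  have h2 : (fun ω => ∫ σ in timeSimplex n s t, integrand A Q f B φ (Z s x) t n σ ω) =ᵐ[P]
      fun ω => φ (Z s x t ω) * iterI A Q f B (Z s x) s n t ω := by
    filter_upwards [h.ae_integrableOn_chain hR hZY hs n hst htT] with ω hω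
    simp only [integrand_eq]
    rw [integral_const_mul, setIntegral_timeSimplex hst.le hω, iteratedIntegral_chain _ _ _ _ hst.le]
  refine ⟨h1.integral_prod_right.congr h2, ?_⟩
  rw [h.incrV_eq_iteratedIntegral hR hZY hs n hst htT,
    ← setIntegral_timeSimplex hst.le h1.integral_prod_left, integral_integral_swap h1]
  exact integral_congr_ae h2

end IterationData

end Representation

end ShiftedOU

namespace ShiftedOU

/-! ### Assembling the Ornstein–Uhlenbeck data and the main theorem. -/

section Assembly

open Set
open scoped ENNReal

variable {d : ℕ} {T : ℝ} {A Q : Matrix (Fin d) (Fin d) ℝ} {f : ℝ → E d} {B : ℝ → E d → E d}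
  {φ : E d → ℝ} {Ω : Type*} [mΩ : MeasurableSpace Ω] {P : Measure Ω}
  {W' : ℝ≥0 → Ω → E d} {Z : ℝ → E d → ℝ → Ω → E d}

theorem iterationData_ouSystem (hQ : Q.PosDef) (hf : ContinuousOn f (Icc 0 T))
    (hB : Measurable fun p : ℝ × E d => (Icc 0 T).indicator (fun s => B s p.2) p.1)
    {C : ℝ≥0} {m : ℕ} (hBg : ∀ s ∈ Icc 0 T, ∀ x, ‖B s x‖ₑ ≤ C * (1 + ‖x‖ₑ) ^ m)
    (hφ_meas : Measurable φ) (hφ_bdd : ∃ C : ℝ, ∀ x, |φ x| ≤ C)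
    (hR : ∀ s ∈ Icc 0 T, ∀ x, (ouSystem T A hQ hf).Realization (ouWt A Q B T) P s T x
      (ouProcess A Q f W' s x) (pairing A Q f B (ouProcess A Q f W' s x)))
    (hZ : ∀ s ∈ Icc 0 T, ∀ x, ∀ᵐ ω ∂P, ∀ t ∈ Icc s T, Z s x t ω = ouProcess A Q f W' s x t ω) :
    IterationData (ouSystem T A hQ hf) (ouWt A Q B T) (ouInd T) (ouVec A Q T) B T P Z φ := by
  -- Almost surely Z is the step map applied to one Gaussian variable, which yields both its
  -- measurability and its law.
  have key (s t : ℝ) (x : E d) (hv : Valid T s t) : ∃ N : Ω → E d, Measurable N ∧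
      P.map N = (ouSystem T A hQ hf).γ ∧ Z s x t =ᵐ[P] (ouSystem T A hQ hf).step s t x ∘ N := by
    obtain ⟨N, hN, hNγ, hNY⟩ := (hR s hv.mem_left x).start t hv.2.1 hv.2.2
    refine ⟨N, hN, hNγ, ?_⟩
    filter_upwards [hNY, hZ s hv.mem_left x] with ω h1 h2
    rw [h2 t ⟨hv.2.1.le, hv.2.2⟩, h1, Function.comp_apply]
  refine ⟨admissible_ouWt hQ hf hB hBg, admissible_ouInd hQ hf, admissible_ouVec hQ hf,
    hasGradientWeight_ouSystem hQ hf, fun s t x ξ => rfl, fun s t x ξ hv => if_pos hv,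
    fun s t hv => if_neg hv, fun s t x hv => ?_, fun s t x hv => ?_, hφ_meas, ?_⟩
  · obtain ⟨N, hN, -, hNZ⟩ := key s t x hv
    exact ⟨_, (IterationData.measurable_step _ s t x).comp hN, hNZ⟩
  · obtain ⟨N, hN, hNγ, hNZ⟩ := key s t x hv
    rw [Measure.map_congr hNZ, ← Measure.map_map (IterationData.measurable_step _ s t x) hN, hNγ]
  · obtain ⟨K, hK⟩ := hφ_bdd
    refine ⟨ENNReal.ofReal K, ENNReal.ofReal_ne_top, fun z => ?_⟩
    rw [pow_zero, mul_one, ← ofReal_norm]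
    exact ENNReal.ofReal_le_ofReal (hK z)

end Assembly

end ShiftedOU
theorem mainTheorem1 {Ω : Type*} [MeasurableSpace Ω] (P : Measure Ω) [IsProbabilityMeasure P]
    {d : ℕ} (A Q : Matrix (Fin d) (Fin d) ℝ) (hA : (-A).PosDef) (hQ : Q.PosDef) (T : ℝ)
    (W : ℝ≥0 → Ω → ShiftedOU.E d) (hW : ShiftedOU.IsBrownianMotion W P)
    (f : ℝ → ShiftedOU.E d) (hf : ContinuousOn f (Set.Icc 0 T))
    (B₀ : ℝ → ShiftedOU.E d → ShiftedOU.E d)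
    (hB_meas : Measurable (fun p : Set.Icc (0 : ℝ) T × ShiftedOU.E d => B₀ p.1 p.2))
    (hB_growth : ∃ (C : ℝ) (m : ℕ), ∀ t ∈ Set.Icc (0 : ℝ) T, ∀ x, ‖B₀ t x‖ ≤ C * (1 + ‖x‖) ^ m)
    (Z : ℝ → ShiftedOU.E d → ℝ → Ω → ShiftedOU.E d)
    (hZ : ∀ s ∈ Set.Icc (0 : ℝ) T, ∀ x, ShiftedOU.IsSolution A Q f W P T s x (Z s x))
    (φ : ShiftedOU.E d → ℝ) (hφ_meas : Measurable φ) (hφ_bdd : ∃ C : ℝ, ∀ x, |φ x| ≤ C)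
    (B : ℝ → ShiftedOU.E d → ShiftedOU.E d) (hB : B = ShiftedOU.shiftedDrift B₀ f) :
    -- the iteration scheme is well defined
    (∀ (n : ℕ) (s t : ℝ), 0 ≤ s → s < t → t ≤ T →
      Differentiable ℝ (ShiftedOU.iterU P Z B φ n s t) ∧
      ∀ x,
        (∀ r ∈ Set.Ioo s t, Integrable (fun ω => inner ℝ (B r (Z s x r ω))
          (gradient (ShiftedOU.iterU P Z B φ n r t) (Z s x r ω))) P) ∧
        IntervalIntegrable (fun r => ShiftedOU.evol P Z s r (fun y => inner ℝ (B r y)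
          (gradient (ShiftedOU.iterU P Z B φ n r t) y)) x) volume s t) ∧
    -- the formula for the increments as iterated time integrals
    (∀ (n : ℕ) (s t : ℝ) (x : ShiftedOU.E d), 1 ≤ n → 0 ≤ s → s < t → t ≤ T →
      (∀ σ ∈ ShiftedOU.timeSimplex n s t,
        Integrable (ShiftedOU.integrand A Q f B φ (Z s x) t n σ) P) ∧
      Integrable (fun p : (Fin n → ℝ) × Ω => ShiftedOU.integrand A Q f B φ (Z s x) t n p.1 p.2)
        ((volume.restrict (ShiftedOU.timeSimplex n s t)).prod P) ∧
      ShiftedOU.incrV P Z B φ n s t x =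
        ShiftedOU.iteratedIntegral s n
          (fun σ => ∫ ω, ShiftedOU.integrand A Q f B φ (Z s x) t n σ ω ∂P) t) ∧
    -- the formula through the recursively defined random weights
    (∀ (n : ℕ) (s t : ℝ) (x : ShiftedOU.E d), 0 ≤ s → s < t → t ≤ T →
      (∀ᵐ ω ∂P, IntervalIntegrable (fun r => ShiftedOU.pairing A Q f B (Z s x) r t ω *
        ShiftedOU.iterI A Q f B (Z s x) s n r ω) volume s t) ∧
      Integrable (fun ω => φ (Z s x t ω) * ShiftedOU.iterI A Q f B (Z s x) s n t ω) P ∧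
      ShiftedOU.incrV P Z B φ n s t x =
        ∫ ω, φ (Z s x t ω) * ShiftedOU.iterI A Q f B (Z s x) s n t ω ∂P) := by
  subst hB
  -- The path constructions need continuity for every ω; the solutions are unaffected, since they
  -- are determined by the noise only almost surely.
  obtain ⟨W', hm, hc, hW', hWW'⟩ := hW.exists_modification
  have hB := ShiftedOU.measurable_indicator_shiftedDrift hB_meas hf
  obtain ⟨C, m, hBg⟩ := ShiftedOU.exists_enorm_shiftedDrift_le hB_growth hf
  have hflow := fun s hs x => (hZ s hs x).ae_flow hs hf hWW' hc
  have hR := fun s (hs : s ∈ Set.Icc (0 : ℝ) T) x =>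
    ShiftedOU.realization_ouProcess hW' hm hc hQ hf hB hs.1 x ((hflow s hs x).mono fun _ h => h.2)
  have hY := fun s (hs : s ∈ Set.Icc (0 : ℝ) T) x => (hflow s hs x).mono fun _ h => h.1
  have hD := ShiftedOU.iterationData_ouSystem hQ hf hB hBg hφ_meas hφ_bdd hR hY
  refine ⟨fun n s t hs hst htT => ⟨hD.differentiable_iterU n ⟨hs, hst, htT⟩, fun x =>
    ⟨fun r hr => hD.integrable_inner_gradient n ⟨hs, hst, htT⟩ hr x,
      hD.intervalIntegrable_evol n ⟨hs, hst, htT⟩ x⟩⟩,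
    fun n s t x _ hs hst htT => ?_, fun n s t x hs hst htT => ?_⟩
  · have hsT : s ∈ Set.Icc 0 T := ⟨hs, hst.le.trans htT⟩
    exact ⟨fun σ hσ => hD.integrable_integrand (hR s hsT x) (hY s hsT x) hs hst htT hσ,
      hD.integrable_integrand_prod (hR s hsT x) (hY s hsT x) hs n hst htT,
      hD.incrV_eq_iteratedIntegral (hR s hsT x) (hY s hsT x) hs n hst htT⟩
  · have hsT : s ∈ Set.Icc 0 T := ⟨hs, hst.le.trans htT⟩
    exact ⟨hD.ae_intervalIntegrable (hR s hsT x) (hY s hsT x) hs n hst htT,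
      hD.integral_weight (hR s hsT x) (hY s hsT x) hs n hst htT⟩
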